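/- **Conventions.** All Hilbert manifolds are smooth ($C^\infty$), Hausdorff, second countable, without boundary and modelled on a real Hilbert space. An *lc-manifold of depth $\le 1$* is a second countable Hausdorff space $P$ with a closed subset $\partial P$ such that $\partial P$ and $P\setminus\partial P$ are Hilbert manifolds, and every $p\in\partial P$ has an open neighbourhood $U\subset\partial P$ and an open embedding $c:U\times[0,\varepsilon)\to P$ (an lc-chart) with $c(u,0)=u$, restricting to a diffeomorphism of $U\times(0,\varepsilon)$ onto an open subset of $P\setminus\partial P$. A continuous map $\sigma:P\to B$ to a Hilbert manifold is *lc-smooth* if it is smooth on $\partial P$ and on $P\setminus\partial P$ and each $p\in\partial P$ lies in an lc-chart in which the derivative of $\sigma$ in the $U$-direction is continuous on $U\times[0,\varepsilon)$. A *Floer space* $(B,\mathcal A)$ is a Hilbert manifold $B$ with a coarser "weak" topology, a continuous function $\mathcal A:B\to\mathbb R$ and a smooth splitting $TB=T^+B\oplus T^-B$ with projections $\Pi^\pm$, where the fibres of $T^+B$, and those of $T^-B$, are all isomorphic (automatic if $B$ is connected). Weak semicontinuity and precompactness are understood sequentially: a set is weakly precompact if each sequence in it has a subsequence converging weakly in $B$,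 and $h$ is weakly lower semicontinuous on a set $S$ if $h(y)\le\liminf h(s_i)$ whenever $s_i\in S$ converges weakly to a point $y$ of the ambient space. A *chain* is an lc-smooth map $\sigma:P\to B$ from an lc-manifold of depth $\le 1$ such that 1. on $\operatorname{im}\sigma$, $\mathcal A$ is bounded below and weakly lower semicontinuous; 2. if $\sigma(x_i)\to y\in B$ weakly and $\mathcal A(\sigma(x_i))\to\mathcal A(y)$, then a subsequence of $x_i$ converges in $P$; 3. every subset of $\operatorname{im}\sigma$ on which $\mathcal A$ is bounded is weakly precompact; 4. on each stratum of $P$, at each point, $\Pi^-\circ D\sigma$ is Fredholm as a map to $T^-B$ and $\Pi^+\circ D\sigma$ is compact. It has index $n$ if $\Pi^-\circ D\sigma$ has index $n$ at each point of $P\setminus\partial P$; a *cycle* is a chain with $\partial P=\emptyset$. $\mathrm{Bord}_n(B,\mathcal A)$ is the $\mathbb Z/2$-vector space generated by the isomorphism classes of cycles of index $n$, with the relations $[\sigma\sqcup\tau]=[\sigma]+[\tau]$, and $[\sigma]=0$ if $\sigma=\partial W$ for a chain $W$ of index $n+1$. A *correspondence without boundary* from $(B_0,\mathcal A_0)$ to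 $(B_1,\mathcal A_1)$ is a smooth map $F=(f_0,f_1):Z\to B_0\times B_1$ from a Hilbert manifold $Z$ such that 1. on $\operatorname{im}F$, $\mathcal A_1-\mathcal A_0$ is bounded below and weakly lower semicontinuous; 2. if $\mathcal A_1(f_1(z_i))$ is bounded above and $(f_0(z_i))$ is weakly precompact, then $(f_1(z_i))$ is weakly precompact; 3. if $f_0(z_i)\to w$ strongly, $f_1(z_i)\to y$ weakly and $\mathcal A_1(f_1(z_i))-\mathcal A_0(f_0(z_i))\to\mathcal A_1(y)-\mathcal A_0(w)$, then a subsequence of $z_i$ converges in $Z$; 4. at each $z\in Z$, $(\Pi_0^+Df_0,\Pi_1^-Df_1):T_zZ\to T^+B_0\oplus T^-B_1$ is Fredholm, and for every bounded sequence $v_i\in T_zZ$ such that $\Pi_0^+Df_0(v_i)$ converges, $\{\Pi_1^+Df_1(v_i)\}$ is precompact; 5. $Df_0:T_zZ\to T_{f_0(z)}B_0$ has dense range at each $z\in Z$. It has index $k$ if the Fredholm operator in 4 has index $k$ at each point. **Lemma.** Let $F:Z\to B_0\times B_1$ be a correspondence of index $k$ without boundary. (a) For every cycle $\sigma:P\to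 B_0$ of index $n$, the fibre product $P\times_{B_0}Z=\{(p,z):\sigma(p)=f_0(z)\}$ is an embedded submanifold of $P\times Z$, and $f_1\circ\mathrm{pr}_Z:P\times_{B_0}Z\to B_1$ is a cycle of index $n+k$, denoted $\sigma\times_{B_0}F$. (b) For every chain $W:P\to B_0$ of index $m$, the fibre product $P\times_{B_0}Z$, with boundary $\partial P\times_{B_0}Z$ and open stratum $(P\setminus\partial P)\times_{B_0}Z$ (with their structures of embedded submanifolds of $\partial P\times Z$ and $(P\setminus\partial P)\times Z$), is an lc-manifold of depth $\le1$, and $f_1\circ\mathrm{pr}_Z$ is a chain $W\times_{B_0}F$ in $B_1$ of index $m+k$; moreover $\partial(W\times_{B_0}F)=\partial W\times_{B_0}F$. (c) $[\sigma]\mapsto[\sigma\times_{B_0}F]$ defines a (unique) family of $\mathbb Z/2$-linear maps $\mathrm{Bord}_n(B_0,\mathcal A_0)\to\mathrm{Bord}_{n+k}(B_1,\mathcal A_1)$, $n\in\mathbb Z$; that is, $F$ induces a homomorphism $\mathrm{Bord}_*(B_0,\mathcal A_0)\to\mathrm{Bord}_{*+k}(B_1,\mathcal A_1)$. -/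

import Mathlib

open Set Filter Topology Function
open scoped Manifold ContDiff

universe u

noncomputable section

namespace FloerBordism

/-! ## Sequential notions for a possibly coarser topology `t` -/

/-- Every sequence in `S` has a subsequence converging, for `t`, to some point of `X`. -/
def SeqPrecompact {X : Type u} (t : TopologicalSpace X) (S : Set X) : Prop :=
  ∀ s : ℕ → X, (∀ i, s i ∈ S) →
    ∃ y, ∃ φ : ℕ → ℕ, StrictMono φ ∧ Tendsto (s ∘ φ) atTop (@nhds X t y)

/-- `f y ≤ liminf f (s i)` for every sequence `s` in `S` converging, for `t`, to a point
`y` of `X` (the limit `y` need not lie in `S`). -/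
def SeqLowerSemicontinuous {X : Type u} (t : TopologicalSpace X) (f : X → ℝ) (S : Set X) : Prop :=
  ∀ s : ℕ → X, (∀ i, s i ∈ S) → ∀ y, Tendsto s atTop (@nhds X t y) →
    ∀ a < f y, ∀ᶠ i in atTop, a < f (s i)

/-- The index `dim ker T - dim coker T` of a Fredholm operator. -/
def fredholmIndex {V W : Type u} [NormedAddCommGroup V] [NormedSpace ℝ V]
    [NormedAddCommGroup W] [NormedSpace ℝ W] (T : V →L[ℝ] W) : ℤ :=
  (Module.finrank ℝ T.ker : ℤ) - (Module.finrank ℝ (W ⧸ T.range) : ℤ)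

/-! ## Hilbert manifolds -/

/-- A separable (second countable, Hausdorff) smooth manifold without boundary modelled on a real
Hilbert space. -/
structure HilbertManifold : Type (u + 1) where
  carrier : Type u
  model : Type u
  [normedModel : NormedAddCommGroup model]
  [innerModel : InnerProductSpace ℝ model]
  [completeModel : CompleteSpace model]
  [topology : TopologicalSpace carrier]
  [hausdorff : T2Space carrier]
  [secondCountable : SecondCountableTopology carrier]
  [charted : ChartedSpace model carrier]
  [smooth : IsManifold 𝓘(ℝ, model) ∞ carrier]

instance : CoeSort HilbertManifold.{u} (Type u) := ⟨HilbertManifold.carrier⟩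

attribute [instance] HilbertManifold.normedModel HilbertManifold.innerModel
  HilbertManifold.completeModel HilbertManifold.topology HilbertManifold.hausdorff
  HilbertManifold.secondCountable HilbertManifold.charted HilbertManifold.smooth

/-- Smooth (`C^∞`) maps of Hilbert manifolds. -/
def Smooth (M N : HilbertManifold.{u}) (f : M → N) : Prop :=
  ContMDiff 𝓘(ℝ, M.model) 𝓘(ℝ, N.model) ∞ f

/-- The differential `T_x M → T_{f x} N`; Mathlib's tangent spaces are copies of the model. -/
def differential (M N : HilbertManifold.{u}) (f : M → N) (x : M) : M.model →L[ℝ] N.model :=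
  mfderiv 𝓘(ℝ, M.model) 𝓘(ℝ, N.model) f x

/-- Diffeomorphisms of Hilbert manifolds. -/
abbrev Diffeo (M N : HilbertManifold.{u}) : Type u :=
  Diffeomorph 𝓘(ℝ, M.model) 𝓘(ℝ, N.model) M N ∞

/-! ## lc-manifolds of depth at most one -/

/-- An lc-chart of a space `P` with closed subset `bd`, both `bd` and its complement being
Hilbert manifolds: an open embedding of `base × [0, ε)` into `P`, where `base` is open in `bd`,
which is the inclusion on `base × {0}` and restricts to a diffeomorphism from `base × (0, ε)` onto
an open subset of the complement of `bd`. -/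
structure LCChart {P : Type u} [TopologicalSpace P] (bd : Set P) (E₀ E₁ : Type u)
    [NormedAddCommGroup E₀] [InnerProductSpace ℝ E₀]
    [NormedAddCommGroup E₁] [InnerProductSpace ℝ E₁]
    [ChartedSpace E₀ ↥(bdᶜ)] [ChartedSpace E₁ ↥bd] where
  base : Set ↥bd
  isOpen_base : IsOpen base
  ε : ℝ
  ε_pos : 0 < ε
  toFun : ↥bd × ℝ → P
  isOpenEmbedding : IsOpenEmbedding ((base ×ˢ Ico 0 ε).domRestrict toFun)
  map_zero : ∀ v ∈ base, toFun (v, 0) = v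
  diffeo : OpenPartialHomeomorph (↥bd × ℝ) ↥(bdᶜ)
  source_eq : diffeo.source = base ×ˢ Ioo 0 ε
  diffeo_eq : ∀ q ∈ diffeo.source, (diffeo q : P) = toFun q
  smooth_diffeo : ContMDiffOn (𝓘(ℝ, E₁).prod 𝓘(ℝ, ℝ)) 𝓘(ℝ, E₀) ∞ diffeo diffeo.source
  smooth_symm : ContMDiffOn 𝓘(ℝ, E₀) (𝓘(ℝ, E₁).prod 𝓘(ℝ, ℝ)) ∞ diffeo.symm diffeo.target

/-- A (second countable) lc-manifold of depth at most one. -/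
structure LCManifold : Type (u + 1) where
  carrier : Type u
  [topology : TopologicalSpace carrier]
  [hausdorff : T2Space carrier]
  [secondCountable : SecondCountableTopology carrier]
  boundary : Set carrier
  isClosed_boundary : IsClosed boundary
  intModel : Type u
  [normedInt : NormedAddCommGroup intModel]
  [innerInt : InnerProductSpace ℝ intModel]
  [completeInt : CompleteSpace intModel]
  [chartedInt : ChartedSpace intModel ↥(boundaryᶜ)]
  [smoothInt : IsManifold 𝓘(ℝ, intModel) ∞ ↥(boundaryᶜ)]
  bdModel : Type u
  [normedBd : NormedAddCommGroup bdModel]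
  [innerBd : InnerProductSpace ℝ bdModel]
  [completeBd : CompleteSpace bdModel]
  [chartedBd : ChartedSpace bdModel ↥boundary]
  [smoothBd : IsManifold 𝓘(ℝ, bdModel) ∞ ↥boundary]
  exists_lcChart : ∀ p : ↥boundary, ∃ c : LCChart boundary intModel bdModel, p ∈ c.base

namespace LCManifold

instance : CoeSort LCManifold.{u} (Type u) := ⟨LCManifold.carrier⟩

attribute [instance] topology hausdorff secondCountable normedInt innerInt completeInt chartedInt
  smoothInt normedBd innerBd completeBd chartedBd smoothBd

/-- The open stratum, the complement of the boundary. -/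
abbrev int (P : LCManifold.{u}) : HilbertManifold.{u} where
  carrier := ↥(P.boundaryᶜ)
  model := P.intModel

/-- The boundary, as a Hilbert manifold. -/
abbrev bd (P : LCManifold.{u}) : HilbertManifold.{u} where
  carrier := ↥P.boundary
  model := P.bdModel

/-- Restriction of a map to the open stratum. -/
abbrev onInt (P : LCManifold.{u}) {X : Type u} (f : P → X) : P.int → X := fun x => f x.1

/-- Restriction of a map to the boundary. -/
abbrev onBd (P : LCManifold.{u}) {X : Type u} (f : P → X) : P.bd → X := fun x => f x.1

end LCManifold

/-- lc-smooth maps from an lc-manifold of depth at most one to a Hilbert manifold. In the last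
clause the first derivative in the direction of the boundary, computed in a lc-chart at `p` and in
the charts of the boundary at `p` and of the target at `σ p`, is jointly continuous on
`base × [0, ε)`. -/
structure LCSmooth (P : LCManifold.{u}) (B : HilbertManifold.{u}) (σ : P → B) : Prop where
  continuous : Continuous σ
  smooth_int : Smooth P.int B (P.onInt σ)
  smooth_bd : Smooth P.bd B (P.onBd σ)
  continuous_deriv : ∀ p : P.bd, ∃ c : LCChart P.boundary P.intModel P.bdModel,
    p ∈ c.base ∧ c.base ⊆ (chartAt P.bdModel p).source ∧
    (∀ q ∈ c.base ×ˢ Ico 0 c.ε, σ (c.toFun q) ∈ (chartAt B.model (σ p.1)).source) ∧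
    ContinuousOn
      (fun q : P.bdModel × ℝ =>
        fderiv ℝ (fun x => chartAt B.model (σ p.1)
          (σ (c.toFun ((chartAt P.bdModel p).symm x, q.2)))) q.1)
      ((chartAt P.bdModel p '' c.base) ×ˢ Ico 0 c.ε)

/-! ## Floer spaces -/

/-- A Floer space: a Hilbert manifold with a polarization `TB = T⁺B ⊕ T⁻B`, a continuous function
`csd` and a coarser weak topology. The polarization is given by the projection `projMinus` onto
`T⁻B` along `T⁺B`, a smooth idempotent endomorphism of the tangent bundle; both summands are
bundles with a fixed fibre, which is automatic over a connected manifold. -/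
structure FloerSpace : Type (u + 1) extends HilbertManifold.{u} where
  projMinus : carrier → model →L[ℝ] model
  projMinus_idem : ∀ b, (projMinus b).comp (projMinus b) = projMinus b
  projMinus_smooth : ∀ b₀, ContMDiffAt 𝓘(ℝ, model) 𝓘(ℝ, model →L[ℝ] model) ∞
    (inTangentCoordinates 𝓘(ℝ, model) 𝓘(ℝ, model) id id projMinus b₀) b₀
  minus_fibre : ∀ b b', Nonempty ((projMinus b).range ≃L[ℝ] (projMinus b').range)
  plus_fibre : ∀ b b', Nonempty ((projMinus b).ker ≃L[ℝ] (projMinus b').ker)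
  csd : carrier → ℝ
  csd_continuous : Continuous csd
  weak : TopologicalSpace carrier
  weak_coarser : topology ≤ weak

instance : CoeSort FloerSpace.{u} (Type u) := ⟨fun B => B.carrier⟩

namespace FloerSpace

/-- The projection onto `T⁺B` along `T⁻B`. -/
def projPlus (B : FloerSpace.{u}) (b : B) : B.model →L[ℝ] B.model :=
  ContinuousLinearMap.id ℝ B.model - B.projMinus b

/-- `T⁻_b B`, a subspace of `T_b B`. -/
abbrev TMinus (B : FloerSpace.{u}) (b : B) : Submodule ℝ B.model := (B.projMinus b).range

/-- `T⁺_b B`, a subspace of `T_b B`. -/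
abbrev TPlus (B : FloerSpace.{u}) (b : B) : Submodule ℝ B.model := (B.projPlus b).range

/-- `Π⁻ : T_b B → T⁻_b B`. -/
abbrev toMinus (B : FloerSpace.{u}) (b : B) : B.model →L[ℝ] B.TMinus b :=
  (B.projMinus b).rangeRestrict

/-- `Π⁺ : T_b B → T⁺_b B`. -/
abbrev toPlus (B : FloerSpace.{u}) (b : B) : B.model →L[ℝ] B.TPlus b :=
  (B.projPlus b).rangeRestrict

/-- `Π⁻ ∘ Dσ_p : T_p P → T⁻B`. -/
def minusD (B : FloerSpace.{u}) (P : HilbertManifold.{u}) (σ : P → B) (p : P) :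
    P.model →L[ℝ] B.TMinus (σ p) :=
  (B.toMinus (σ p)).comp (differential P B.toHilbertManifold σ p)

/-- `Π⁺ ∘ Dσ_p : T_p P → T⁺B`. -/
def plusD (B : FloerSpace.{u}) (P : HilbertManifold.{u}) (σ : P → B) (p : P) :
    P.model →L[ℝ] B.TPlus (σ p) :=
  (B.toPlus (σ p)).comp (differential P B.toHilbertManifold σ p)

end FloerSpace

/-! ## Chains and cycles -/

/-- The semicontinuity and compactness axioms of a chain. -/
structure CompactnessAxioms (B : FloerSpace.{u}) (P : Type u) [TopologicalSpace P] (σ : P → B) :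
    Prop where
  bddBelow : BddBelow (B.csd '' range σ)
  lsc : SeqLowerSemicontinuous B.weak B.csd (range σ)
  strong_conv : ∀ (x : ℕ → P) (y : B), Tendsto (fun i => σ (x i)) atTop (@nhds B B.weak y) →
    Tendsto (fun i => B.csd (σ (x i))) atTop (𝓝 (B.csd y)) →
    ∃ p, ∃ φ : ℕ → ℕ, StrictMono φ ∧ Tendsto (x ∘ φ) atTop (𝓝 p)
  weak_precompact : ∀ S ⊆ range σ, (∃ C, ∀ b ∈ S, |B.csd b| ≤ C) → SeqPrecompact B.weak S

/-- The semi-infinite condition, on one stratum: `Π⁻ ∘ Dσ` is Fredholm and `Π⁺ ∘ Dσ` is compact. -/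
structure SemiInfinite (B : FloerSpace.{u}) (P : HilbertManifold.{u}) (σ : P → B) : Prop where
  fredholm : ∀ p, (B.minusD P σ p).IsFredholm
  compact : ∀ p, IsCompactOperator (B.plusD P σ p)

/-- A chain of depth at most one in `B`. -/
structure FloerChain (B : FloerSpace.{u}) : Type (u + 1) where
  dom : LCManifold.{u}
  map : dom → B
  lcSmooth : LCSmooth dom B.toHilbertManifold map
  compactness : CompactnessAxioms B dom map
  semiInfinite_int : SemiInfinite B dom.int (dom.onInt map)
  semiInfinite_bd : SemiInfinite B dom.bd (dom.onBd map)

/-- A cycle in `B`: a chain of depth zero, that is, one whose domain is a Hilbert manifold. -/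
structure FloerCycle (B : FloerSpace.{u}) : Type (u + 1) where
  dom : HilbertManifold.{u}
  map : dom → B
  smooth : Smooth dom B.toHilbertManifold map
  compactness : CompactnessAxioms B dom map
  semiInfinite : SemiInfinite B dom map

/-- A chain has index `n` if `Π⁻ ∘ Dσ` has index `n` at each point off the boundary. -/
def FloerChain.HasIndex {B : FloerSpace.{u}} (W : FloerChain B) (n : ℤ) : Prop :=
  ∀ p, fredholmIndex (B.minusD W.dom.int (W.dom.onInt W.map) p) = n

/-- A cycle has index `n` if `Π⁻ ∘ Dσ` has index `n` at each point. -/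
def FloerCycle.HasIndex {B : FloerSpace.{u}} (σ : FloerCycle B) (n : ℤ) : Prop :=
  ∀ p, fredholmIndex (B.minusD σ.dom σ.map p) = n

/-- Isomorphism of cycles. -/
def FloerCycle.Iso {B : FloerSpace.{u}} (σ τ : FloerCycle B) : Prop :=
  ∃ φ : Diffeo σ.dom τ.dom, ∀ x, τ.map (φ x) = σ.map x

/-- `ρ` is (isomorphic to) the disjoint union of `σ` and `τ`: the domains of `σ` and `τ` are
openly and smoothly embedded in that of `ρ`, with complementary images. -/
def FloerCycle.IsDisjointUnion {B : FloerSpace.{u}} (σ τ ρ : FloerCycle B) : Prop :=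
  ∃ (i : σ.dom → ρ.dom) (j : τ.dom → ρ.dom),
    IsLocalDiffeomorph 𝓘(ℝ, σ.dom.model) 𝓘(ℝ, ρ.dom.model) ∞ i ∧
    IsLocalDiffeomorph 𝓘(ℝ, τ.dom.model) 𝓘(ℝ, ρ.dom.model) ∞ j ∧
    Injective i ∧ Injective j ∧ IsCompl (range i) (range j) ∧
    (∀ x, ρ.map (i x) = σ.map x) ∧ (∀ y, ρ.map (j y) = τ.map y)

/-- `σ` is the boundary of the chain `W`, up to isomorphism: `∂W = σ`. -/
def FloerChain.BoundaryIs {B : FloerSpace.{u}} (W : FloerChain B) (σ : FloerCycle B) : Prop :=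
  ∃ φ : Diffeo σ.dom W.dom.bd, ∀ x, W.dom.onBd W.map (φ x) = σ.map x

/-! ## Floer bordism -/

/-- The cycles of index `n`. -/
abbrev CycleOfIndex (B : FloerSpace.{u}) (n : ℤ) : Type (u + 1) := {σ : FloerCycle B // σ.HasIndex n}

/-- The relations of the bordism group: isomorphic cycles are equal, disjoint union is addition,
and a cycle of index `n` that is the boundary of a chain of index `n + 1` is zero. -/
inductive BordRel (B : FloerSpace.{u}) (n : ℤ) : (CycleOfIndex B n →₀ ZMod 2) → Prop
  | iso (σ τ : CycleOfIndex B n) (h : σ.1.Iso τ.1) :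
      BordRel B n (Finsupp.single σ 1 - Finsupp.single τ 1)
  | disjointUnion (σ τ ρ : CycleOfIndex B n) (h : σ.1.IsDisjointUnion τ.1 ρ.1) :
      BordRel B n (Finsupp.single ρ 1 - (Finsupp.single σ 1 + Finsupp.single τ 1))
  | boundary (σ : CycleOfIndex B n) (W : FloerChain B) (hW : W.HasIndex (n + 1))
      (h : W.BoundaryIs σ.1) : BordRel B n (Finsupp.single σ 1)

/-- The Floer bordism group `Bord_n(B, csd)`, a vector space over `ℤ/2`. -/
abbrev Bord (B : FloerSpace.{u}) (n : ℤ) : Type (u + 1) :=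
  (CycleOfIndex B n →₀ ZMod 2) ⧸ Submodule.span (ZMod 2) {r | BordRel B n r}

/-- The bordism class of a cycle. -/
def Bord.mk {B : FloerSpace.{u}} {n : ℤ} (σ : CycleOfIndex B n) : Bord B n :=
  Submodule.Quotient.mk (Finsupp.single σ 1)

/-! ## Correspondences -/

/-- A correspondence without boundary from `B₀` to `B₁`. -/
structure Correspondence (B₀ B₁ : FloerSpace.{u}) : Type (u + 1) where
  dom : HilbertManifold.{u}
  /-- The two components of the map to `B₀ × B₁`. -/
  map₀ : dom → B₀
  map₁ : dom → B₁
  smooth₀ : Smooth dom B₀.toHilbertManifold map₀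
  smooth₁ : Smooth dom B₁.toHilbertManifold map₁
  bddBelow : BddBelow (range fun z => B₁.csd (map₁ z) - B₀.csd (map₀ z))
  lsc : SeqLowerSemicontinuous (@instTopologicalSpaceProd B₀ B₁ B₀.weak B₁.weak)
    (fun b : B₀ × B₁ => B₁.csd b.2 - B₀.csd b.1) (range fun z => (map₀ z, map₁ z))
  weak_precompact : ∀ z : ℕ → dom, BddAbove (range fun i => B₁.csd (map₁ (z i))) →
    SeqPrecompact B₀.weak (range fun i => map₀ (z i)) →
    SeqPrecompact B₁.weak (range fun i => map₁ (z i))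
  strong_conv : ∀ (z : ℕ → dom) (w : B₀) (y : B₁),
    Tendsto (fun i => map₀ (z i)) atTop (𝓝 w) →
    Tendsto (fun i => map₁ (z i)) atTop (@nhds B₁ B₁.weak y) →
    Tendsto (fun i => B₁.csd (map₁ (z i)) - B₀.csd (map₀ (z i))) atTop
      (𝓝 (B₁.csd y - B₀.csd w)) →
    ∃ p, ∃ φ : ℕ → ℕ, StrictMono φ ∧ Tendsto (z ∘ φ) atTop (𝓝 p)
  fredholm : ∀ z, ((B₀.plusD dom map₀ z).prod (B₁.minusD dom map₁ z)).IsFredholm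
  precompact : ∀ (z : dom) (v : ℕ → dom.model), (∃ C, ∀ i, ‖v i‖ ≤ C) →
    (∃ w, Tendsto (fun i => B₀.plusD dom map₀ z (v i)) atTop (𝓝 w)) →
    IsCompact (closure (range fun i => B₁.plusD dom map₁ z (v i)))
  dense : ∀ z, DenseRange (differential dom B₀.toHilbertManifold map₀ z)

/-- A correspondence has index `k` if `(Π₀⁺, Π₁⁻) ∘ Df` has index `k` at each point. -/
def Correspondence.HasIndex {B₀ B₁ : FloerSpace.{u}} (F : Correspondence B₀ B₁) (k : ℤ) : Prop :=
  ∀ z, fredholmIndex ((B₀.plusD F.dom F.map₀ z).prod (B₁.minusD F.dom F.map₁ z)) = k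

/-! ## Fibre products -/

/-- `p : Q → P` and `z : Q → Z` exhibit `Q` as the fibre product of `σ : P → B` and `g : Z → B`:
`(p, z)` is a smooth embedding onto the set of pairs on which `σ` and `g` agree. -/
structure IsFibreProduct {P Z Q : HilbertManifold.{u}} {B : Type u} (σ : P → B) (g : Z → B)
    (p : Q → P) (z : Q → Z) : Prop where
  isSmoothEmbedding : Manifold.IsSmoothEmbedding 𝓘(ℝ, Q.model)
    (𝓘(ℝ, P.model).prod 𝓘(ℝ, Z.model)) ∞ (fun q => (p q, z q))
  range_eq : range (fun q => (p q, z q)) = {x : P × Z | σ x.1 = g x.2}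

/-- The cycle `τ` in `B₁` is the fibre product `P ×_{B₀} Z → B₁` of the cycle `σ : P → B₀` with the
correspondence `F : Z → B₀ × B₁`. -/
def FloerCycle.IsFibreProduct {B₀ B₁ : FloerSpace.{u}} (σ : FloerCycle B₀) (F : Correspondence B₀ B₁)
    (τ : FloerCycle B₁) : Prop :=
  ∃ (p : τ.dom → σ.dom) (z : τ.dom → F.dom),
    FloerBordism.IsFibreProduct σ.map F.map₀ p z ∧ ∀ q, τ.map q = F.map₁ (z q)

/-- The chain `T` in `B₁` is the fibre product `P ×_{B₀} Z → B₁` of the chain `W : P → B₀` with the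
correspondence `F : Z → B₀ × B₁`: topologically it is the fibre product, and its boundary and open
stratum are the (smooth) fibre products of the boundary and of the open stratum of `P`. -/
def FloerChain.IsFibreProduct {B₀ B₁ : FloerSpace.{u}} (W : FloerChain B₀) (F : Correspondence B₀ B₁)
    (T : FloerChain B₁) : Prop :=
  ∃ (p : T.dom → W.dom) (z : T.dom → F.dom)
    (pInt : T.dom.int → W.dom.int) (pBd : T.dom.bd → W.dom.bd),
    (∀ q, (pInt q : W.dom) = p q) ∧ (∀ q, (pBd q : W.dom) = p q) ∧
    IsEmbedding (fun q => (p q, z q)) ∧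
    range (fun q => (p q, z q)) = {x : W.dom × F.dom | W.map x.1 = F.map₀ x.2} ∧
    FloerBordism.IsFibreProduct (W.dom.onInt W.map) F.map₀ pInt (T.dom.onInt z) ∧
    FloerBordism.IsFibreProduct (W.dom.onBd W.map) F.map₀ pBd (T.dom.onBd z) ∧
    ∀ q, T.map q = F.map₁ (z q)

end FloerBordism

end

open FloerBordism

noncomputable section

namespace FloerBordism

/-! Everything rests on one operator. At a point (p, z) of the fibre product put D = Dσ - Df₀.
Replacing Dσ by Π₀⁻Dσ changes (D, Π₁⁻Df₁) by a compact operator, and what remains is, up to two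
shears, the composite of Π₀⁻Dσ and (Π₀⁺Df₀, Π₁⁻Df₁), each stabilised by an identity. So (D, Π₁⁻Df₁)
is Fredholm and its index is the sum of the two given indices (`hasFiniteIndex_difference_prod`). In
particular D has a range of finite codimension, hence closed; as it contains the dense range of Df₀,
D is onto (`surjective_difference`). Transversality is thus automatic, and Π₁⁻Df₁ restricted to ker
D keeps the kernel, cokernel and index of the pair. Compactness of Π₁⁺Df₁ on ker D comes from the
axiom on bounded sequences, because Π₀⁺Df₀ = Π₀⁺Dσ there.

The implicit function theorem then gives slice charts with tangent spaces ker D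
(`exists_fibreProduct_structure`). A Hilbert manifold has a single model, so these kernels must all
be isomorphic: they carry Fredholm operators of equal index to the mutually isomorphic fibres of
T⁻B₁ (`nonempty_equiv_of_linearIndex_eq`). On the boundary of a chain no index is prescribed; there
a collar shows that ker D × ℝ is the model of the open stratum, and the line is cancelled.

For the compactness axioms, write A₁ as the sum of A₀ and A₁ - A₀. Both terms are bounded below and
weakly lower semicontinuous, so a bound on the sum bounds both, and convergence of the sum to its
value at the weak limit forces convergence of both (`CompactnessAxioms.fibreProduct`).

Near the boundary of a chain the equation σ = f₀ is only continuous in the collar parameter t, with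
a continuous tangential derivative. Inverting for each fixed t ≥ 0, with constants independent of t,
still produces collars (`exists_parametric_solution`, `LCSmooth.exists_collar`). Finally, smooth
embeddings make fibre products unique and functorial under injective local diffeomorphisms
(`IsFibreProduct.exists_map`), so all bordism relations are respected. -/

/-! ## The index of linear maps with finite dimensional kernel and cokernel -/

section LinearIndex

variable {U V W : Type*} [AddCommGroup U] [Module ℝ U] [AddCommGroup V] [Module ℝ V]
  [AddCommGroup W] [Module ℝ W]

/-- Linear maps with finite dimensional kernel and cokernel. -/
structure HasFiniteIndex (f : V →ₗ[ℝ] W) : Prop where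
  ker : FiniteDimensional ℝ f.ker
  coker : FiniteDimensional ℝ (W ⧸ f.range)

/-- The index `dim ker f - dim coker f` of a linear map. -/
def linearIndex (f : V →ₗ[ℝ] W) : ℤ :=
  (Module.finrank ℝ f.ker : ℤ) - (Module.finrank ℝ (W ⧸ f.range) : ℤ)

theorem finite_of_exact {A B C : Type*} [AddCommGroup A] [Module ℝ A] [AddCommGroup B] [Module ℝ B]
    [AddCommGroup C] [Module ℝ C] (i : A →ₗ[ℝ] B) (p : B →ₗ[ℝ] C)
    (h : p.ker = i.range) [FiniteDimensional ℝ A] [FiniteDimensional ℝ C] :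
    FiniteDimensional ℝ B := by
  have h1 : FiniteDimensional ℝ p.ker := by rw [h]; infer_instance
  have h2 : FiniteDimensional ℝ p.range := inferInstance
  have h3 : FiniteDimensional ℝ (B ⧸ p.ker) := Module.Finite.equiv p.quotKerEquivRange.symm
  exact Module.Finite.of_submodule_quotient p.ker

theorem finrank_of_shortExact {A B C : Type*} [AddCommGroup A] [Module ℝ A] [AddCommGroup B]
    [Module ℝ B] [AddCommGroup C] [Module ℝ C] (i : A →ₗ[ℝ] B) (p : B →ₗ[ℝ] C)
    (hi : Injective i) (hp : Surjective p) (h : p.ker = i.range) [FiniteDimensional ℝ B] :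
    Module.finrank ℝ B = Module.finrank ℝ A + Module.finrank ℝ C := by
  rw [← p.finrank_range_add_finrank_ker, h, LinearMap.range_eq_top.2 hp, finrank_top,
    LinearMap.finrank_range_of_inj hi, add_comm]

/-- The data of the kernel–cokernel sequence of `g ∘ f`, cut at `ker g ⊓ range f`
and at `V ⧸ (range f ⊔ ker g)`. -/
theorem kerCoker_aux (f : U →ₗ[ℝ] V) (g : V →ₗ[ℝ] W) :
    ∃ (a : f.ker →ₗ[ℝ] (g ∘ₗ f).ker) (b : (g ∘ₗ f).ker →ₗ[ℝ] ↥(f.range ⊓ g.ker))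
      (c : ↥(f.range ⊓ g.ker) →ₗ[ℝ] g.ker)
      (e : V ⧸ f.range →ₗ[ℝ] W ⧸ (g ∘ₗ f).range)
      (d : W ⧸ (g ∘ₗ f).range →ₗ[ℝ] W ⧸ g.range)
      (k : g.ker →ₗ[ℝ] V ⧸ f.range),
      Injective a ∧ Surjective b ∧ b.ker = a.range ∧
      Injective c ∧ k.ker = c.range ∧ e.ker = k.range ∧ d.ker = e.range ∧ Surjective d := by
  have hfr : ∀ x, g.range.mkQ (g x) = 0 := fun x => by simp
  have hle : (g ∘ₗ f).range ≤ g.range := LinearMap.range_comp_le_range f g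
  -- These are the maps of 0 → ker f → ker gf → ker g → coker f → coker gf → coker g → 0.
  refine ⟨Submodule.inclusion (LinearMap.ker_le_ker_comp f g),
    (f.domRestrict _).codRestrict _ (fun x => ⟨⟨x, rfl⟩, x.2⟩),
    Submodule.inclusion inf_le_right,
    Submodule.mapQ _ _ g (by rintro _ ⟨x, rfl⟩; exact ⟨x, rfl⟩),
    Submodule.mapQ _ _ LinearMap.id hle,
    f.range.mkQ.domRestrict _, Submodule.inclusion_injective _, ?_, ?_,
    Submodule.inclusion_injective _, ?_, ?_, ?_, ?_⟩
  · rintro ⟨_, ⟨x, rfl⟩, hx⟩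
    exact ⟨⟨x, hx⟩, rfl⟩
  · ext ⟨x, hx⟩
    simp only [LinearMap.mem_ker, LinearMap.mem_range, Subtype.exists]
    constructor
    · intro h
      exact ⟨x, congrArg Subtype.val h, rfl⟩
    · rintro ⟨y, hy, h⟩
      have : y = x := congrArg Subtype.val h
      subst this
      exact Subtype.ext hy
  · ext ⟨x, hx⟩
    simp only [LinearMap.mem_ker, LinearMap.domRestrict_apply, Submodule.mkQ_apply,
      Submodule.Quotient.mk_eq_zero]
    constructor
    · intro h
      exact ⟨⟨x, h, hx⟩, rfl⟩
    · rintro ⟨⟨y, hy, hy'⟩, h⟩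
      have : y = x := congrArg Subtype.val h
      exact this ▸ hy
  · ext x
    obtain ⟨x, rfl⟩ := f.range.mkQ_surjective x
    simp only [LinearMap.mem_ker, Submodule.mkQ_apply, Submodule.mapQ_apply,
      Submodule.Quotient.mk_eq_zero]
    constructor
    · rintro ⟨y, hy⟩
      refine ⟨⟨x - f y, ?_⟩, ?_⟩
      · simp only [LinearMap.mem_ker, map_sub]
        rw [← hy]; simp
      · change Submodule.Quotient.mk (x - f y) = _
        rw [Submodule.Quotient.eq]
        exact ⟨-y, by simp⟩
    · rintro ⟨⟨y, hy⟩, h⟩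
      have h' : f.range.mkQ y = f.range.mkQ x := h
      have := (Submodule.Quotient.eq _).1 h'
      obtain ⟨z, hz⟩ := this
      refine ⟨-z, ?_⟩
      simp only [LinearMap.comp_apply, map_neg, hz, map_sub, LinearMap.mem_ker.1 hy]
      simp
  · ext x
    obtain ⟨x, rfl⟩ := (g ∘ₗ f).range.mkQ_surjective x
    simp only [LinearMap.mem_ker, Submodule.mkQ_apply, Submodule.mapQ_apply,
      Submodule.Quotient.mk_eq_zero, LinearMap.id_apply]
    constructor
    · rintro ⟨y, rfl⟩
      exact ⟨f.range.mkQ y, rfl⟩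
    · rintro ⟨y, h⟩
      obtain ⟨y, rfl⟩ := f.range.mkQ_surjective y
      obtain ⟨z, hz⟩ := (Submodule.Quotient.eq _).1 h
      refine ⟨y - f z, ?_⟩
      have : g (f z) = g y - x := hz
      rw [map_sub, this]; abel
  · intro x
    obtain ⟨x, rfl⟩ := g.range.mkQ_surjective x
    exact ⟨Submodule.Quotient.mk x, rfl⟩

/-- With its two companions below this is the two-out-of-three property: in the six-term exact
sequence every term is squeezed between its neighbours. -/
theorem HasFiniteIndex.comp {f : U →ₗ[ℝ] V} {g : V →ₗ[ℝ] W} (hg : HasFiniteIndex g)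
    (hf : HasFiniteIndex f) : HasFiniteIndex (g ∘ₗ f) := by
  obtain ⟨a, b, c, e, d, k, ha, hb, hab, hc, hck, hek, hde, hd⟩ := kerCoker_aux f g
  have := hf.ker; have := hg.ker; have := hf.coker; have := hg.coker
  have := FiniteDimensional.of_injective c hc
  exact ⟨finite_of_exact a b hab, finite_of_exact e d hde⟩

theorem HasFiniteIndex.of_comp_left {f : U →ₗ[ℝ] V} {g : V →ₗ[ℝ] W}
    (h : HasFiniteIndex (g ∘ₗ f)) (hf : HasFiniteIndex f) : HasFiniteIndex g := by
  obtain ⟨a, b, c, e, d, k, ha, hb, hab, hc, hck, hek, hde, hd⟩ := kerCoker_aux f g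
  have := hf.ker; have := h.ker; have := hf.coker; have := h.coker
  have := Module.Finite.of_surjective b hb
  exact ⟨finite_of_exact c k hck, Module.Finite.of_surjective d hd⟩

theorem HasFiniteIndex.of_comp_right {f : U →ₗ[ℝ] V} {g : V →ₗ[ℝ] W}
    (h : HasFiniteIndex (g ∘ₗ f)) (hg : HasFiniteIndex g) : HasFiniteIndex f := by
  obtain ⟨a, b, c, e, d, k, ha, hb, hab, hc, hck, hek, hde, hd⟩ := kerCoker_aux f g
  have := hg.ker; have := h.ker; have := hg.coker; have := h.coker
  exact ⟨FiniteDimensional.of_injective a ha, finite_of_exact k e hek⟩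

theorem linearIndex_comp {f : U →ₗ[ℝ] V} {g : V →ₗ[ℝ] W} (hg : HasFiniteIndex g)
    (hf : HasFiniteIndex f) : linearIndex (g ∘ₗ f) = linearIndex g + linearIndex f := by
  obtain ⟨a, b, c, e, d, k, ha, hb, hab, hc, hck, hek, hde, hd⟩ := kerCoker_aux f g
  have := hf.ker; have := hg.ker; have := hf.coker; have := hg.coker
  have := (hg.comp hf).ker; have := (hg.comp hf).coker
  have h1 := finrank_of_shortExact a b ha hb hab
  have h2 := LinearMap.finrank_range_add_finrank_ker k
  have h3 := LinearMap.finrank_range_add_finrank_ker e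
  have h4 := LinearMap.finrank_range_add_finrank_ker d
  rw [hck, LinearMap.finrank_range_of_inj hc] at h2
  rw [hek] at h3
  rw [hde, LinearMap.range_eq_top.2 hd, finrank_top] at h4
  -- The alternating sum of the six dimensions vanishes, which is additivity of the index.
  simp only [linearIndex]
  omega

theorem HasFiniteIndex.of_bijective {f : V →ₗ[ℝ] W} (hf : Bijective f) : HasFiniteIndex f := by
  constructor
  · rw [LinearMap.ker_eq_bot.2 hf.1]; infer_instance
  · rw [LinearMap.range_eq_top.2 hf.2]; infer_instance

theorem linearIndex_of_bijective {f : V →ₗ[ℝ] W} (hf : Bijective f) : linearIndex f = 0 := by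
  rw [linearIndex, LinearMap.ker_eq_bot.2 hf.1, LinearMap.range_eq_top.2 hf.2]
  simp [Module.finrank_zero_of_subsingleton]

variable {V' W' : Type*} [AddCommGroup V'] [Module ℝ V'] [AddCommGroup W'] [Module ℝ W']

theorem hasFiniteIndex_of_kerCokerEquiv {f : V →ₗ[ℝ] W} {f' : V' →ₗ[ℝ] W'} (h : HasFiniteIndex f)
    (a : f'.ker ≃ₗ[ℝ] f.ker) (b : (W' ⧸ f'.range) ≃ₗ[ℝ] (W ⧸ f.range)) : HasFiniteIndex f' :=
  have := h.ker; have := h.coker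
  ⟨Module.Finite.equiv a.symm, Module.Finite.equiv b.symm⟩

theorem linearIndex_of_kerCokerEquiv {f : V →ₗ[ℝ] W} {f' : V' →ₗ[ℝ] W'}
    (a : f'.ker ≃ₗ[ℝ] f.ker) (b : (W' ⧸ f'.range) ≃ₗ[ℝ] (W ⧸ f.range)) :
    linearIndex f' = linearIndex f := by
  rw [linearIndex, linearIndex, a.finrank_eq, b.finrank_eq]

variable (U) in
/-- Kernel and cokernel of `f × id`. -/
theorem prodMap_id_equivs (f : V →ₗ[ℝ] W) :
    Nonempty ((f.prodMap (LinearMap.id : U →ₗ[ℝ] U)).ker ≃ₗ[ℝ] f.ker) ∧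
    Nonempty (((W × U) ⧸ (f.prodMap (LinearMap.id : U →ₗ[ℝ] U)).range) ≃ₗ[ℝ] (W ⧸ f.range)) := by
  constructor
  · refine ⟨LinearEquiv.ofBijective
      (((LinearMap.fst ℝ V U).domRestrict _).codRestrict _ (fun x => ?_)) ⟨?_, ?_⟩⟩
    · exact (Prod.ext_iff.1 x.2).1
    · rintro ⟨⟨x, y⟩, h⟩ ⟨⟨x', y'⟩, h'⟩ hxy
      have h1 : y = 0 := (Prod.ext_iff.1 h).2
      have h2 : y' = 0 := (Prod.ext_iff.1 h').2
      have h3 : x = x' := congrArg Subtype.val hxy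
      simp [h1, h2, h3]
    · rintro ⟨x, hx⟩
      exact ⟨⟨(x, 0), by simpa [LinearMap.mem_ker] using hx⟩, rfl⟩
  · refine ⟨LinearEquiv.ofBijective (Submodule.mapQ _ _ (LinearMap.fst ℝ W U) ?_) ⟨?_, ?_⟩⟩
    · rintro _ ⟨⟨x, y⟩, rfl⟩
      exact ⟨x, rfl⟩
    · rw [← LinearMap.ker_eq_bot, LinearMap.ker_eq_bot']
      intro x hx
      obtain ⟨⟨x, y⟩, rfl⟩ := Submodule.mkQ_surjective _ x
      simp only [Submodule.mkQ_apply, Submodule.mapQ_apply, Submodule.Quotient.mk_eq_zero] at hx ⊢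
      obtain ⟨z, hz⟩ := hx
      exact ⟨(z, y), Prod.ext hz rfl⟩
    · intro x
      obtain ⟨x, rfl⟩ := Submodule.mkQ_surjective _ x
      exact ⟨Submodule.Quotient.mk (x, 0), rfl⟩

theorem HasFiniteIndex.prodMap_id {f : V →ₗ[ℝ] W} (hf : HasFiniteIndex f) :
    HasFiniteIndex (f.prodMap (LinearMap.id : U →ₗ[ℝ] U)) :=
  hasFiniteIndex_of_kerCokerEquiv hf (prodMap_id_equivs U f).1.some (prodMap_id_equivs U f).2.some

theorem linearIndex_prodMap_id (f : V →ₗ[ℝ] W) :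
    linearIndex (f.prodMap (LinearMap.id : U →ₗ[ℝ] U)) = linearIndex f :=
  linearIndex_of_kerCokerEquiv (prodMap_id_equivs U f).1.some (prodMap_id_equivs U f).2.some

/-- If `D` is onto and `j` is injective with range `ker D`, then `(D, s)` and `s ∘ j` have
isomorphic kernels and cokernels. -/
theorem prod_comp_equivs (D : V →ₗ[ℝ] W) (s : V →ₗ[ℝ] W') (hD : Surjective D) (j : U →ₗ[ℝ] V)
    (hj : Injective j) (hjr : j.range = D.ker) :
    Nonempty ((s ∘ₗ j).ker ≃ₗ[ℝ] (D.prod s).ker) ∧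
    Nonempty ((W' ⧸ (s ∘ₗ j).range) ≃ₗ[ℝ] ((W × W') ⧸ (D.prod s).range)) := by
  have hDj : ∀ x, D (j x) = 0 := fun x => by
    have : j x ∈ D.ker := hjr ▸ ⟨x, rfl⟩
    exact this
  constructor
  · refine ⟨LinearEquiv.ofBijective
      ((j.domRestrict _).codRestrict _ (fun x => ?_)) ⟨?_, ?_⟩⟩
    · exact Prod.ext (hDj x) x.2
    · intro x y hxy
      exact Subtype.ext (hj (congrArg Subtype.val hxy))
    · rintro ⟨x, hx⟩
      have h1 : x ∈ D.ker := (Prod.ext_iff.1 hx).1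
      rw [← hjr] at h1
      obtain ⟨y, rfl⟩ := h1
      exact ⟨⟨y, (Prod.ext_iff.1 hx).2⟩, rfl⟩
  · refine ⟨LinearEquiv.ofBijective (Submodule.mapQ _ _ (LinearMap.inr ℝ W W') ?_) ⟨?_, ?_⟩⟩
    · rintro _ ⟨x, rfl⟩
      exact ⟨j x, Prod.ext (hDj x) rfl⟩
    · rw [← LinearMap.ker_eq_bot, LinearMap.ker_eq_bot']
      intro x hx
      obtain ⟨x, rfl⟩ := Submodule.mkQ_surjective _ x
      simp only [Submodule.mkQ_apply, Submodule.mapQ_apply, Submodule.Quotient.mk_eq_zero] at hx ⊢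
      obtain ⟨z, hz⟩ := hx
      have h1 : z ∈ D.ker := (Prod.ext_iff.1 hz).1
      rw [← hjr] at h1
      obtain ⟨y, rfl⟩ := h1
      exact ⟨y, (Prod.ext_iff.1 hz).2⟩
    · intro x
      obtain ⟨⟨x, y⟩, rfl⟩ := Submodule.mkQ_surjective _ x
      obtain ⟨v, rfl⟩ := hD x
      -- Modulo the range of (D, s), the pair (D v, y) equals (0, y - s v).
      refine ⟨Submodule.Quotient.mk (y - s v), ?_⟩
      simp only [Submodule.mkQ_apply, Submodule.mapQ_apply]
      rw [Submodule.Quotient.eq]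
      exact ⟨-v, by simp⟩

end LinearIndex

/-! ## Fredholm operators between Banach spaces -/

section Banach

variable {E F G : Type*} [NormedAddCommGroup E] [NormedSpace ℝ E] [CompleteSpace E]
  [NormedAddCommGroup F] [NormedSpace ℝ F] [CompleteSpace F]
  [NormedAddCommGroup G] [NormedSpace ℝ G] [CompleteSpace G]

/-- After dividing by the kernel the operator is injective, and its range has a finite dimensional,
hence closed, algebraic complement; the open mapping theorem then closes the range. -/
theorem isClosed_range_of_finite_coker (T : E →L[ℝ] F) [FiniteDimensional ℝ (F ⧸ T.range)] :
    IsClosed (T.range : Set F) := by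
  have hc : IsClosed (T.ker : Set E) := T.isClosed_ker
  let S : (E ⧸ T.ker) →L[ℝ] F := T.ker.liftQL T le_rfl
  have hS : S.range = T.range := by
    ext y
    constructor
    · rintro ⟨x, rfl⟩
      obtain ⟨x, rfl⟩ := T.ker.mkQ_surjective x
      exact ⟨x, rfl⟩
    · rintro ⟨x, rfl⟩
      exact ⟨T.ker.mkQ x, rfl⟩
  have hker : S.ker = ⊥ := by
    rw [LinearMap.ker_eq_bot']
    intro x hx
    obtain ⟨x, rfl⟩ := T.ker.mkQ_surjective x
    exact (Submodule.Quotient.mk_eq_zero _).2 hx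
  obtain ⟨C, hC⟩ := T.range.exists_isCompl
  have hfin : FiniteDimensional ℝ C := Module.Finite.equiv (T.range.quotientEquivOfIsCompl C hC)
  have := S.closed_complemented_range_of_isCompl_of_ker_eq_bot C (hS ▸ hC)
    C.closed_of_finiteDimensional hker
  rwa [hS] at this

/-- A bounded operator between Banach spaces with finite dimensional kernel and cokernel is
Fredholm. -/
theorem HasFiniteIndex.isFredholm {T : E →L[ℝ] F} (hT : HasFiniteIndex (T : E →ₗ[ℝ] F)) :
    T.IsFredholm := by
  have h1 : FiniteDimensional ℝ T.ker := hT.ker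
  have h2 : FiniteDimensional ℝ (F ⧸ T.range) := hT.coker
  have hr := isClosed_range_of_finite_coker T
  obtain ⟨X, hX⟩ := (Submodule.ClosedComplemented.of_finiteDimensional T.ker).exists_isTopCompl
  have hXc : IsClosed (X : Set E) := hX.isClosed'
  have hXf : X.CoFG := Submodule.FG.cofg_of_isCompl hX.isCompl (Submodule.fg_iff_finiteDimensional _ |>.2 h1)
  have hFf : T.range.CoFG := h2
  have : CompleteSpace X := hXc.completeSpace_coe
  have : CompleteSpace T.range := hr.completeSpace_coe
  have hm : MapsTo T X T.range := fun x _ => ⟨x, rfl⟩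
  refine ContinuousLinearMap.IsFredholm.of_isInvertible_restrict hXc hr hm
    ⟨ContinuousLinearEquiv.ofBijective (T.restrict hm) ?_ ?_, rfl⟩
  · rw [LinearMap.ker_eq_bot']
    rintro ⟨x, hx⟩ h
    have h0 : x ∈ T.ker := congrArg Subtype.val h
    exact Subtype.ext ((Submodule.disjoint_def.1 hX.isCompl.disjoint) x h0 hx)
  · rw [LinearMap.range_eq_top]
    rintro ⟨_, y, rfl⟩
    obtain ⟨a, ha, b, hb, rfl⟩ := Submodule.mem_sup.1
      (hX.isCompl.sup_eq_top ▸ Submodule.mem_top (x := y))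
    refine ⟨⟨b, hb⟩, Subtype.ext ?_⟩
    have : T a = 0 := ha
    change T b = T (a + b)
    simp [this]

omit [CompleteSpace E] [CompleteSpace F] in
theorem _root_.ContinuousLinearMap.IsFredholm.hasFiniteIndex {T : E →L[ℝ] F} (hT : T.IsFredholm) :
    HasFiniteIndex (T : E →ₗ[ℝ] F) :=
  ⟨hT.finite_ker, hT.finite_coker⟩

/-- Between complements of finite dimensional pieces T is an isomorphism, and isomorphisms form an
open set. Any operator whose compression to these complements is invertible has an index determined
by the complements alone. -/
theorem hasFiniteIndex_add_of_small {T : E →L[ℝ] F} (hT : HasFiniteIndex (T : E →ₗ[ℝ] F)) :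
    ∃ δ > 0, ∀ R : E →L[ℝ] F, ‖R‖ < δ → HasFiniteIndex ((T + R : E →L[ℝ] F) : E →ₗ[ℝ] F) ∧
      linearIndex ((T + R : E →L[ℝ] F) : E →ₗ[ℝ] F) = linearIndex (T : E →ₗ[ℝ] F) := by
  obtain ⟨pkg⟩ := hT.isFredholm.nonempty_fredholmPackage
  obtain ⟨⟨X₀, X, hX, hX0⟩, ⟨Y₀, Y, hY, hY0⟩, e, he⟩ := pkg
  have hXc : IsClosed (X : Set E) := hX.symm.isClosed'
  have hYc : IsClosed (Y : Set F) := hY.symm.isClosed'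
  have : CompleteSpace X := hXc.completeSpace_coe
  have : CompleteSpace Y := hYc.completeSpace_coe
  let i : X →L[ℝ] E := X.subtypeL
  let p : F →L[ℝ] Y := Y.projectionOntoL Y₀ hY
  have hi : HasFiniteIndex (i : X →ₗ[ℝ] E) := by
    constructor
    · change FiniteDimensional ℝ (LinearMap.ker X.subtype)
      rw [Submodule.ker_subtype]; infer_instance
    · change FiniteDimensional ℝ (E ⧸ LinearMap.range X.subtype)
      rw [Submodule.range_subtype]
      exact Module.Finite.equiv (X.quotientEquivOfIsCompl X₀ hX.isCompl).symm
  have hp : HasFiniteIndex (p : F →ₗ[ℝ] Y) := by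
    constructor
    · change FiniteDimensional ℝ p.ker
      rw [Submodule.ker_projectionOntoL]; exact hY0
    · change FiniteDimensional ℝ (Y ⧸ p.range)
      rw [Submodule.range_projectionOntoL]; infer_instance
  have hTe : p ∘L T ∘L i = e := by
    ext x
    simp [he, p, i]
  -- Since p S i is bijective it has index 0, so ind S = - ind p - ind i whatever S is.
  have key : ∀ S : E →L[ℝ] F, (∃ e' : X ≃L[ℝ] Y, p ∘L S ∘L i = e') →
      HasFiniteIndex (S : E →ₗ[ℝ] F) ∧ linearIndex (S : E →ₗ[ℝ] F) =
        - linearIndex (p : F →ₗ[ℝ] Y) - linearIndex (i : X →ₗ[ℝ] E) := by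
    rintro S ⟨e', h⟩
    have hb : Bijective ((p : F →ₗ[ℝ] Y) ∘ₗ ((S : E →ₗ[ℝ] F) ∘ₗ (i : X →ₗ[ℝ] E))) := by
      have : ⇑((p : F →ₗ[ℝ] Y) ∘ₗ ((S : E →ₗ[ℝ] F) ∘ₗ (i : X →ₗ[ℝ] E))) = e' := by
        ext x
        exact congrArg Subtype.val (DFunLike.congr_fun h x)
      rw [this]; exact e'.bijective
    have h1 := (HasFiniteIndex.of_bijective hb).of_comp_right hp
    have h2 := h1.of_comp_left hi
    refine ⟨h2, ?_⟩
    have h3 := linearIndex_of_bijective hb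
    rw [linearIndex_comp hp h1, linearIndex_comp h2 hi] at h3
    omega
  have hcont : Continuous fun R : E →L[ℝ] F => p ∘L (T + R) ∘L i := by fun_prop
  have hnear : ∀ᶠ R in 𝓝 (0 : E →L[ℝ] F), p ∘L (T + R) ∘L i ∈ range ((↑) : (X ≃L[ℝ] Y) → X →L[ℝ] Y) := by
    refine hcont.continuousAt.eventually ?_
    simp only [add_zero]
    rw [hTe]
    exact ContinuousLinearEquiv.nhds e
  obtain ⟨δ, hδ, hball⟩ := Metric.eventually_nhds_iff.1 hnear
  refine ⟨δ, hδ, fun R hR => ?_⟩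
  obtain ⟨e', he'⟩ := hball (by simpa using hR)
  have h1 := key (T + R) ⟨e', he'.symm⟩
  exact ⟨h1.1, h1.2.trans (key T ⟨e, hTe⟩).2.symm⟩

-- T and T + A agree on ker A, which has finite codimension; precomposing with its inclusion shifts
-- both indices by the same amount.
omit [CompleteSpace E] [CompleteSpace F] in
theorem hasFiniteIndex_add_of_finiteRank {T A : E →L[ℝ] F} (hT : HasFiniteIndex (T : E →ₗ[ℝ] F))
    [FiniteDimensional ℝ A.range] : HasFiniteIndex ((T + A : E →L[ℝ] F) : E →ₗ[ℝ] F) ∧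
      linearIndex ((T + A : E →L[ℝ] F) : E →ₗ[ℝ] F) = linearIndex (T : E →ₗ[ℝ] F) := by
  have hj : HasFiniteIndex A.ker.subtype := by
    constructor
    · rw [Submodule.ker_subtype]; infer_instance
    · rw [Submodule.range_subtype]
      exact Module.Finite.equiv (LinearMap.quotKerEquivRange (A : E →ₗ[ℝ] F)).symm
  have h : ((T + A : E →L[ℝ] F) : E →ₗ[ℝ] F) ∘ₗ A.ker.subtype = (T : E →ₗ[ℝ] F) ∘ₗ A.ker.subtype := by
    ext ⟨x, hx⟩
    have : A x = 0 := hx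
    simp [this]
  have h1 : HasFiniteIndex ((T + A : E →L[ℝ] F) : E →ₗ[ℝ] F) :=
    HasFiniteIndex.of_comp_left (h ▸ hT.comp hj) hj
  refine ⟨h1, ?_⟩
  have h2 := linearIndex_comp h1 hj
  rw [h, linearIndex_comp hT hj] at h2
  omega

omit [CompleteSpace G] in
/-- Two Banach spaces with Fredholm operators of the same index to a common space are isomorphic. -/
theorem nonempty_equiv_of_linearIndex_eq {T : E →L[ℝ] G} {S : F →L[ℝ] G}
    (hT : HasFiniteIndex (T : E →ₗ[ℝ] G)) (hS : HasFiniteIndex (S : F →ₗ[ℝ] G))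
    (h : linearIndex (T : E →ₗ[ℝ] G) = linearIndex (S : F →ₗ[ℝ] G)) : Nonempty (E ≃L[ℝ] F) := by
  have := hT.ker; have := hS.ker; have := hT.coker; have := hS.coker
  obtain ⟨X, hX⟩ := (Submodule.ClosedComplemented.of_finiteDimensional T.ker).exists_isTopCompl
  obtain ⟨Y, hY⟩ := (Submodule.ClosedComplemented.of_finiteDimensional S.ker).exists_isTopCompl
  have hXc : IsClosed (X : Set E) := hX.isClosed'
  have hYc : IsClosed (Y : Set F) := hY.isClosed'
  have hXr : ∀ x, ∃ x' ∈ X, T x' = T x := fun x => by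
    obtain ⟨a, ha, b, hb, rfl⟩ := Submodule.mem_sup.1
      (hX.isCompl.sup_eq_top ▸ Submodule.mem_top (x := x))
    exact ⟨b, hb, by have : T a = 0 := ha
                     simp [this]⟩
  have hYr : ∀ x, ∃ x' ∈ Y, S x' = S x := fun x => by
    obtain ⟨a, ha, b, hb, rfl⟩ := Submodule.mem_sup.1
      (hY.isCompl.sup_eq_top ▸ Submodule.mem_top (x := x))
    exact ⟨b, hb, by have : S a = 0 := ha
                     simp [this]⟩
  have hXi : ∀ x ∈ X, T x = 0 → x = 0 := fun x hx h0 =>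
    (Submodule.disjoint_def.1 hX.isCompl.disjoint) x h0 hx
  have hYi : ∀ x ∈ Y, S x = 0 → x = 0 := fun x hx h0 =>
    (Submodule.disjoint_def.1 hY.isCompl.disjoint) x h0 hx
  -- the fibre product of the complements of the kernels
  let R : Submodule ℝ (E × F) :=
    X.comap (LinearMap.fst ℝ E F) ⊓ Y.comap (LinearMap.snd ℝ E F) ⊓
      LinearMap.eqLocus ((T : E →ₗ[ℝ] G) ∘ₗ LinearMap.fst ℝ E F) ((S : F →ₗ[ℝ] G) ∘ₗ LinearMap.snd ℝ E F)
  have hR : ∀ x, x ∈ R ↔ (x.1 ∈ X ∧ x.2 ∈ Y) ∧ T x.1 = S x.2 := fun x => Iff.rfl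
  have hRc : IsClosed (R : Set (E × F)) := by
    have : (R : Set (E × F)) = (Prod.fst ⁻¹' X ∩ Prod.snd ⁻¹' Y) ∩ {x | T x.1 = S x.2} := rfl
    rw [this]
    exact ((hXc.preimage continuous_fst).inter (hYc.preimage continuous_snd)).inter
      (isClosed_eq (by fun_prop) (by fun_prop))
  have : CompleteSpace R := hRc.completeSpace_coe
  let f : R →L[ℝ] E := (ContinuousLinearMap.fst ℝ E F) ∘L R.subtypeL
  let g : R →L[ℝ] F := (ContinuousLinearMap.snd ℝ E F) ∘L R.subtypeL
  have hcomm : (T : E →ₗ[ℝ] G) ∘ₗ (f : R →ₗ[ℝ] E) = (S : F →ₗ[ℝ] G) ∘ₗ (g : R →ₗ[ℝ] F) := by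
    ext ⟨x, hx⟩
    exact hx.2
  have hfi : Injective f := by
    refine (injective_iff_map_eq_zero _).2 ?_
    rintro ⟨⟨x, y⟩, hx⟩ h0
    have h0 : x = 0 := h0
    subst h0
    have h1 : y = 0 := hYi y hx.1.2 (by have := hx.2; simpa using this.symm)
    subst h1
    rfl
  have hgi : Injective g := by
    refine (injective_iff_map_eq_zero _).2 ?_
    rintro ⟨⟨x, y⟩, hx⟩ h0
    have h0 : y = 0 := h0
    subst h0
    have h1 : x = 0 := hXi x hx.1.1 (by have := hx.2; simpa using this)
    subst h1
    rfl
  have hTf : HasFiniteIndex ((T : E →ₗ[ℝ] G) ∘ₗ (f : R →ₗ[ℝ] E)) := by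
    constructor
    · have : LinearMap.ker ((T : E →ₗ[ℝ] G) ∘ₗ (f : R →ₗ[ℝ] E)) = ⊥ := by
        rw [LinearMap.ker_eq_bot']
        rintro x hx
        have h1 : (f x) = 0 := hXi _ x.2.1.1 hx
        exact hfi (h1.trans (map_zero f).symm)
      rw [this]; infer_instance
    · have : LinearMap.range ((T : E →ₗ[ℝ] G) ∘ₗ (f : R →ₗ[ℝ] E)) = T.range ⊓ S.range := by
        apply le_antisymm
        · rintro _ ⟨x, rfl⟩
          exact ⟨⟨x.1.1, rfl⟩, ⟨x.1.2, x.2.2.symm⟩⟩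
        · rintro _ ⟨⟨x, rfl⟩, y, hy⟩
          obtain ⟨x', hx', hxx⟩ := hXr x
          obtain ⟨y', hy', hyy⟩ := hYr y
          refine ⟨⟨(x', y'), ⟨hx', hy'⟩, ?_⟩, hxx⟩
          exact hxx.trans (hy.symm.trans hyy.symm)
      rw [this]
      exact Submodule.CoFG.inf hT.coker hS.coker
  have hf := hTf.of_comp_right hT
  have hSg := hTf
  rw [hcomm] at hSg
  have hg := hSg.of_comp_right hS
  have hidx : linearIndex (f : R →ₗ[ℝ] E) = linearIndex (g : R →ₗ[ℝ] F) := by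
    have h1 := linearIndex_comp hT hf
    rw [hcomm, linearIndex_comp hS hg] at h1
    omega
  have := hf.coker; have := hg.coker
  have hfk : (f : R →ₗ[ℝ] E).ker = ⊥ := LinearMap.ker_eq_bot.2 hfi
  have hgk : (g : R →ₗ[ℝ] F).ker = ⊥ := LinearMap.ker_eq_bot.2 hgi
  have hdim : Module.finrank ℝ (E ⧸ f.range) = Module.finrank ℝ (F ⧸ g.range) := by
    have h1 := hidx
    rw [linearIndex, linearIndex, hfk, hgk] at h1
    simp only [finrank_bot] at h1
    have : ((Module.finrank ℝ (E ⧸ f.range) : ℕ) : ℤ) = (Module.finrank ℝ (F ⧸ g.range) : ℕ) := by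
      linarith
    exact_mod_cast this
  have hfc := isClosed_range_of_finite_coker f
  have hgc := isClosed_range_of_finite_coker g
  obtain ⟨C, hC⟩ := (Submodule.ClosedComplemented.of_finiteDimensional_quotient hfc).exists_isTopCompl
  obtain ⟨D, hD⟩ := (Submodule.ClosedComplemented.of_finiteDimensional_quotient hgc).exists_isTopCompl
  have eC := f.range.quotientEquivOfIsCompl C hC.isCompl
  have eD := g.range.quotientEquivOfIsCompl D hD.isCompl
  have : FiniteDimensional ℝ C := Module.Finite.equiv eC
  have : FiniteDimensional ℝ D := Module.Finite.equiv eD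
  have eCD : C ≃L[ℝ] D := ContinuousLinearEquiv.ofFinrankEq
    (by rw [← eC.finrank_eq, ← eD.finrank_eq, hdim])
  have ef : R ≃L[ℝ] f.range := f.equivRange hfi hfc
  have eg : R ≃L[ℝ] g.range := g.equivRange hgi hgc
  exact ⟨(Submodule.prodEquivOfIsTopCompl _ _ hC).symm.trans
    (((ef.symm.trans eg).prodCongr eCD).trans (Submodule.prodEquivOfIsTopCompl _ _ hD))⟩

theorem linearIndex_inl_real (A : Type*) [AddCommGroup A] [Module ℝ A] :
    HasFiniteIndex (LinearMap.inl ℝ A ℝ) ∧ linearIndex (LinearMap.inl ℝ A ℝ) = -1 := by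
  have e1 : ((A × ℝ) ⧸ LinearMap.range (LinearMap.inl ℝ A ℝ)) ≃ₗ[ℝ] ℝ := by
    rw [LinearMap.range_inl]
    exact LinearMap.quotKerEquivOfSurjective _ LinearMap.snd_surjective
  have hk : LinearMap.ker (LinearMap.inl ℝ A ℝ) = ⊥ := LinearMap.ker_eq_bot.2 LinearMap.inl_injective
  refine ⟨⟨by rw [hk]; infer_instance, Module.Finite.equiv e1.symm⟩, ?_⟩
  rw [linearIndex, hk, e1.finrank_eq]
  simp

/-- Cancellation of a line. -/
theorem nonempty_equiv_of_prod_real (h : Nonempty ((E × ℝ) ≃L[ℝ] (F × ℝ))) :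
    Nonempty (E ≃L[ℝ] F) := by
  obtain ⟨e⟩ := h
  have he : Bijective (e : (E × ℝ) →ₗ[ℝ] (F × ℝ)) := e.bijective
  -- Both E and F map to F × ℝ with index -1.
  refine nonempty_equiv_of_linearIndex_eq
    (T := (e : (E × ℝ) →L[ℝ] (F × ℝ)) ∘L ContinuousLinearMap.inl ℝ E ℝ)
    (S := ContinuousLinearMap.inl ℝ F ℝ) ?_ (linearIndex_inl_real F).1 ?_
  · exact (HasFiniteIndex.of_bijective he).comp (linearIndex_inl_real E).1
  · refine (linearIndex_comp (HasFiniteIndex.of_bijective he) (linearIndex_inl_real E).1).trans ?_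
    rw [linearIndex_of_bijective he, (linearIndex_inl_real E).2]
    exact (linearIndex_inl_real F).2.symm

end Banach

/-! ### Compact perturbations of Fredholm operators -/

section Compact

variable {E F : Type*} [NormedAddCommGroup E] [NormedSpace ℝ E] [CompleteSpace E]
  [NormedAddCommGroup F] [InnerProductSpace ℝ F]

-- The image of the unit ball is covered by finitely many balls of radius δ/2; the orthogonal
-- projection to the span of their centres moves no point of the image further than its nearest
-- centre is. The Hilbert structure of the target is what provides the projection.
omit [CompleteSpace E] in
theorem exists_finiteRank_approx {K : E →L[ℝ] F} (hK : IsCompactOperator K) {δ : ℝ} (hδ : 0 < δ) :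
    ∃ A : E →L[ℝ] F, FiniteDimensional ℝ A.range ∧ ‖K - A‖ < δ := by
  have hcpt := (isCompactOperator_iff_isCompact_closure_image_closedBall (K : E →ₗ[ℝ] F)
    zero_lt_one).1 hK
  obtain ⟨t, htf, ht⟩ := Metric.totallyBounded_iff.1
    ((hcpt.totallyBounded).subset subset_closure) (δ / 2) (half_pos hδ)
  let V := Submodule.span ℝ t
  have : FiniteDimensional ℝ V := FiniteDimensional.span_of_finite ℝ htf
  let A : E →L[ℝ] F := V.starProjection ∘L K
  refine ⟨A, ?_, lt_of_le_of_lt (ContinuousLinearMap.opNorm_le_of_unit_norm (half_pos hδ).le ?_)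
    (half_lt_self hδ)⟩
  · refine Submodule.finiteDimensional_of_le (S₂ := V) ?_
    rintro _ ⟨x, rfl⟩
    exact V.starProjection_apply_mem (K x)
  · intro x hx
    have hmem : K x ∈ (K : E →ₗ[ℝ] F) '' Metric.closedBall 0 1 := ⟨x, by simp [hx], rfl⟩
    obtain ⟨y, hy, hd⟩ := mem_iUnion₂.1 (ht hmem)
    have h1 : ‖K x - V.starProjection (K x)‖ ≤ ‖K x - y‖ := by
      rw [Submodule.starProjection_minimal]
      exact ciInf_le ⟨0, by rintro _ ⟨z, rfl⟩; positivity⟩ (⟨y, Submodule.subset_span hy⟩ : V)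
    refine h1.trans ?_
    rw [← dist_eq_norm]
    exact (Metric.mem_ball.1 hd).le

/-- The index of a Fredholm operator is unchanged by compact perturbations. -/
theorem hasFiniteIndex_add_of_compact {G : Type*} [NormedAddCommGroup G] [NormedSpace ℝ G]
    [CompleteSpace G] {T : E →L[ℝ] G} {K : E →L[ℝ] F} (c : F →L[ℝ] G)
    (hT : HasFiniteIndex (T : E →ₗ[ℝ] G)) (hK : IsCompactOperator K) :
    HasFiniteIndex ((T + c ∘L K : E →L[ℝ] G) : E →ₗ[ℝ] G) ∧
      linearIndex ((T + c ∘L K : E →L[ℝ] G) : E →ₗ[ℝ] G) = linearIndex (T : E →ₗ[ℝ] G) := by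
  obtain ⟨δ, hδ, h⟩ := hasFiniteIndex_add_of_small hT
  -- The bound makes c (K - A) smaller than δ, and the extra 1 covers c = 0. Then T + c K is T plus
  -- a small operator plus the finite rank operator c A.
  obtain ⟨A, hA, hd⟩ := exists_finiteRank_approx hK (δ := δ / (‖c‖ + 1)) (by positivity)
  have hn : ‖c ∘L (K - A)‖ < δ := by
    refine (c.opNorm_comp_le _).trans_lt ?_
    rw [lt_div_iff₀ (by positivity)] at hd
    nlinarith [norm_nonneg (K - A), norm_nonneg c]
  obtain ⟨h1, h2⟩ := h _ hn
  have hcA : FiniteDimensional ℝ (c ∘L A).range := by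
    have : (c ∘L A).range = A.range.map (c : F →ₗ[ℝ] G) := LinearMap.range_comp _ _
    rw [this]; infer_instance
  have h3 := hasFiniteIndex_add_of_finiteRank (A := c ∘L A) h1
  have : T + c ∘L (K - A) + c ∘L A = T + c ∘L K := by
    ext x; simp [add_assoc]
  rw [this] at h3
  exact ⟨h3.1, h3.2.trans h2⟩

end Compact

/-- A bounded operator is compact once it maps bounded sequences to sequences with convergent
subsequences. -/
theorem isCompactOperator_of_seq {E F : Type*} [NormedAddCommGroup E] [NormedSpace ℝ E]
    [NormedAddCommGroup F] [NormedSpace ℝ F] (T : E →L[ℝ] F)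
    (h : ∀ v : ℕ → E, (∃ C, ∀ i, ‖v i‖ ≤ C) →
      ∃ y, ∃ φ : ℕ → ℕ, StrictMono φ ∧ Tendsto (fun i => T (v (φ i))) atTop (𝓝 y)) :
    IsCompactOperator T := by
  refine (isCompactOperator_iff_isCompact_closure_image_closedBall (T : E →ₗ[ℝ] F)
    zero_lt_one).2 ?_
  refine IsSeqCompact.isCompact fun y hy => ?_
  -- A sequence in the closure of the image is shadowed by values of T at errors tending to 0.
  have h1 : ∀ i : ℕ, ∃ v ∈ Metric.closedBall (0 : E) 1, dist (y i) (T v) < 1 / ((i : ℝ) + 1) := by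
    intro i
    obtain ⟨_, ⟨v, hv, rfl⟩, hd⟩ := Metric.mem_closure_iff.1 (hy i) _ Nat.one_div_pos_of_nat
    exact ⟨v, hv, hd⟩
  choose v hv hd using h1
  obtain ⟨a, φ, hφ, ht⟩ := h v ⟨1, fun i => by simpa using hv i⟩
  have ht' : Tendsto (y ∘ φ) atTop (𝓝 a) := by
    refine tendsto_of_tendsto_of_dist ht ?_
    refine squeeze_zero (fun _ => dist_nonneg) (fun i => ?_)
      (tendsto_one_div_add_atTop_nhds_zero_nat.comp hφ.tendsto_atTop)
    rw [dist_comm]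
    exact (hd (φ i)).le
  exact ⟨a, isClosed_closure.mem_of_tendsto ht' (Eventually.of_forall fun i => hy _), φ, hφ, ht'⟩

/-! ## Transversality and the Fredholm property of fibre products, pointwise -/

section Pointwise

variable {E₀ E₁ EP EZ : Type*}
  [NormedAddCommGroup E₀] [InnerProductSpace ℝ E₀] [CompleteSpace E₀]
  [NormedAddCommGroup E₁] [InnerProductSpace ℝ E₁] [CompleteSpace E₁]
  [NormedAddCommGroup EP] [NormedSpace ℝ EP] [CompleteSpace EP]
  [NormedAddCommGroup EZ] [NormedSpace ℝ EZ] [CompleteSpace EZ]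

theorem isClosed_range_of_idem {E : Type*} [NormedAddCommGroup E] [NormedSpace ℝ E]
    {A : E →L[ℝ] E} (hA : A.comp A = A) : IsClosed (A.range : Set E) := by
  have : (A.range : Set E) = {x | A x = x} := by
    ext x
    constructor
    · rintro ⟨y, rfl⟩
      exact DFunLike.congr_fun hA y
    · intro h
      exact ⟨x, h⟩
  rw [this]
  exact isClosed_eq A.continuous continuous_id

/-- Here A₀ and A₁ play the role of Π₀⁻ and Π₁⁻. The compact part (id - A₀) S may be dropped without
changing the index; the rest factors through A₀ S × id and F × id, where F = ((id - A₀) g, A₁ h). -/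
theorem hasFiniteIndex_difference_prod {A₀ : E₀ →L[ℝ] E₀} {A₁ : E₁ →L[ℝ] E₁}
    (hA₀ : A₀.comp A₀ = A₀) (hA₁ : A₁.comp A₁ = A₁)
    (S : EP →L[ℝ] E₀) (g : EZ →L[ℝ] E₀) (h : EZ →L[ℝ] E₁)
    (hS : (A₀.rangeRestrict ∘L S).IsFredholm)
    (hSc : IsCompactOperator ((ContinuousLinearMap.id ℝ E₀ - A₀).rangeRestrict ∘L S))
    (hF : (((ContinuousLinearMap.id ℝ E₀ - A₀).rangeRestrict ∘L g).prod
      (A₁.rangeRestrict ∘L h)).IsFredholm) :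
    HasFiniteIndex ((S.coprod (-g)).prod
      ((A₁.rangeRestrict ∘L h) ∘L ContinuousLinearMap.snd ℝ EP EZ) :
        EP × EZ →ₗ[ℝ] E₀ × A₁.range) ∧
    linearIndex ((S.coprod (-g)).prod
      ((A₁.rangeRestrict ∘L h) ∘L ContinuousLinearMap.snd ℝ EP EZ) :
        EP × EZ →ₗ[ℝ] E₀ × A₁.range) =
      linearIndex (A₀.rangeRestrict ∘L S : EP →ₗ[ℝ] A₀.range) +
      linearIndex (((ContinuousLinearMap.id ℝ E₀ - A₀).rangeRestrict ∘L g).prod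
        (A₁.rangeRestrict ∘L h) :
          EZ →ₗ[ℝ] (ContinuousLinearMap.id ℝ E₀ - A₀).range × A₁.range) := by
  have : CompleteSpace A₁.range := (isClosed_range_of_idem hA₁).completeSpace_coe
  set A' := ContinuousLinearMap.id ℝ E₀ - A₀ with hA'
  have hi : ∀ x, A₀ (A₀ x) = A₀ x := fun x => DFunLike.congr_fun hA₀ x
  have hi' : ∀ x, A₀ (A' x) = 0 := fun x => by simp [hA', hi]
  have fS := hS.hasFiniteIndex
  have fF := hF.hasFiniteIndex
  -- the two shears
  let e₁ : A₀.range × EZ →ₗ[ℝ] EZ × A₀.range :=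
    (LinearMap.snd ℝ _ _).prod
      (LinearMap.fst ℝ _ _ - ((A₀.rangeRestrict ∘L g : EZ →L[ℝ] A₀.range) : EZ →ₗ[ℝ] _) ∘ₗ
        LinearMap.snd ℝ _ _)
  let e₂ : (A'.range × A₁.range) × A₀.range →ₗ[ℝ] E₀ × A₁.range :=
    (A₀.range.subtype ∘ₗ LinearMap.snd ℝ _ _ -
      A'.range.subtype ∘ₗ LinearMap.fst ℝ _ _ ∘ₗ LinearMap.fst ℝ _ _).prod
      (LinearMap.snd ℝ _ _ ∘ₗ LinearMap.fst ℝ _ _)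
  have he₁ : Bijective e₁ := by
    constructor
    · rintro ⟨u, w⟩ ⟨u', w'⟩ h'
      have h1 : w = w' := (Prod.ext_iff.1 h').1
      subst h1
      have h2 : u - A₀.rangeRestrict (g w) = u' - A₀.rangeRestrict (g w) := (Prod.ext_iff.1 h').2
      rw [sub_left_inj.1 h2]
    · rintro ⟨w, u⟩
      exact ⟨(u + (A₀.rangeRestrict ∘L g) w, w), Prod.ext rfl (add_sub_cancel_right _ _)⟩
  have he₂ : Bijective e₂ := by
    constructor
    · refine (injective_iff_map_eq_zero _).2 ?_
      rintro ⟨⟨⟨_, x, rfl⟩, w⟩, ⟨_, y, rfl⟩⟩ h'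
      have h1 : w = 0 := (Prod.ext_iff.1 h').2
      have h2 : A₀ y - A' x = 0 := (Prod.ext_iff.1 h').1
      have h3 : A₀ y = 0 := by
        have := congrArg A₀ h2
        simpa [hi, hi'] using this
      have h4 : A' x = 0 := by simpa [h3] using h2
      subst h1
      ext <;> simp [h3, h4]
    · rintro ⟨x, w⟩
      refine ⟨((⟨A' (-x), -x, rfl⟩, w), ⟨A₀ x, x, rfl⟩), ?_⟩
      ext <;> simp [e₂, hA']
  -- The target operator with S replaced by A₀ S.
  let L₀ : EP × EZ →L[ℝ] E₀ × A₁.range :=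
    ((A₀ ∘L S).coprod (-g)).prod ((A₁.rangeRestrict ∘L h) ∘L ContinuousLinearMap.snd ℝ EP EZ)
  have hcomp : (L₀ : EP × EZ →ₗ[ℝ] E₀ × A₁.range) = e₂ ∘ₗ (LinearMap.prodMap
      (((A'.rangeRestrict ∘L g).prod (A₁.rangeRestrict ∘L h) : EZ →L[ℝ] A'.range × A₁.range) :
        EZ →ₗ[ℝ] A'.range × A₁.range) LinearMap.id) ∘ₗ e₁ ∘ₗ (LinearMap.prodMap
      ((A₀.rangeRestrict ∘L S : EP →L[ℝ] A₀.range) : EP →ₗ[ℝ] A₀.range) LinearMap.id) := by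
    refine LinearMap.ext ?_
    rintro ⟨x, y⟩
    refine Prod.ext ?_ rfl
    change A₀ (S x) + -(g y) = (A₀ (S x) - A₀ (g y)) - A' (g y)
    simp [hA']
    abel
  have b₁ := HasFiniteIndex.of_bijective he₁
  have b₂ := HasFiniteIndex.of_bijective he₂
  have c₁ := b₁.comp (fS.prodMap_id (U := EZ))
  have c₂ := (fF.prodMap_id (U := A₀.range)).comp c₁
  have c₃ := b₂.comp c₂
  have i₃ := linearIndex_comp b₂ c₂
  rw [linearIndex_comp (fF.prodMap_id (U := A₀.range)) c₁,
    linearIndex_comp b₁ (fS.prodMap_id (U := EZ)), linearIndex_of_bijective he₁,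
    linearIndex_of_bijective he₂, linearIndex_prodMap_id, linearIndex_prodMap_id] at i₃
  rw [← hcomp] at c₃ i₃
  have hK : IsCompactOperator ((A' ∘L S) ∘L ContinuousLinearMap.fst ℝ EP EZ) :=
    (hSc.continuous_comp (g := ((↑) : A'.range → E₀)) continuous_subtype_val).comp_clm
      (ContinuousLinearMap.fst ℝ EP EZ)
  have key := hasFiniteIndex_add_of_compact (ContinuousLinearMap.inl ℝ E₀ A₁.range) c₃ hK
  have hL : L₀ + ContinuousLinearMap.inl ℝ E₀ A₁.range ∘L
      ((A' ∘L S) ∘L ContinuousLinearMap.fst ℝ EP EZ) = (S.coprod (-g)).prod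
      ((A₁.rangeRestrict ∘L h) ∘L ContinuousLinearMap.snd ℝ EP EZ) := by
    refine ContinuousLinearMap.ext ?_
    rintro ⟨x, y⟩
    refine Prod.ext ?_ ?_
    · change (A₀ (S x) + -(g y)) + A' (S x) = S x + -(g y)
      simp [hA']
      abel
    · change (A₁.rangeRestrict (h y)) + 0 = A₁.rangeRestrict (h y)
      rw [add_zero]
  rw [hL] at key
  refine ⟨key.1, key.2.trans ?_⟩
  rw [i₃]
  omega

/-- The cokernel of the first component is a quotient of that of the Fredholm pair, so the range of
S - g is closed. It contains the range of g, which is dense. -/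
theorem surjective_difference {A₀ : E₀ →L[ℝ] E₀} {A₁ : E₁ →L[ℝ] E₁}
    (hA₀ : A₀.comp A₀ = A₀) (hA₁ : A₁.comp A₁ = A₁)
    (S : EP →L[ℝ] E₀) (g : EZ →L[ℝ] E₀) (h : EZ →L[ℝ] E₁)
    (hS : (A₀.rangeRestrict ∘L S).IsFredholm)
    (hSc : IsCompactOperator ((ContinuousLinearMap.id ℝ E₀ - A₀).rangeRestrict ∘L S))
    (hF : (((ContinuousLinearMap.id ℝ E₀ - A₀).rangeRestrict ∘L g).prod
      (A₁.rangeRestrict ∘L h)).IsFredholm) (hg : DenseRange g) :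
    Surjective (S.coprod (-g)) := by
  have h1 := (hasFiniteIndex_difference_prod hA₀ hA₁ S g h hS hSc hF).1.coker
  set L := (S.coprod (-g)).prod ((A₁.rangeRestrict ∘L h) ∘L ContinuousLinearMap.snd ℝ EP EZ)
  have h2 : FiniteDimensional ℝ (E₀ ⧸ (S.coprod (-g)).range) := by
    refine Module.Finite.of_surjective
      (Submodule.mapQ (LinearMap.range (L : EP × EZ →ₗ[ℝ] E₀ × A₁.range)) (S.coprod (-g)).range
        (LinearMap.fst ℝ E₀ A₁.range) ?_) ?_
    · rintro _ ⟨x, rfl⟩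
      exact ⟨x, rfl⟩
    · intro x
      obtain ⟨x, rfl⟩ := Submodule.mkQ_surjective _ x
      exact ⟨Submodule.Quotient.mk (x, 0), rfl⟩
  have h3 := isClosed_range_of_finite_coker (S.coprod (-g))
  have h4 : range g ⊆ ((S.coprod (-g)).range : Set E₀) := by
    rintro _ ⟨x, rfl⟩
    exact ⟨(0, -x), by simp⟩
  intro y
  exact (h3.closure_subset_iff.2 h4) (hg y)

/-- Composing with an injection onto the kernel of the (surjective) difference. -/
theorem hasFiniteIndex_on_ker {A₀ : E₀ →L[ℝ] E₀} {A₁ : E₁ →L[ℝ] E₁}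
    (hA₀ : A₀.comp A₀ = A₀) (hA₁ : A₁.comp A₁ = A₁)
    (S : EP →L[ℝ] E₀) (g : EZ →L[ℝ] E₀) (h : EZ →L[ℝ] E₁)
    (hS : (A₀.rangeRestrict ∘L S).IsFredholm)
    (hSc : IsCompactOperator ((ContinuousLinearMap.id ℝ E₀ - A₀).rangeRestrict ∘L S))
    (hF : (((ContinuousLinearMap.id ℝ E₀ - A₀).rangeRestrict ∘L g).prod
      (A₁.rangeRestrict ∘L h)).IsFredholm) (hg : DenseRange g)
    {Q : Type*} [NormedAddCommGroup Q] [NormedSpace ℝ Q] (j₁ : Q →L[ℝ] EP) (j₂ : Q →L[ℝ] EZ)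
    (hj : Injective (j₁.prod j₂)) (hjr : (j₁.prod j₂).range = (S.coprod (-g)).ker) :
    HasFiniteIndex (A₁.rangeRestrict ∘L (h ∘L j₂) : Q →ₗ[ℝ] A₁.range) ∧
    linearIndex (A₁.rangeRestrict ∘L (h ∘L j₂) : Q →ₗ[ℝ] A₁.range) =
      linearIndex (A₀.rangeRestrict ∘L S : EP →ₗ[ℝ] A₀.range) +
      linearIndex (((ContinuousLinearMap.id ℝ E₀ - A₀).rangeRestrict ∘L g).prod
        (A₁.rangeRestrict ∘L h) :
          EZ →ₗ[ℝ] (ContinuousLinearMap.id ℝ E₀ - A₀).range × A₁.range) := by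
  have h1 := hasFiniteIndex_difference_prod hA₀ hA₁ S g h hS hSc hF
  have h2 := surjective_difference hA₀ hA₁ S g h hS hSc hF hg
  obtain ⟨⟨a⟩, ⟨b⟩⟩ := prod_comp_equivs (S.coprod (-g) : EP × EZ →ₗ[ℝ] E₀)
    ((A₁.rangeRestrict ∘L h) ∘L ContinuousLinearMap.snd ℝ EP EZ : EP × EZ →ₗ[ℝ] A₁.range) h2
    (j₁.prod j₂ : Q →ₗ[ℝ] EP × EZ) hj hjr
  exact ⟨hasFiniteIndex_of_kerCokerEquiv h1.1 a b,
    (linearIndex_of_kerCokerEquiv a b).trans h1.2⟩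

-- Here A₀ and A' are the projections to the plus summands. On ker (S - g) the operators A₀ S j₁ and
-- A₀ g j₂ coincide. A bounded sequence thus has a subsequence along which A₀ g j₂ converges, and
-- the hypothesis on the correspondence applies to it.
omit [CompleteSpace E₀] [CompleteSpace E₁] [CompleteSpace EP] [CompleteSpace EZ] in
theorem isCompactOperator_on_ker {A₀ : E₀ →L[ℝ] E₀} {A' : E₁ →L[ℝ] E₁}
    (S : EP →L[ℝ] E₀) (g : EZ →L[ℝ] E₀) (h : EZ →L[ℝ] E₁)
    (hSc : IsCompactOperator (A₀.rangeRestrict ∘L S))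
    (hpre : ∀ v : ℕ → EZ, (∃ C, ∀ i, ‖v i‖ ≤ C) →
      (∃ w, Tendsto (fun i => (A₀.rangeRestrict ∘L g) (v i)) atTop (𝓝 w)) →
      IsCompact (closure (range fun i => (A'.rangeRestrict ∘L h) (v i))))
    {Q : Type*} [NormedAddCommGroup Q] [NormedSpace ℝ Q] (j₁ : Q →L[ℝ] EP) (j₂ : Q →L[ℝ] EZ)
    (hj : ∀ v, S (j₁ v) = g (j₂ v)) :
    IsCompactOperator (A'.rangeRestrict ∘L (h ∘L j₂)) := by
  refine isCompactOperator_of_seq _ fun v ⟨C, hC⟩ => ?_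
  have hcpt := IsCompactOperator.isCompact_closure_image_closedBall
    (f := ((A₀.rangeRestrict ∘L S) ∘L j₁ : Q →ₗ[ℝ] A₀.range)) (hSc.comp_clm j₁) C
  obtain ⟨w, -, φ, hφ, hw⟩ := hcpt.tendsto_subseq
    (x := fun i => (A₀.rangeRestrict ∘L S) (j₁ (v i)))
    (fun i => subset_closure ⟨v i, by simpa using hC i, rfl⟩)
  have hcpt' := hpre (fun i => j₂ (v (φ i)))
    ⟨‖j₂‖ * C, fun i => (j₂.le_opNorm _).trans (by gcongr; exact hC _)⟩
    ⟨w, by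
      refine hw.congr fun i => ?_
      change A₀.rangeRestrict (S _) = A₀.rangeRestrict (g _)
      rw [hj]⟩
  obtain ⟨y, -, ψ, hψ, hy⟩ := hcpt'.tendsto_subseq
    (x := fun i => (A'.rangeRestrict ∘L h) (j₂ (v (φ i)))) (fun i => subset_closure ⟨i, rfl⟩)
  exact ⟨y, φ ∘ ψ, hφ.comp hψ, hy⟩

end Pointwise

/-! ### The pointwise results for a correspondence of Floer spaces -/

section FloerPointwise

variable {B₀ B₁ : FloerSpace.{u}} (F : Correspondence B₀ B₁)

/-- The differential of `(p, z) ↦ "σ p - g z"` at a point of the fibre product. -/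
def differenceD {P Z B : HilbertManifold.{u}} (σ : P → B) (g : Z → B) (x : P × Z) :
    P.model × Z.model →L[ℝ] B.model :=
  (differential P B σ x.1).coprod (-differential Z B g x.2)

theorem SemiInfinite.surjective_differenceD {P : HilbertManifold.{u}} {σ : P → B₀}
    (hσ : SemiInfinite B₀ P σ) {p : P} {z : F.dom} (hpz : σ p = F.map₀ z) :
    Surjective (differenceD (B := B₀.toHilbertManifold) σ F.map₀ (p, z)) := by
  have h1 := F.fredholm z
  unfold FloerSpace.plusD FloerSpace.minusD at h1
  -- The projections of B₀ are evaluated at f₀(z) in one hypothesis and at σ(p) in the other; the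
  -- equation of the fibre product identifies the base points.
  rw [← hpz] at h1
  exact surjective_difference (B₀.projMinus_idem _) (B₁.projMinus_idem _) _ _ _
    (hσ.fredholm p) (hσ.compact p) h1 (F.dense z)

theorem SemiInfinite.hasFiniteIndex_on_ker {P : HilbertManifold.{u}} {σ : P → B₀}
    (hσ : SemiInfinite B₀ P σ) {p : P} {z : F.dom} (hpz : σ p = F.map₀ z)
    {Q : Type*} [NormedAddCommGroup Q] [NormedSpace ℝ Q]
    (j₁ : Q →L[ℝ] P.model) (j₂ : Q →L[ℝ] F.dom.model) (hj : Injective (j₁.prod j₂))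
    (hjr : (j₁.prod j₂).range = (differenceD (B := B₀.toHilbertManifold) σ F.map₀ (p, z)).ker) :
    HasFiniteIndex (B₁.toMinus (F.map₁ z) ∘L
      (differential F.dom B₁.toHilbertManifold F.map₁ z ∘L j₂) : Q →ₗ[ℝ] B₁.TMinus (F.map₁ z)) ∧
    linearIndex (B₁.toMinus (F.map₁ z) ∘L
      (differential F.dom B₁.toHilbertManifold F.map₁ z ∘L j₂) : Q →ₗ[ℝ] B₁.TMinus (F.map₁ z)) =
      fredholmIndex (B₀.minusD P σ p) +
      fredholmIndex ((B₀.plusD F.dom F.map₀ z).prod (B₁.minusD F.dom F.map₁ z)) := by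
  have h1 := F.fredholm z
  unfold FloerSpace.plusD FloerSpace.minusD at h1 ⊢
  rw [← hpz] at h1 ⊢
  exact FloerBordism.hasFiniteIndex_on_ker (B₀.projMinus_idem _) (B₁.projMinus_idem _) _ _ _
    (hσ.fredholm p) (hσ.compact p) h1 (F.dense z) j₁ j₂ hj hjr

theorem SemiInfinite.isCompactOperator_on_ker {P : HilbertManifold.{u}} {σ : P → B₀}
    (hσ : SemiInfinite B₀ P σ) {p : P} {z : F.dom} (hpz : σ p = F.map₀ z)
    {Q : Type*} [NormedAddCommGroup Q] [NormedSpace ℝ Q]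
    (j₁ : Q →L[ℝ] P.model) (j₂ : Q →L[ℝ] F.dom.model)
    (hjr : (j₁.prod j₂).range ≤ (differenceD (B := B₀.toHilbertManifold) σ F.map₀ (p, z)).ker) :
    IsCompactOperator (B₁.toPlus (F.map₁ z) ∘L
      (differential F.dom B₁.toHilbertManifold F.map₁ z ∘L j₂)) := by
  have h1 := F.precompact z
  unfold FloerSpace.plusD at h1
  rw [← hpz] at h1
  refine FloerBordism.isCompactOperator_on_ker _ _ _ (hσ.compact p) h1 j₁ j₂ fun v => ?_
  have h2 := hjr ⟨v, rfl⟩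
  exact sub_eq_zero.1 ((sub_eq_add_neg _ _).trans h2)

/-- All kernels of the difference are isomorphic. -/
theorem SemiInfinite.nonempty_ker_equiv {P : HilbertManifold.{u}} {σ : P → B₀}
    (hσ : SemiInfinite B₀ P σ) {n k : ℤ} (hn : ∀ p, fredholmIndex (B₀.minusD P σ p) = n)
    (hk : F.HasIndex k) {p p' : P} {z z' : F.dom} (h : σ p = F.map₀ z) (h' : σ p' = F.map₀ z') :
    Nonempty ((differenceD (B := B₀.toHilbertManifold) σ F.map₀ (p, z)).ker ≃L[ℝ]
      (differenceD (B := B₀.toHilbertManifold) σ F.map₀ (p', z')).ker) := by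
  have key : ∀ {p : P} {z : F.dom}, σ p = F.map₀ z → ∃ T :
      (differenceD (B := B₀.toHilbertManifold) σ F.map₀ (p, z)).ker →L[ℝ] B₁.TMinus (F.map₁ z),
      HasFiniteIndex T.toLinearMap ∧
      linearIndex T.toLinearMap = n + k := by
    intro p z hpz
    have := hσ.hasFiniteIndex_on_ker F hpz
      (ContinuousLinearMap.fst ℝ _ _ ∘L Submodule.subtypeL
        (differenceD (B := B₀.toHilbertManifold) σ F.map₀ (p, z)).ker)
      (ContinuousLinearMap.snd ℝ _ _ ∘L Submodule.subtypeL
        (differenceD (B := B₀.toHilbertManifold) σ F.map₀ (p, z)).ker)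
      (fun x y hxy => Subtype.ext hxy) (Submodule.range_subtype _)
    rw [hn, hk z] at this
    exact ⟨_, this⟩
  obtain ⟨T, hT, hT'⟩ := key h
  obtain ⟨S, hS, hS'⟩ := key h'
  -- The two Fredholm operators of index n + k end in fibres of T⁻B₁ at different points; the
  -- isomorphism of fibres gives them a common target.
  obtain ⟨e⟩ := B₁.minus_fibre (F.map₁ z') (F.map₁ z)
  have : CompleteSpace (differenceD (B := B₀.toHilbertManifold) σ F.map₀ (p, z)).ker :=
    (ContinuousLinearMap.isClosed_ker _).completeSpace_coe
  have : CompleteSpace (differenceD (B := B₀.toHilbertManifold) σ F.map₀ (p', z')).ker :=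
    (ContinuousLinearMap.isClosed_ker _).completeSpace_coe
  have he : Bijective ((e : B₁.TMinus (F.map₁ z') →L[ℝ] B₁.TMinus (F.map₁ z)) :
      B₁.TMinus (F.map₁ z') →ₗ[ℝ] B₁.TMinus (F.map₁ z)) := e.bijective
  refine nonempty_equiv_of_linearIndex_eq hT
    (S := (e : B₁.TMinus (F.map₁ z') →L[ℝ] B₁.TMinus (F.map₁ z)) ∘L S)
    ((HasFiniteIndex.of_bijective he).comp hS) ?_
  refine hT'.trans (Eq.symm ((linearIndex_comp (HasFiniteIndex.of_bijective he) hS).trans ?_))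
  rw [linearIndex_of_bijective he, hS', zero_add]

end FloerPointwise

/-! ## The compactness axioms of a fibre product -/

section Compactness

variable {B₀ B₁ : FloerSpace.{u}} (F : Correspondence B₀ B₁) {P : Type u} [TopologicalSpace P]
  {σ : P → B₀}

/-- From below, A₀ ∘ σ is bounded by the chain axiom; from above, A₀ = A₁ - (A₁ - A₀) with the
bracket bounded below. -/
theorem CompactnessAxioms.exists_bound (hσ : CompactnessAxioms B₀ P σ) (C : ℝ) :
    ∃ C', ∀ (p : P) (z : F.dom), σ p = F.map₀ z → B₁.csd (F.map₁ z) ≤ C →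
      |B₀.csd (σ p)| ≤ C' := by
  obtain ⟨m, hm⟩ := hσ.bddBelow
  obtain ⟨m', hm'⟩ := F.bddBelow
  refine ⟨max (-m) (C - m'), fun p z h hC => ?_⟩
  have h1 : m ≤ B₀.csd (σ p) := hm ⟨σ p, ⟨p, rfl⟩, rfl⟩
  have h2 : m' ≤ B₁.csd (F.map₁ z) - B₀.csd (F.map₀ z) := hm' ⟨z, rfl⟩
  rw [← h] at h2
  rw [abs_le]
  constructor
  · linarith [le_max_left (-m) (C - m')]
  · linarith [le_max_right (-m) (C - m')]

/-- The bound on A₁ makes σ(x i) weakly precompact. Along a subsequence the two summands A₀ and A₁ -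
A₀ of A₁ are then separately lower semicontinuous, which is how semicontinuity and strong
convergence are both obtained below. -/
theorem CompactnessAxioms.exists_weak_limit (hσ : CompactnessAxioms B₀ P σ) {C : ℝ}
    (x : ℕ → P) (z : ℕ → F.dom) (hxz : ∀ i, σ (x i) = F.map₀ (z i))
    (hC : ∀ i, B₁.csd (F.map₁ (z i)) ≤ C) {y : B₁}
    (hy : Tendsto (fun i => F.map₁ (z i)) atTop (@nhds B₁ B₁.weak y)) :
    ∃ (w : B₀) (φ : ℕ → ℕ), StrictMono φ ∧
      Tendsto (fun i => σ (x (φ i))) atTop (@nhds B₀ B₀.weak w) ∧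
      (∀ a < B₀.csd w, ∀ᶠ i in atTop, a < B₀.csd (σ (x (φ i)))) ∧
      (∀ a < B₁.csd y - B₀.csd w, ∀ᶠ i in atTop,
        a < B₁.csd (F.map₁ (z (φ i))) - B₀.csd (σ (x (φ i)))) := by
  obtain ⟨C', hC'⟩ := hσ.exists_bound F C
  obtain ⟨w, φ, hφ, hw⟩ := hσ.weak_precompact (range fun i => σ (x i))
    (by rintro _ ⟨i, rfl⟩; exact ⟨x i, rfl⟩)
    ⟨C', by rintro _ ⟨i, rfl⟩; exact hC' _ _ (hxz i) (hC i)⟩ (fun i => σ (x i)) (fun i => ⟨i, rfl⟩)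
  refine ⟨w, φ, hφ, hw, hσ.lsc _ (fun i => ⟨_, rfl⟩) w hw, ?_⟩
  have h1 : Tendsto (fun i => (F.map₀ (z (φ i)), F.map₁ (z (φ i)))) atTop
      (@nhds (B₀ × B₁) (@instTopologicalSpaceProd B₀ B₁ B₀.weak B₁.weak) (w, y)) := by
    let _ := B₀.weak
    let _ := B₁.weak
    rw [nhds_prod_eq]
    refine Tendsto.prodMk ?_ (hy.comp hφ.tendsto_atTop)
    exact hw.congr fun i => hxz _
  have h2 := F.lsc _ (fun i => ⟨_, rfl⟩) (w, y) h1
  simpa only [hxz] using h2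

theorem CompactnessAxioms.fibreProduct (hσc : Continuous σ) (hσ : CompactnessAxioms B₀ P σ)
    {Q : Type u} [TopologicalSpace Q] (p : Q → P) (z : Q → F.dom)
    (he : IsEmbedding fun q => (p q, z q))
    (hr : range (fun q => (p q, z q)) = {x : P × F.dom | σ x.1 = F.map₀ x.2})
    {τ : Q → B₁} (hτ : ∀ q, τ q = F.map₁ (z q)) : CompactnessAxioms B₁ Q τ := by
  have hpz : ∀ q, σ (p q) = F.map₀ (z q) := fun q => by
    have : (p q, z q) ∈ {x : P × F.dom | σ x.1 = F.map₀ x.2} := hr ▸ ⟨q, rfl⟩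
    exact this
  refine ⟨?_, ?_, ?_, ?_⟩
  · obtain ⟨m, hm⟩ := hσ.bddBelow
    obtain ⟨m', hm'⟩ := F.bddBelow
    refine ⟨m + m', ?_⟩
    rintro _ ⟨_, ⟨q, rfl⟩, rfl⟩
    have h1 : m ≤ B₀.csd (σ (p q)) := hm ⟨_, ⟨p q, rfl⟩, rfl⟩
    have h2 : m' ≤ B₁.csd (F.map₁ (z q)) - B₀.csd (F.map₀ (z q)) := hm' ⟨z q, rfl⟩
    rw [← hpz] at h2
    rw [hτ]
    linarith
  · intro s hs y hy a ha
    by_contra hcon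
    choose q hq using hs
    obtain ⟨φ, hφ, hφa⟩ := extraction_of_frequently_atTop (not_eventually.1 hcon)
    have hs' : ∀ i, s i = F.map₁ (z (q i)) := fun i => by rw [← hτ, hq]
    obtain rfl : s = fun i => F.map₁ (z (q i)) := funext hs'
    simp only [not_lt] at hφa
    obtain ⟨w, ψ, -, -, h1, h2⟩ := hσ.exists_weak_limit F (fun i => p (q (φ i)))
      (fun i => z (q (φ i))) (fun i => hpz _) hφa (hy.comp hφ.tendsto_atTop)
    -- Each summand loses at most half of the gap A₁(y) - a, so their sum exceeds a.
    obtain ⟨i, h3, h4⟩ := ((h1 (B₀.csd w - (B₁.csd y - a) / 2) (by linarith)).and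
      (h2 (B₁.csd y - B₀.csd w - (B₁.csd y - a) / 2) (by linarith))).exists
    linarith [hφa (ψ i)]
  · intro q y hy hc
    simp only [hτ] at hy hc
    obtain ⟨C, hC⟩ := hc.bddAbove_range
    obtain ⟨w, φ, hφ, hw, h1, h2⟩ := hσ.exists_weak_limit F (fun i => p (q i))
      (fun i => z (q i)) (fun i => hpz _) (fun i => hC ⟨i, rfl⟩) hy
    -- The sum converges and the other summand has no limit below its value at (w, y), so A₀ cannot
    -- stay above its value at w.
    have hlim : Tendsto (fun i => B₀.csd (σ (p (q (φ i))))) atTop (𝓝 (B₀.csd w)) := by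
      refine tendsto_order.2 ⟨h1, fun a ha => ?_⟩
      have h3 := (tendsto_order.1 (hc.comp hφ.tendsto_atTop)).2
        (B₁.csd y + (a - B₀.csd w) / 2) (by linarith)
      filter_upwards [h3, h2 (B₁.csd y - B₀.csd w - (a - B₀.csd w) / 2) (by linarith)] with i h4 h5
      simp only [Function.comp_apply] at h4
      linarith
    obtain ⟨p₀, ψ, hψ, hp₀⟩ := hσ.strong_conv (fun i => p (q (φ i))) w hw hlim
    have hstr : Tendsto (fun i => F.map₀ (z (q (φ (ψ i))))) atTop (𝓝 (σ p₀)) :=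
      ((hσc.tendsto p₀).comp hp₀).congr fun i => hpz _
    have hφψ := hφ.comp hψ
    -- The weak topology is not assumed Hausdorff, so the weak limit w is not compared with σ(p₀).
    -- From here on σ(p₀) replaces it, and the difference converges by continuity of A₀.
    have hdiff : Tendsto (fun i => B₁.csd (F.map₁ (z (q (φ (ψ i)))))
        - B₀.csd (F.map₀ (z (q (φ (ψ i)))))) atTop (𝓝 (B₁.csd y - B₀.csd (σ p₀))) :=
      (hc.comp hφψ.tendsto_atTop).sub ((B₀.csd_continuous.tendsto _).comp hstr)
    obtain ⟨z₀, χ, hχ, hz₀⟩ := F.strong_conv (fun i => z (q (φ (ψ i)))) (σ p₀) y hstr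
      (hy.comp hφψ.tendsto_atTop) hdiff
    have h3 : Tendsto (fun i => (p (q (φ (ψ (χ i)))), z (q (φ (ψ (χ i)))))) atTop (𝓝 (p₀, z₀)) :=
      (hp₀.comp hχ.tendsto_atTop).prodMk_nhds hz₀
    have h4 : σ p₀ = F.map₀ z₀ :=
      tendsto_nhds_unique (hstr.comp hχ.tendsto_atTop) ((F.smooth₀.continuous.tendsto z₀).comp hz₀)
    have h5 : (p₀, z₀) ∈ range fun q => (p q, z q) := hr ▸ h4
    obtain ⟨q₀, hq₀⟩ := h5
    refine ⟨q₀, φ ∘ ψ ∘ χ, hφ.comp (hψ.comp hχ), ?_⟩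
    rw [he.tendsto_nhds_iff]
    rw [show (p q₀, z q₀) = (p₀, z₀) from hq₀]
    exact h3
  · rintro S hS ⟨C, hC⟩ s hs
    choose q hq using fun i => hS (hs i)
    have hCq : ∀ i, B₁.csd (F.map₁ (z (q i))) ≤ C := fun i => by
      rw [← hτ, hq]
      exact (le_abs_self _).trans (hC _ (hs i))
    obtain ⟨C', hC'⟩ := hσ.exists_bound F C
    refine F.weak_precompact (fun i => z (q i)) ⟨C, by rintro _ ⟨i, rfl⟩; exact hCq i⟩
      (hσ.weak_precompact _ ?_ ⟨C', ?_⟩) s fun i => ⟨i, (hτ _).symm.trans (hq i)⟩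
    · rintro _ ⟨i, rfl⟩
      exact ⟨p (q i), hpz _⟩
    · rintro _ ⟨i, rfl⟩
      simp only [← hpz]
      exact hC' _ _ (hpz _) (hCq i)

end Compactness

/-! ## Maps of Hilbert manifolds in charts -/

section Charts

variable {M N : HilbertManifold.{u}} {f : M → N}

theorem isOpen_chart_domain (hf : Continuous f) (x : M) (y : N) :
    IsOpen ((chartAt M.model x).target ∩
      (chartAt M.model x).symm ⁻¹' (f ⁻¹' (chartAt N.model y).source)) :=
  (chartAt M.model x).isOpen_inter_preimage_symm ((chartAt N.model y).open_source.preimage hf)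

theorem Smooth.contDiffOn_charts (hf : Smooth M N f) (x : M) (y : N) :
    ContDiffOn ℝ ∞ (fun v => chartAt N.model y (f ((chartAt M.model x).symm v)))
      ((chartAt M.model x).target ∩
        (chartAt M.model x).symm ⁻¹' (f ⁻¹' (chartAt N.model y).source)) := by
  rw [← contMDiffOn_iff_contDiffOn]
  refine (contMDiffOn_chart (x := y)).comp
    ((ContMDiff.contMDiffOn (s := univ) hf).comp
      ((contMDiffOn_chart_symm (x := x)).mono inter_subset_left) (fun _ _ => mem_univ _)) ?_
  exact fun v hv => hv.2

theorem Smooth.differential_eq (hf : Smooth M N f) (x : M) :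
    differential M N f x = fderiv ℝ
      (fun v => chartAt N.model (f x) (f ((chartAt M.model x).symm v))) (chartAt M.model x x) := by
  have h : MDifferentiableAt 𝓘(ℝ, M.model) 𝓘(ℝ, N.model) f x :=
    (ContMDiff.contMDiffAt hf).mdifferentiableAt (by simp)
  unfold differential
  rw [h.mfderiv]
  simp only [mfld_simps, fderivWithin_univ]
  rfl

end Charts

/-! ### A smooth inverse function theorem -/

section InverseFunction

variable {X Y : Type*} [NormedAddCommGroup X] [NormedSpace ℝ X] [CompleteSpace X]
  [NormedAddCommGroup Y] [NormedSpace ℝ Y]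

/-- The inverse function theorem, with smoothness of the inverse on the whole target. -/
theorem exists_smooth_localInverse {Ω : Set X} (hΩ : IsOpen Ω) {Φ : X → Y}
    (hΦ : ContDiffOn ℝ ∞ Φ Ω) {x₀ : X} (hx₀ : x₀ ∈ Ω) {A : X ≃L[ℝ] Y}
    (hA : HasFDerivAt Φ (A : X →L[ℝ] Y) x₀) :
    ∃ Θ : OpenPartialHomeomorph X Y, ⇑Θ = Φ ∧ x₀ ∈ Θ.source ∧ Θ.source ⊆ Ω ∧
      ContDiffOn ℝ ∞ Θ.symm Θ.target := by
  have h1 : ContDiffAt ℝ ∞ Φ x₀ := hΦ.contDiffAt (hΩ.mem_nhds hx₀)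
  let Θ₀ := h1.toOpenPartialHomeomorph Φ hA (by simp)
  have hc : ContinuousOn (fderiv ℝ Φ) Ω := hΦ.continuousOn_fderiv_of_isOpen hΩ (by simp)
  -- Shrinking the source to the open set of points with invertible derivative makes the inverse
  -- smooth at every point of the target, not only at the image of x₀.
  have ho : IsOpen (Ω ∩ fderiv ℝ Φ ⁻¹' range ((↑) : (X ≃L[ℝ] Y) → X →L[ℝ] Y)) :=
    hc.isOpen_inter_preimage hΩ ContinuousLinearEquiv.isOpen
  refine ⟨Θ₀.restrOpen _ ho, rfl, ⟨h1.mem_toOpenPartialHomeomorph_source hA (by simp), hx₀, A, ?_⟩,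
    fun x hx => hx.2.1, fun y hy => ContDiffAt.contDiffWithinAt ?_⟩
  · exact hA.fderiv.symm
  · set Θ := Θ₀.restrOpen _ ho
    obtain ⟨-, hyΩ, B, hB⟩ := Θ.map_target hy
    have h2 : ContDiffAt ℝ ∞ Φ (Θ.symm y) := hΦ.contDiffAt (hΩ.mem_nhds hyΩ)
    refine Θ.contDiffAt_symm (f₀' := B) hy ?_ h2
    rw [hB]
    exact (h2.differentiableAt (by simp)).hasFDerivAt

end InverseFunction

/-! ### Splitting off the kernel of a surjection -/

section Splitting

variable {E₁ E₂ E H : Type*} [NormedAddCommGroup E₁] [InnerProductSpace ℝ E₁] [CompleteSpace E₁]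
  [NormedAddCommGroup E₂] [InnerProductSpace ℝ E₂] [CompleteSpace E₂]
  [NormedAddCommGroup E] [NormedSpace ℝ E] [CompleteSpace E]
  [NormedAddCommGroup H] [NormedSpace ℝ H] [CompleteSpace H]

-- The product carries the sup norm, so orthogonal projection to the kernel is borrowed from the
-- isomorphic ℓ² product.
omit [CompleteSpace E] in
theorem closedComplemented_ker_prod (D : E₁ × E₂ →L[ℝ] E) : D.ker.ClosedComplemented := by
  let w := WithLp.prodContinuousLinearEquiv 2 ℝ E₁ E₂
  let K := (D ∘L (w : WithLp 2 (E₁ × E₂) →L[ℝ] E₁ × E₂)).ker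
  have : CompleteSpace K := (ContinuousLinearMap.isClosed_ker _).completeSpace_coe
  refine ⟨((w : WithLp 2 (E₁ × E₂) →L[ℝ] E₁ × E₂) ∘L K.starProjection ∘L
    (w.symm : E₁ × E₂ →L[ℝ] WithLp 2 (E₁ × E₂))).codRestrict D.ker ?_, ?_⟩
  · intro x
    exact K.starProjection_apply_mem (w.symm x)
  · rintro ⟨x, hx⟩
    have hk : w.symm x ∈ K := by
      change D (w (w.symm x)) = 0
      rw [w.apply_symm_apply]; exact hx
    refine Subtype.ext ?_
    change w (K.starProjection (w.symm x)) = x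
    rw [Submodule.starProjection_eq_self_iff.2 hk, w.apply_symm_apply]

/-- A surjection from a product of Hilbert spaces extends to an isomorphism. -/
theorem exists_splitting (D : E₁ × E₂ →L[ℝ] E) (hD : Surjective D) (e : D.ker ≃L[ℝ] H) :
    ∃ A : (E₁ × E₂) ≃L[ℝ] H × E, ∀ v, (A v).2 = D v := by
  obtain ⟨p, hp⟩ := closedComplemented_ker_prod D
  have hs : Surjective p := fun x => ⟨x, hp x⟩
  have hk : IsCompl ((e : D.ker →L[ℝ] H) ∘L p).ker D.ker := by
    have h1 : ((e : D.ker →L[ℝ] H) ∘L p).ker = p.ker := by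
      ext x; simp
    rw [h1]
    exact (LinearMap.isCompl_of_proj hp).symm
  exact ⟨ContinuousLinearMap.equivProdOfSurjectiveOfIsCompl ((e : D.ker →L[ℝ] H) ∘L p) D
    (LinearMap.range_eq_top.2 (e.surjective.comp hs)) (LinearMap.range_eq_top.2 hD) hk,
    fun v => rfl⟩

/-- The kernel is isomorphic to a Hilbert space in the same universe. -/
theorem exists_hilbert_model {E₁ E₂ : Type u} [NormedAddCommGroup E₁] [InnerProductSpace ℝ E₁]
    [CompleteSpace E₁] [NormedAddCommGroup E₂] [InnerProductSpace ℝ E₂] [CompleteSpace E₂]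
    {E : Type*} [NormedAddCommGroup E] [NormedSpace ℝ E] (D : E₁ × E₂ →L[ℝ] E) :
    ∃ (H : Type u) (_ : NormedAddCommGroup H) (_ : InnerProductSpace ℝ H) (_ : CompleteSpace H),
      Nonempty (D.ker ≃L[ℝ] H) := by
  let w := WithLp.prodContinuousLinearEquiv 2 ℝ E₁ E₂
  let K := (D ∘L (w : WithLp 2 (E₁ × E₂) →L[ℝ] E₁ × E₂)).ker
  have hK : CompleteSpace K := (ContinuousLinearMap.isClosed_ker _).completeSpace_coe
  refine ⟨K, inferInstance, inferInstance, hK, ⟨ContinuousLinearEquiv.equivOfInverse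
    (((w.symm : E₁ × E₂ →L[ℝ] WithLp 2 (E₁ × E₂)) ∘L D.ker.subtypeL).codRestrict K ?_)
    (((w : WithLp 2 (E₁ × E₂) →L[ℝ] E₁ × E₂) ∘L K.subtypeL).codRestrict D.ker ?_) ?_ ?_⟩⟩
  · rintro ⟨x, hx⟩
    change D (w (w.symm x)) = 0
    rw [w.apply_symm_apply]; exact hx
  · rintro ⟨x, hx⟩
    exact hx
  · rintro ⟨x, hx⟩
    exact Subtype.ext (w.apply_symm_apply x)
  · rintro ⟨x, hx⟩
    exact Subtype.ext (w.symm_apply_apply x)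

end Splitting

/-! ## Smooth fibre products -/

section FibreProduct

variable {P Z B : HilbertManifold.{u}} {σ : P → B} {g : Z → B}

/-- The difference of two maps in charts around `x` and `σ x.1`. -/
theorem exists_adapted_chart (hσ : Smooth P B σ) (hg : Smooth Z B g) (x₀ : P × Z)
    (hx₀ : σ x₀.1 = g x₀.2) {H : Type u} [NormedAddCommGroup H] [NormedSpace ℝ H]
    (A : (P.model × Z.model) ≃L[ℝ] H × B.model)
    (hA : ∀ v, (A v).2 = differenceD σ g x₀ v) :
    ∃ Ψ : OpenPartialHomeomorph (P × Z) (H × B.model), x₀ ∈ Ψ.source ∧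
      ContMDiffOn (𝓘(ℝ, P.model).prod 𝓘(ℝ, Z.model)) 𝓘(ℝ, H × B.model) ∞ Ψ Ψ.source ∧
      ContMDiffOn 𝓘(ℝ, H × B.model) (𝓘(ℝ, P.model).prod 𝓘(ℝ, Z.model)) ∞ Ψ.symm Ψ.target ∧
      (∀ x ∈ Ψ.source, σ x.1 = g x.2 ↔ (Ψ x).2 = 0) ∧
      HasFDerivAt (fun y => (chartAt P.model x₀.1 (Ψ.symm y).1, chartAt Z.model x₀.2 (Ψ.symm y).2))
        (A.symm : H × B.model →L[ℝ] P.model × Z.model) (Ψ x₀) := by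
  obtain ⟨p₀, z₀⟩ := x₀
  simp only at hx₀
  set φ := chartAt P.model p₀
  set ψ := chartAt Z.model z₀
  set χ := chartAt B.model (σ p₀) with hχ
  let U := φ.target ∩ φ.symm ⁻¹' (σ ⁻¹' χ.source)
  let V := ψ.target ∩ ψ.symm ⁻¹' (g ⁻¹' χ.source)
  have hU : IsOpen U := isOpen_chart_domain (ContMDiff.continuous hσ) p₀ (σ p₀)
  have hV : IsOpen V := isOpen_chart_domain (ContMDiff.continuous hg) z₀ (σ p₀)
  have h0U : φ p₀ ∈ U := ⟨mem_chart_target _ _, by simp [φ, χ]⟩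
  have h0V : ψ z₀ ∈ V := ⟨mem_chart_target _ _, by simp [ψ, χ, hx₀]⟩
  have hσ' := hσ.contDiffOn_charts p₀ (σ p₀)
  have hg' := hg.contDiffOn_charts z₀ (σ p₀)
  let G : P.model × Z.model → B.model := fun v => χ (σ (φ.symm v.1)) - χ (g (ψ.symm v.2))
  have hG : ContDiffOn ℝ ∞ G (U ×ˢ V) :=
    (hσ'.comp contDiff_fst.contDiffOn fun v hv => hv.1).sub
      (hg'.comp contDiff_snd.contDiffOn fun v hv => hv.2)
  have hGd : HasFDerivAt G (differenceD σ g (p₀, z₀)) (φ p₀, ψ z₀) := by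
    have h1 : HasFDerivAt (fun v => χ (σ (φ.symm v))) (differential P B σ p₀) (φ p₀) := by
      rw [hσ.differential_eq]
      exact ((hσ'.contDiffAt (hU.mem_nhds h0U)).differentiableAt (by simp)).hasFDerivAt
    have h2 : HasFDerivAt (fun v => χ (g (ψ.symm v))) (differential Z B g z₀) (ψ z₀) := by
      rw [hg.differential_eq, ← hx₀]
      exact ((hg'.contDiffAt (hV.mem_nhds h0V)).differentiableAt (by simp)).hasFDerivAt
    have h3 := (h1.comp (φ p₀, ψ z₀) (hasFDerivAt_fst (𝕜 := ℝ) (p := (φ p₀, ψ z₀)))).sub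
      (h2.comp (φ p₀, ψ z₀) (hasFDerivAt_snd (𝕜 := ℝ) (p := (φ p₀, ψ z₀))))
    refine h3.congr_fderiv ?_
    ext v
    · simp [differenceD]
    · simp [differenceD]
  -- The kernel coordinate is kept linear and the second one is the nonlinear difference, so the
  -- derivative at the base point is exactly A and the fibre product becomes the slice where the
  -- second coordinate is 0.
  let Φ : P.model × Z.model → H × B.model := fun v => ((A v).1, G v)
  have hΦ : ContDiffOn ℝ ∞ Φ (U ×ˢ V) :=
    (contDiff_fst.comp A.contDiff).contDiffOn.prodMk hG
  have hΦd : HasFDerivAt Φ (A : P.model × Z.model →L[ℝ] H × B.model) (φ p₀, ψ z₀) := by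
    have h1 : HasFDerivAt (fun v => (A v).1) ((ContinuousLinearMap.fst ℝ H B.model) ∘L
      (A : P.model × Z.model →L[ℝ] H × B.model)) (φ p₀, ψ z₀) :=
      ((ContinuousLinearMap.fst ℝ H B.model) ∘L
        (A : P.model × Z.model →L[ℝ] H × B.model)).hasFDerivAt
    refine (h1.prodMk hGd).congr_fderiv ?_
    refine ContinuousLinearMap.ext fun v => ?_
    exact Prod.ext rfl (hA v).symm
  obtain ⟨Θ, hΘ, h0Θ, hΘs, hΘi⟩ := exists_smooth_localInverse (hU.prod hV) hΦ ⟨h0U, h0V⟩ hΦd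
  let e : OpenPartialHomeomorph (P × Z) (P.model × Z.model) := φ.prod ψ
  have he : ContMDiffOn (𝓘(ℝ, P.model).prod 𝓘(ℝ, Z.model)) 𝓘(ℝ, P.model × Z.model) ∞ e e.source :=
    ((contMDiffOn_chart (x := p₀)).comp contMDiffOn_fst fun x hx => hx.1).prodMk_space
      ((contMDiffOn_chart (x := z₀)).comp contMDiffOn_snd fun x hx => hx.2)
  have hei : ContMDiffOn 𝓘(ℝ, P.model × Z.model) (𝓘(ℝ, P.model).prod 𝓘(ℝ, Z.model)) ∞
      e.symm e.target :=
    ((contMDiffOn_chart_symm (x := p₀)).comp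
      contDiff_fst.contMDiff.contMDiffOn fun x hx => hx.1).prodMk
      ((contMDiffOn_chart_symm (x := z₀)).comp
        contDiff_snd.contMDiff.contMDiffOn fun x hx => hx.2)
  refine ⟨e.trans Θ, ⟨⟨mem_chart_source _ _, mem_chart_source _ _⟩, h0Θ⟩, ?_, ?_, ?_, ?_⟩
  · rw [OpenPartialHomeomorph.coe_trans]
    refine ContMDiffOn.comp (t := Θ.source) ?_ (he.mono fun x hx => hx.1) fun x hx => hx.2
    rw [hΘ]
    exact (hΦ.mono hΘs).contMDiffOn
  · rw [OpenPartialHomeomorph.coe_trans_symm]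
    exact hei.comp (hΘi.contMDiffOn.mono fun y hy => hy.1) fun y hy => hy.2
  · rintro ⟨p, z⟩ ⟨⟨hp, hz⟩, hpz⟩
    have h1 : (φ p, ψ z) ∈ U ×ˢ V := hΘs hpz
    have h2 : (e.trans Θ (p, z)).2 = χ (σ p) - χ (g z) := by
      have hpp : φ.symm (φ p) = p := φ.left_inv hp
      have hzz : ψ.symm (ψ z) = z := ψ.left_inv hz
      have : Θ (φ p, ψ z) = Φ (φ p, ψ z) := by rw [hΘ]
      change (Θ (φ p, ψ z)).2 = _
      rw [this]
      simp only [Φ, G, hpp, hzz]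
    have hp' : σ p ∈ χ.source := by simpa [φ.left_inv hp] using h1.1.2
    have hz' : g z ∈ χ.source := by simpa [ψ.left_inv hz] using h1.2.2
    simp only [h2, sub_eq_zero]
    exact ⟨fun h => by rw [h], fun h => χ.injOn hp' hz' h⟩
  -- The derivative is recorded in the preferred charts at p₀ and z₀, in which the manifold
  -- derivative is computed.
  · have h1 : HasFDerivAt Θ (A : P.model × Z.model →L[ℝ] H × B.model)
        (Θ.symm (Θ (φ p₀, ψ z₀))) := by
      rw [Θ.left_inv h0Θ, hΘ]; exact hΦd
    have h2 := Θ.hasFDerivAt_symm (Θ.map_source h0Θ) h1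
    have h3 : (fun y => (φ ((e.trans Θ).symm y).1, ψ ((e.trans Θ).symm y).2))
        =ᶠ[𝓝 (Θ (φ p₀, ψ z₀))] Θ.symm := by
      filter_upwards [Θ.open_target.mem_nhds (Θ.map_source h0Θ)] with y hy
      have h4 := hΘs (Θ.map_target hy)
      exact Prod.ext (φ.right_inv h4.1.1) (ψ.right_inv h4.2.1)
    exact h2.congr_of_eventuallyEq h3

variable {Q : Type u} [TopologicalSpace Q] {ι : Q → P × Z}

/-- The chart of a fibre product induced by an adapted chart. -/
theorem exists_slice_chart (hι : IsEmbedding ι) (hr : range ι = {x : P × Z | σ x.1 = g x.2})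
    {H : Type u} [NormedAddCommGroup H] [NormedSpace ℝ H]
    (Ψ : OpenPartialHomeomorph (P × Z) (H × B.model))
    (hΨ : ∀ x ∈ Ψ.source, σ x.1 = g x.2 ↔ (Ψ x).2 = 0) (q₀ : Q) :
    ∃ c : OpenPartialHomeomorph Q H, c.source = ι ⁻¹' Ψ.source ∧
      (∀ q, c q = (Ψ (ι q)).1) ∧ (∀ h, h ∈ c.target ↔ (h, 0) ∈ Ψ.target) ∧
      ∀ h ∈ c.target, ι (c.symm h) = Ψ.symm (h, 0) := by
  have : Nonempty Q := ⟨q₀⟩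
  let T : Set H := {h | (h, (0 : B.model)) ∈ Ψ.target}
  have hT : IsOpen T := Ψ.open_target.preimage (by fun_prop)
  let k : H → P × Z := fun h => Ψ.symm (h, 0)
  have hk : ContinuousOn k T := Ψ.symm.continuousOn.comp (by fun_prop) fun h hh => hh
  -- Points of the slice solve the equation, so `invFun ι` is only ever used on the range of ι.
  have hkr : ∀ h ∈ T, k h ∈ range ι := fun h hh => by
    rw [hr]
    have h1 : Ψ (k h) = (h, 0) := Ψ.right_inv hh
    exact (hΨ _ (Ψ.map_target hh)).2 (by rw [h1])
  have hinv : ∀ h ∈ T, ι (invFun ι (k h)) = k h := fun h hh => invFun_eq (hkr h hh)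
  have hmem : ∀ q, ι q ∈ Ψ.source → Ψ (ι q) = ((Ψ (ι q)).1, 0) := fun q hq => by
    have : ι q ∈ {x : P × Z | σ x.1 = g x.2} := hr ▸ ⟨q, rfl⟩
    exact Prod.ext rfl ((hΨ _ hq).1 this)
  let c : PartialEquiv Q H :=
    ⟨fun q => (Ψ (ι q)).1, fun h => invFun ι (k h), ι ⁻¹' Ψ.source, T, ?_, ?_, ?_, ?_⟩
  · refine ⟨⟨⟨c, ?_, ?_⟩, Ψ.open_source.preimage hι.continuous, hT⟩, rfl, fun _ => rfl,
      fun _ => Iff.rfl, hinv⟩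
    · exact continuous_fst.comp_continuousOn
        (Ψ.continuousOn.comp hι.continuous.continuousOn fun q hq => hq)
    · refine (hι.isInducing.continuousOn_iff).2 ?_
      exact hk.congr fun h hh => hinv h hh
  · intro q hq
    change ((Ψ (ι q)).1, 0) ∈ Ψ.target
    rw [← hmem q hq]
    exact Ψ.map_source hq
  · intro h hh
    change ι _ ∈ Ψ.source
    rw [hinv h hh]
    exact Ψ.map_target hh
  · intro q hq
    apply hι.injective
    have hq' : (Ψ (ι q)).1 ∈ T := by
      change ((Ψ (ι q)).1, 0) ∈ Ψ.target
      rw [← hmem q hq]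
      exact Ψ.map_source hq
    change ι (invFun ι (k (Ψ (ι q)).1)) = ι q
    rw [hinv _ hq']
    change Ψ.symm ((Ψ (ι q)).1, 0) = ι q
    rw [← hmem q hq, Ψ.left_inv hq]
  · intro h hh
    rw [hinv h hh]
    exact congrArg Prod.fst (Ψ.right_inv hh)

/-- The preimage theorem for the difference of σ and g: each surjective differential with kernel H
yields a slice chart, and transition maps are smooth because they are restrictions of transitions
between adapted charts of P × Z. Identifying the tangent space with the kernel is what the index
computation consumes. -/
theorem exists_fibreProduct_structure (hσ : Smooth P B σ) (hg : Smooth Z B g)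
    (hι : IsEmbedding ι) (hr : range ι = {x : P × Z | σ x.1 = g x.2})
    (H : Type u) [NormedAddCommGroup H] [InnerProductSpace ℝ H] [CompleteSpace H]
    (hsurj : ∀ x : P × Z, σ x.1 = g x.2 → Surjective (differenceD σ g x))
    (hker : ∀ x : P × Z, σ x.1 = g x.2 → Nonempty ((differenceD σ g x).ker ≃L[ℝ] H)) :
    ∃ (_ : ChartedSpace H Q) (_ : IsManifold 𝓘(ℝ, H) ∞ Q),
      Manifold.IsSmoothEmbedding 𝓘(ℝ, H) (𝓘(ℝ, P.model).prod 𝓘(ℝ, Z.model)) ∞ ι ∧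
      ∀ q : Q,
        Injective ((mfderiv 𝓘(ℝ, H) 𝓘(ℝ, P.model) (fun q => (ι q).1) q : H →L[ℝ] P.model).prod
          (mfderiv 𝓘(ℝ, H) 𝓘(ℝ, Z.model) (fun q => (ι q).2) q : H →L[ℝ] Z.model)) ∧
        ((mfderiv 𝓘(ℝ, H) 𝓘(ℝ, P.model) (fun q => (ι q).1) q : H →L[ℝ] P.model).prod
          (mfderiv 𝓘(ℝ, H) 𝓘(ℝ, Z.model) (fun q => (ι q).2) q : H →L[ℝ] Z.model)).range =
          (differenceD σ g (ι q)).ker := by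
  have hmem : ∀ q, σ (ι q).1 = g (ι q).2 := fun q => by
    have : ι q ∈ {x : P × Z | σ x.1 = g x.2} := hr ▸ ⟨q, rfl⟩
    exact this
  have h1 : ∀ q : Q, ∃ A : (P.model × Z.model) ≃L[ℝ] H × B.model,
      ∀ v, (A v).2 = differenceD σ g (ι q) v := fun q =>
    exists_splitting _ (hsurj _ (hmem q)) (hker _ (hmem q)).some
  choose A hA using h1
  choose Ψ hΨ₀ hΨs hΨi hΨe hΨd using fun q =>
    exists_adapted_chart hσ hg (ι q) (hmem q) (A q) (hA q)
  choose c hcs hc hct hci using fun q => exists_slice_chart hι hr (Ψ q) (hΨe q) q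
  have hq₀ : ∀ q, q ∈ (c q).source := fun q => by
    rw [hcs]; exact hΨ₀ q
  let cs : ChartedSpace H Q :=
    { atlas := range c
      chartAt := c
      mem_chart_source := hq₀
      chart_mem_atlas := fun q => ⟨q, rfl⟩ }
  have hzero : ContDiff ℝ ∞ fun h : H => (h, (0 : B.model)) := contDiff_id.prodMk contDiff_const
  have hk : ∀ q, ContMDiffOn 𝓘(ℝ, H) (𝓘(ℝ, P.model).prod 𝓘(ℝ, Z.model)) ∞
      (fun h => (Ψ q).symm (h, 0)) (c q).target := fun q =>
    (hΨi q).comp hzero.contMDiff.contMDiffOn fun h hh => (hct q h).1 hh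
  have hm : IsManifold 𝓘(ℝ, H) ∞ Q := by
    refine isManifold_of_contDiffOn _ _ _ ?_
    rintro _ _ ⟨q, rfl⟩ ⟨q', rfl⟩
    simp only [mfld_simps]
    rw [← contMDiffOn_iff_contDiffOn]
    have h2 : ContMDiffOn 𝓘(ℝ, H) 𝓘(ℝ, H) ∞ (fun h => (Ψ q' ((Ψ q).symm (h, 0))).1)
        ((c q).target ∩ (c q).symm ⁻¹' (c q').source) := by
      have h3 := (hΨs q').comp ((hk q).mono inter_subset_left) (t := (Ψ q').source)
        (s := (c q).target ∩ (c q).symm ⁻¹' (c q').source) ?_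
      · exact contDiff_fst.contMDiff.comp_contMDiffOn h3
      · rintro h ⟨hh, hh'⟩
        rw [mem_preimage, hcs] at hh'
        have h4 : ι ((c q).symm h) ∈ (Ψ q').source := hh'
        rwa [hci q h hh] at h4
    refine h2.congr ?_
    rintro h ⟨hh, hh'⟩
    simp only [Function.comp_apply]
    rw [hc, hci q h hh]
  have himm : ∀ q, Manifold.IsImmersionAtOfComplement B.model 𝓘(ℝ, H)
      (𝓘(ℝ, P.model).prod 𝓘(ℝ, Z.model)) ∞ ι q := by
    intro q
    let _ : ChartedSpace (P.model × Z.model) (P × Z) := prodChartedSpace P.model P Z.model Z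
    -- The immersion normal form asks for a chart of P × Z valued in its own model, so the adapted
    -- chart is followed by the inverse of A.
    have hcod : (Ψ q).trans (A q).symm.toHomeomorph.toOpenPartialHomeomorph ∈
        IsManifold.maximalAtlas (H := P.model × Z.model) 𝓘(ℝ, P.model × Z.model) ∞ (P × Z) := by
      have : IsManifold 𝓘(ℝ, P.model × Z.model) ∞ (P × Z) := by
        rw [modelWithCornersSelf_prod]
        exact (inferInstance : IsManifold (𝓘(ℝ, P.model).prod 𝓘(ℝ, Z.model)) ∞ (P × Z))
      refine OpenPartialHomeomorph.mem_maximalAtlas_of_contMDiffOn (H := P.model × Z.model)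
        (I := 𝓘(ℝ, P.model × Z.model)) (n := ∞) (M := P × Z) _ ?_ ?_
      · rw [OpenPartialHomeomorph.coe_trans]
        refine ContMDiffOn.comp (t := univ) (I' := 𝓘(ℝ, H × B.model))
          (A q).symm.contDiff.contMDiff.contMDiffOn ?_ fun _ _ => mem_univ _
        have := hΨs q
        rw [← modelWithCornersSelf_prod] at this
        exact this.mono fun x hx => hx.1
      · rw [OpenPartialHomeomorph.coe_trans_symm]
        have := hΨi q
        rw [← modelWithCornersSelf_prod] at this
        refine ContMDiffOn.comp (t := (Ψ q).target) this (A q).contDiff.contMDiff.contMDiffOn ?_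
        exact fun x hx => hx.2
    rw [modelWithCornersSelf_prod] at hcod
    refine Manifold.IsImmersionAtOfComplement.mk_of_continuousAt hι.continuous.continuousAt
      (A q).symm (c q) ((Ψ q).trans (A q).symm.toHomeomorph.toOpenPartialHomeomorph) (hq₀ q)
      ⟨hΨ₀ q, trivial⟩ (IsManifold.chart_mem_maximalAtlas q) hcod ?_
    intro h hh
    have hh' : h ∈ (c q).target := by simpa only [mfld_simps] using hh
    have h2 : Ψ q (ι ((c q).symm h)) = (h, 0) := by
      rw [hci q h hh']
      exact (Ψ q).right_inv ((hct q h).1 hh')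
    change (A q).symm (Ψ q (ι ((c q).symm h))) = (A q).symm (h, 0)
    rw [h2]
  have hsm : Manifold.IsSmoothEmbedding 𝓘(ℝ, H) (𝓘(ℝ, P.model).prod 𝓘(ℝ, Z.model)) ∞ ι :=
    ⟨Manifold.IsImmersionOfComplement.isImmersion himm, hι⟩
  refine ⟨cs, hm, hsm, fun q => ?_⟩
  have hιs := hsm.contMDiff
  have hd1 : MDifferentiableAt 𝓘(ℝ, H) 𝓘(ℝ, P.model) (fun q => (ι q).1) q :=
    (contMDiff_fst.comp hιs).mdifferentiableAt (by simp)
  have hd2 : MDifferentiableAt 𝓘(ℝ, H) 𝓘(ℝ, Z.model) (fun q => (ι q).2) q :=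
    (contMDiff_snd.comp hιs).mdifferentiableAt (by simp)
  have hcq : (c q) q = (Ψ q (ι q)).1 := hc q q
  have hΨq : Ψ q (ι q) = ((c q) q, 0) :=
    Prod.ext hcq.symm ((hΨe q _ (hΨ₀ q)).1 (hmem q))
  -- In the slice chart the embedding has derivative h ↦ A⁻¹(h, 0); since the second component of A
  -- is the difference, its range is the kernel of the difference.
  have hJ : HasFDerivAt (fun h => (chartAt P.model (ι q).1 (ι ((c q).symm h)).1,
      chartAt Z.model (ι q).2 (ι ((c q).symm h)).2))
      (((A q).symm : H × B.model →L[ℝ] P.model × Z.model) ∘L ContinuousLinearMap.inl ℝ H B.model)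
      ((c q) q) := by
    have h2 := hΨd q
    rw [hΨq] at h2
    have h3 := h2.comp (c q q) (ContinuousLinearMap.inl ℝ H B.model).hasFDerivAt
    refine h3.congr_of_eventuallyEq ?_
    filter_upwards [(c q).open_target.mem_nhds ((c q).map_source (hq₀ q))] with h hh
    simp only [hci q h hh]
    rfl
  have e1 : (mfderiv 𝓘(ℝ, H) 𝓘(ℝ, P.model) (fun q => (ι q).1) q : H →L[ℝ] P.model) =
      ContinuousLinearMap.fst ℝ _ _ ∘L
      (((A q).symm : H × B.model →L[ℝ] P.model × Z.model) ∘L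
        ContinuousLinearMap.inl ℝ H B.model) := by
    rw [hd1.mfderiv]
    simp only [mfld_simps, fderivWithin_univ]
    exact hJ.fst.fderiv
  have e2 : (mfderiv 𝓘(ℝ, H) 𝓘(ℝ, Z.model) (fun q => (ι q).2) q : H →L[ℝ] Z.model) =
      ContinuousLinearMap.snd ℝ _ _ ∘L
      (((A q).symm : H × B.model →L[ℝ] P.model × Z.model) ∘L
        ContinuousLinearMap.inl ℝ H B.model) := by
    rw [hd2.mfderiv]
    simp only [mfld_simps, fderivWithin_univ]
    exact hJ.snd.fderiv
  rw [e1, e2]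
  constructor
  · intro x y hxy
    have : (A q).symm (x, 0) = (A q).symm (y, 0) := hxy
    exact (Prod.ext_iff.1 ((A q).symm.injective this)).1
  · ext v
    constructor
    · rintro ⟨x, rfl⟩
      change differenceD σ g (ι q) ((A q).symm (x, 0)) = 0
      rw [← hA q, (A q).apply_symm_apply]
    · intro hv
      refine ⟨(A q v).1, ?_⟩
      change (A q).symm ((A q v).1, 0) = v
      have : ((A q v).1, 0) = A q v := Prod.ext rfl (((hA q v).trans hv).symm)
      rw [this]
      exact (A q).symm_apply_apply v

end FibreProduct

/-! ## Fibre products with a correspondence -/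

section Strata

variable {B₀ B₁ : FloerSpace.{u}} (F : Correspondence B₀ B₁)

/-- The fibre product of a semi-infinite map with a correspondence. -/
theorem SemiInfinite.exists_fibreProduct {P : HilbertManifold.{u}} {σ : P → B₀}
    (hs : Smooth P B₀.toHilbertManifold σ) (hσ : SemiInfinite B₀ P σ)
    {Q : Type u} [TopologicalSpace Q] [T2Space Q] [SecondCountableTopology Q]
    (p : Q → P) (z : Q → F.dom) (he : IsEmbedding fun q => (p q, z q))
    (hr : range (fun q => (p q, z q)) = {x : P × F.dom | σ x.1 = F.map₀ x.2})
    (H : Type u) [NormedAddCommGroup H] [InnerProductSpace ℝ H] [CompleteSpace H]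
    (hker : ∀ x : P × F.dom, σ x.1 = F.map₀ x.2 →
      Nonempty ((differenceD (B := B₀.toHilbertManifold) σ F.map₀ x).ker ≃L[ℝ] H)) :
    ∃ (_ : ChartedSpace H Q) (_ : IsManifold 𝓘(ℝ, H) ∞ Q),
      FloerBordism.IsFibreProduct (Q := ⟨Q, H⟩) σ F.map₀ p z ∧
      ∀ τ : Q → B₁, (∀ q, τ q = F.map₁ (z q)) →
        Smooth ⟨Q, H⟩ B₁.toHilbertManifold τ ∧ SemiInfinite B₁ ⟨Q, H⟩ τ ∧
        ∀ q, fredholmIndex (B₁.minusD ⟨Q, H⟩ τ q) = fredholmIndex (B₀.minusD P σ (p q)) +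
          fredholmIndex ((B₀.plusD F.dom F.map₀ (z q)).prod (B₁.minusD F.dom F.map₁ (z q))) := by
  have hpz : ∀ q, σ (p q) = F.map₀ (z q) := fun q => by
    have : (p q, z q) ∈ {x : P × F.dom | σ x.1 = F.map₀ x.2} := hr ▸ ⟨q, rfl⟩
    exact this
  obtain ⟨cs, hm, hemb, hd⟩ := exists_fibreProduct_structure (B := B₀.toHilbertManifold) hs
    F.smooth₀ he hr H (fun x hx => hσ.surjective_differenceD F hx) hker
  refine ⟨cs, hm, ⟨hemb, hr⟩, fun τ hτ => ?_⟩
  obtain rfl : τ = fun q => F.map₁ (z q) := funext hτ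
  have hz : ContMDiff 𝓘(ℝ, H) 𝓘(ℝ, F.dom.model) ∞ z := contMDiff_snd.comp hemb.contMDiff
  have hdiff : ∀ q, differential ⟨Q, H⟩ B₁.toHilbertManifold (fun q => F.map₁ (z q)) q =
      differential F.dom B₁.toHilbertManifold F.map₁ (z q) ∘L
        (mfderiv 𝓘(ℝ, H) 𝓘(ℝ, F.dom.model) z q : H →L[ℝ] F.dom.model) := fun q =>
    mfderiv_comp q ((ContMDiff.contMDiffAt F.smooth₁).mdifferentiableAt (by simp))
      (hz.contMDiffAt.mdifferentiableAt (by simp))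
  have key := fun q => hσ.hasFiniteIndex_on_ker F (hpz q) (Q := H)
    (mfderiv 𝓘(ℝ, H) 𝓘(ℝ, P.model) p q) (mfderiv 𝓘(ℝ, H) 𝓘(ℝ, F.dom.model) z q)
    (hd q).1 (hd q).2
  have hminus : ∀ q, B₁.minusD ⟨Q, H⟩ (fun q => F.map₁ (z q)) q =
      B₁.toMinus (F.map₁ (z q)) ∘L (differential F.dom B₁.toHilbertManifold F.map₁ (z q) ∘L
        (mfderiv 𝓘(ℝ, H) 𝓘(ℝ, F.dom.model) z q : H →L[ℝ] F.dom.model)) := fun q => by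
    rw [← hdiff]; rfl
  refine ⟨ContMDiff.comp F.smooth₁ hz, ⟨fun q => ?_, fun q => ?_⟩, fun q => ?_⟩
  · rw [hminus]
    have : CompleteSpace (B₁.TMinus (F.map₁ (z q))) :=
      (isClosed_range_of_idem (B₁.projMinus_idem _)).completeSpace_coe
    exact HasFiniteIndex.isFredholm (key q).1
  · have : B₁.plusD ⟨Q, H⟩ (fun q => F.map₁ (z q)) q =
      B₁.toPlus (F.map₁ (z q)) ∘L (differential F.dom B₁.toHilbertManifold F.map₁ (z q) ∘L
        (mfderiv 𝓘(ℝ, H) 𝓘(ℝ, F.dom.model) z q : H →L[ℝ] F.dom.model)) := by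
      rw [← hdiff]; rfl
    rw [this]
    exact hσ.isCompactOperator_on_ker F (hpz q) (Q := H)
      (mfderiv 𝓘(ℝ, H) 𝓘(ℝ, P.model) p q) (mfderiv 𝓘(ℝ, H) 𝓘(ℝ, F.dom.model) z q) (hd q).2.le
  · rw [hminus]
    exact (key q).2

theorem exists_common_hilbert_model {P Z B : HilbertManifold.{u}} {σ : P → B} {g : Z → B}
    (h : ∀ x x' : P × Z, σ x.1 = g x.2 → σ x'.1 = g x'.2 →
      Nonempty ((differenceD σ g x).ker ≃L[ℝ] (differenceD σ g x').ker)) :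
    ∃ (H : Type u) (_ : NormedAddCommGroup H) (_ : InnerProductSpace ℝ H) (_ : CompleteSpace H),
      ∀ x : P × Z, σ x.1 = g x.2 → Nonempty ((differenceD σ g x).ker ≃L[ℝ] H) := by
  by_cases hne : ∃ x : P × Z, σ x.1 = g x.2
  · obtain ⟨x₀, hx₀⟩ := hne
    obtain ⟨H, i₁, i₂, i₃, ⟨e⟩⟩ := exists_hilbert_model (differenceD σ g x₀)
    exact ⟨H, i₁, i₂, i₃, fun x hx => ⟨(h x x₀ hx hx₀).some.trans e⟩⟩
  -- For an empty fibre product any Hilbert space serves as the model.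
  · exact ⟨Z.model, inferInstance, inferInstance, inferInstance, fun x hx => (hne ⟨x, hx⟩).elim⟩

theorem FloerCycle.exists_isFibreProduct {n k : ℤ} (hF : F.HasIndex k) (σ : CycleOfIndex B₀ n) :
    ∃ τ : CycleOfIndex B₁ (n + k), σ.1.IsFibreProduct F τ.1 := by
  obtain ⟨σ, hn⟩ := σ
  let Q := {x : σ.dom × F.dom // σ.map x.1 = F.map₀ x.2}
  obtain ⟨H, _, _, _, hH⟩ := exists_common_hilbert_model (B := B₀.toHilbertManifold)
    (σ := σ.map) (g := F.map₀) fun x x' hx hx' =>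
      σ.semiInfinite.nonempty_ker_equiv F hn hF hx hx'
  have hr : range (fun q : Q => (q.1.1, q.1.2)) =
      {x : σ.dom × F.dom | σ.map x.1 = F.map₀ x.2} := Subtype.range_coe
  have : SecondCountableTopology Q := TopologicalSpace.Subtype.secondCountableTopology _
  obtain ⟨_, _, h1, h2⟩ := σ.semiInfinite.exists_fibreProduct F σ.smooth
    (fun q : Q => q.1.1) (fun q : Q => q.1.2) IsEmbedding.subtypeVal hr H hH
  obtain ⟨h3, h4, h5⟩ := h2 (fun q => F.map₁ q.1.2) fun q => rfl
  refine ⟨⟨⟨⟨Q, H⟩, fun q => F.map₁ q.1.2, h3, ?_, h4⟩, fun q => ?_⟩, _, _, h1, fun q => rfl⟩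
  · exact σ.compactness.fibreProduct F (ContMDiff.continuous σ.smooth) _ _
      IsEmbedding.subtypeVal hr fun q => rfl
  · change fredholmIndex (B₁.minusD ⟨Q, H⟩ (fun q : Q => F.map₁ q.1.2) q) = n + k
    rw [h5, hn, hF]

end Strata

/-! ## Functoriality of fibre products -/

section Functoriality

variable {P P' Z Q Q' : HilbertManifold.{u}} {B : Type u} {σ : P → B} {σ' : P' → B} {g : Z → B}
  {p : Q → P} {z : Q → Z} {p' : Q' → P'} {z' : Q' → Z}

theorem exists_diffeo_of_bijective {f : P → P'}
    (hf : IsLocalDiffeomorph 𝓘(ℝ, P.model) 𝓘(ℝ, P'.model) ∞ f) (hb : Bijective f) :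
    ∃ φ : Diffeo P P', ∀ x, φ x = f x := by
  obtain ⟨g, hgf, hfg⟩ := bijective_iff_has_inverse.1 hb
  refine ⟨⟨⟨f, g, hgf, hfg⟩, hf.contMDiff, fun y => ?_⟩, fun x => rfl⟩
  -- Injectivity forces the global inverse to agree near y with the smooth local one.
  have h1 := (hf (g y)).localInverse_contMDiffAt
  have h2 := (hf (g y)).localInverse_eventuallyEq_right
  rw [hfg y] at h1 h2
  refine h1.congr_of_eventuallyEq ?_
  filter_upwards [h2] with y' hy'
  exact hb.1 ((hfg y').trans hy'.symm)

theorem IsFibreProduct.comm (h : FloerBordism.IsFibreProduct σ g p z) (q : Q) :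
    σ (p q) = g (z q) := by
  have : (p q, z q) ∈ {x : P × Z | σ x.1 = g x.2} := h.range_eq ▸ ⟨q, rfl⟩
  exact this

/-- An injective local diffeomorphism over the base induces one of the fibre products. -/
theorem IsFibreProduct.exists_map (h : FloerBordism.IsFibreProduct σ g p z)
    (h' : FloerBordism.IsFibreProduct σ' g p' z') {i : P → P'}
    (hi : IsLocalDiffeomorph 𝓘(ℝ, P.model) 𝓘(ℝ, P'.model) ∞ i) (hinj : Injective i)
    (hσ : ∀ x, σ' (i x) = σ x) :
    ∃ j : Q → Q', IsLocalDiffeomorph 𝓘(ℝ, Q.model) 𝓘(ℝ, Q'.model) ∞ j ∧ Injective j ∧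
      range j = p' ⁻¹' range i ∧ ∀ q, z' (j q) = z q := by
  have hp : ContMDiff 𝓘(ℝ, Q.model) 𝓘(ℝ, P.model) ∞ p :=
    contMDiff_fst.comp h.isSmoothEmbedding.contMDiff
  have hz : ContMDiff 𝓘(ℝ, Q.model) 𝓘(ℝ, Z.model) ∞ z :=
    contMDiff_snd.comp h.isSmoothEmbedding.contMDiff
  have hp' : ContMDiff 𝓘(ℝ, Q'.model) 𝓘(ℝ, P'.model) ∞ p' :=
    contMDiff_fst.comp h'.isSmoothEmbedding.contMDiff
  have hz' : ContMDiff 𝓘(ℝ, Q'.model) 𝓘(ℝ, Z.model) ∞ z' :=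
    contMDiff_snd.comp h'.isSmoothEmbedding.contMDiff
  -- The map is induced by i × id on P × Z.
  have hex : ∀ q, ∃ q', (p' q', z' q') = (i (p q), z q) := fun q => by
    have : (i (p q), z q) ∈ range fun q => (p' q, z' q) := by
      rw [h'.range_eq]
      exact (hσ _).trans (h.comm q)
    exact this
  choose j hj using hex
  have hj1 : ∀ q, p' (j q) = i (p q) := fun q => congrArg Prod.fst (hj q)
  have hj2 : ∀ q, z' (j q) = z q := fun q => congrArg Prod.snd (hj q)
  have hjinj : Injective j := fun q₁ q₂ hq => h.isSmoothEmbedding.isEmbedding.injective <| by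
    refine Prod.ext (hinj ?_) ?_
    · simp only [← hj1, hq]
    · simp only [← hj2, hq]
  have hrange : range j = p' ⁻¹' range i := by
    ext q'
    constructor
    · rintro ⟨q, rfl⟩
      exact ⟨p q, (hj1 q).symm⟩
    · rintro ⟨x, hx⟩
      have : (x, z' q') ∈ range fun q => (p q, z q) := by
        rw [h.range_eq]
        change σ x = g (z' q')
        rw [← h'.comm q', ← hx, hσ]
      obtain ⟨q, hq⟩ := this
      have h1 : p q = x := congrArg Prod.fst hq
      have h2 : z q = z' q' := congrArg Prod.snd hq
      refine ⟨q, h'.isSmoothEmbedding.isEmbedding.injective (Prod.ext ?_ ?_)⟩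
      · exact (hj1 q).trans (by rw [h1, hx])
      · exact (hj2 q).trans h2
  -- A map into an embedded submanifold is smooth once it is smooth into the ambient manifold; the
  -- inverse is treated in the same way with the local inverse of i.
  have hjs : ContMDiff 𝓘(ℝ, Q.model) 𝓘(ℝ, Q'.model) ∞ j := by
    rw [ContMDiff.iff_comp_isImmersion h'.isSmoothEmbedding.isImmersion]
    have h1 : (fun q => (p' q, z' q)) ∘ j = fun q => (i (p q), z q) := funext hj
    have h2 : ContMDiff 𝓘(ℝ, Q.model) (𝓘(ℝ, P'.model).prod 𝓘(ℝ, Z.model)) ∞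
        fun q => (i (p q), z q) := (hi.contMDiff.comp hp).prodMk hz
    rw [h1]
    refine ⟨h'.isSmoothEmbedding.isEmbedding.isInducing.continuous_iff.2 ?_, h2⟩
    rw [h1]
    exact h2.continuous
  refine ⟨j, fun q₀ => ?_, hjinj, hrange, hj2⟩
  have : Nonempty Q := ⟨q₀⟩
  have hright : ∀ q' ∈ range j, j (invFun j q') = q' := fun q' hq' => invFun_eq hq'
  refine ⟨⟨⟨j, invFun j, univ, range j, fun q _ => ⟨q, rfl⟩, fun _ _ => trivial,
    fun q _ => leftInverse_invFun hjinj q, hright⟩, isOpen_univ, ?_, hjs.contMDiffOn, ?_⟩,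
    trivial, fun _ _ => rfl⟩
  · change IsOpen (range j)
    rw [hrange]
    exact hi.isOpen_range.preimage hp'.continuous
  · rintro _ ⟨q, rfl⟩
    refine ContMDiffAt.contMDiffWithinAt ?_
    change ContMDiffAt _ _ _ (invFun j) (j q)
    have h1 : ContMDiffAt 𝓘(ℝ, Q'.model) (𝓘(ℝ, P.model).prod 𝓘(ℝ, Z.model)) ∞
        (fun q' => ((hi (p q)).localInverse (p' q'), z' q')) (j q) := by
      refine ContMDiffAt.prodMk (ContMDiffAt.comp (j q) ?_ hp'.contMDiffAt) hz'.contMDiffAt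
      rw [hj1]
      exact (hi (p q)).localInverse_contMDiffAt
    have h2 : (fun q => (p q, z q)) ∘ invFun j =ᶠ[𝓝 (j q)]
        fun q' => ((hi (p q)).localInverse (p' q'), z' q') := by
      have h3 := (hi (p q)).localInverse_eventuallyEq_right
      rw [← hj1] at h3
      have h4 : range j ∈ 𝓝 (j q) := by
        rw [hrange]
        exact (hi.isOpen_range.preimage hp'.continuous).mem_nhds ⟨p q, (hj1 q).symm⟩
      filter_upwards [hp'.continuous.continuousAt.eventually h3, h4] with q' hq' hr
      have h5 := hright q' hr
      refine Prod.ext (hinj ?_) ?_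
      · exact (hj1 _).symm.trans ((congrArg p' h5).trans hq'.symm)
      · exact (hj2 _).symm.trans (congrArg z' h5)
    have h3 := h1.congr_of_eventuallyEq h2
    rw [ContMDiffAt.iff_comp_isImmersionAt (h.isSmoothEmbedding.isImmersion.isImmersionAt _)]
    exact ⟨h.isSmoothEmbedding.isEmbedding.isInducing.continuousAt_iff.2 h3.continuousAt, h3⟩

end Functoriality

/-! ### Compatibility with the bordism relations -/

section Bordism

variable {B₀ B₁ : FloerSpace.{u}} {F : Correspondence B₀ B₁}

theorem FloerCycle.IsFibreProduct.iso {σ σ' : FloerCycle B₀} {τ τ' : FloerCycle B₁}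
    (h : σ.IsFibreProduct F τ) (h' : σ'.IsFibreProduct F τ') (hi : σ.Iso σ') : τ.Iso τ' := by
  obtain ⟨φ, hφ⟩ := hi
  obtain ⟨p, z, hq, hτ⟩ := h
  obtain ⟨p', z', hq', hτ'⟩ := h'
  obtain ⟨j, hj, hinj, hr, hz⟩ := hq.exists_map hq' φ.isLocalDiffeomorph φ.injective hφ
  have hs : range φ = univ := φ.surjective.range_eq
  rw [hs, preimage_univ] at hr
  obtain ⟨ψ, hψ⟩ := exists_diffeo_of_bijective hj ⟨hinj, range_eq_univ.1 hr⟩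
  exact ⟨ψ, fun x => by rw [hψ, hτ', hτ, hz]⟩

theorem FloerCycle.Iso.refl (σ : FloerCycle B₀) : σ.Iso σ :=
  ⟨Diffeomorph.refl _ _ _, fun _ => rfl⟩

theorem FloerCycle.IsFibreProduct.isDisjointUnion {σ σ' ρ : FloerCycle B₀}
    {τ τ' π : FloerCycle B₁} (h : σ.IsFibreProduct F τ) (h' : σ'.IsFibreProduct F τ')
    (hρ : ρ.IsFibreProduct F π) (hu : σ.IsDisjointUnion σ' ρ) : τ.IsDisjointUnion τ' π := by
  obtain ⟨i, j, hi, hj, hii, hjj, hc, hσ, hσ'⟩ := hu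
  obtain ⟨p, z, hq, hτ⟩ := h
  obtain ⟨p', z', hq', hτ'⟩ := h'
  obtain ⟨r, w, hr, hπ⟩ := hρ
  obtain ⟨a, ha, hai, har, haz⟩ := hq.exists_map hr hi hii hσ
  obtain ⟨b, hb, hbi, hbr, hbz⟩ := hq'.exists_map hr hj hjj hσ'
  refine ⟨a, b, ha, hb, hai, hbi, ?_, fun x => by rw [hπ, hτ, haz], fun x => by rw [hπ, hτ', hbz]⟩
  -- Complementary images in the domain of ρ pull back to complementary images in the fibre product.
  rw [har, hbr, ← hc.compl_eq, preimage_compl]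
  exact isCompl_compl

theorem FloerChain.IsFibreProduct.boundaryIs {W : FloerChain B₀} {T : FloerChain B₁}
    (h : W.IsFibreProduct F T) {σ : FloerCycle B₀} {τ : FloerCycle B₁} (hσ : W.BoundaryIs σ)
    (hτ : σ.IsFibreProduct F τ) : T.BoundaryIs τ := by
  obtain ⟨φ, hφ⟩ := hσ
  obtain ⟨p, z, pInt, pBd, -, -, -, -, -, hq', hT⟩ := h
  obtain ⟨p', z', hq, hτ⟩ := hτ
  obtain ⟨j, hj, hinj, hr, hz⟩ := hq.exists_map hq' φ.isLocalDiffeomorph φ.injective hφ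
  have hs : range φ = univ := φ.surjective.range_eq
  rw [hs, preimage_univ] at hr
  obtain ⟨ψ, hψ⟩ := exists_diffeo_of_bijective hj ⟨hinj, range_eq_univ.1 hr⟩
  refine ⟨ψ, fun x => ?_⟩
  rw [hψ, hτ]
  exact (hT _).trans (by rw [← hz])

theorem Bord.mk_eq_of_iso {B : FloerSpace.{u}} {n : ℤ} {σ τ : CycleOfIndex B n}
    (h : σ.1.Iso τ.1) : Bord.mk σ = Bord.mk τ :=
  (Submodule.Quotient.eq _).2 (Submodule.subset_span (.iso σ τ h))

theorem Bord.hom_ext {B : FloerSpace.{u}} {n : ℤ} {V : Type*} [AddCommGroup V] [Module (ZMod 2) V]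
    {f g : Bord B n →ₗ[ZMod 2] V} (h : ∀ σ, f (Bord.mk σ) = g (Bord.mk σ)) : f = g := by
  refine Submodule.linearMap_qext _ (Finsupp.lhom_ext' fun σ => LinearMap.ext_ring ?_)
  exact h σ

/-- The homomorphism on bordism induced by a correspondence. -/
theorem existsUnique_bordism_hom {k : ℤ} (hF : F.HasIndex k)
    (hb : ∀ (m : ℤ) (W : FloerChain B₀), W.HasIndex m →
      ∃ T : FloerChain B₁, T.HasIndex (m + k) ∧ W.IsFibreProduct F T) :
    ∃! Φ : ∀ n : ℤ, Bord B₀ n →ₗ[ZMod 2] Bord B₁ (n + k),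
      ∀ (n : ℤ) (σ : CycleOfIndex B₀ n) (τ : CycleOfIndex B₁ (n + k)),
        σ.1.IsFibreProduct F τ.1 → Φ n (Bord.mk σ) = Bord.mk τ := by
  -- An arbitrary choice of fibre products; any two for the same cycle are isomorphic, so the class
  -- does not depend on it.
  choose t ht using fun (n : ℤ) (σ : CycleOfIndex B₀ n) =>
    FloerCycle.exists_isFibreProduct F hF σ
  let f : ∀ n : ℤ, (CycleOfIndex B₀ n →₀ ZMod 2) →ₗ[ZMod 2] Bord B₁ (n + k) := fun n =>
    Finsupp.linearCombination (ZMod 2) fun σ => Bord.mk (t n σ)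
  have hf : ∀ n (σ : CycleOfIndex B₀ n), f n (Finsupp.single σ 1) = Bord.mk (t n σ) := fun n σ => by
    simp [f]
  have hle : ∀ n, Submodule.span (ZMod 2) {r | BordRel B₀ n r} ≤ (f n).ker := fun n => by
    refine Submodule.span_le.2 ?_
    rintro _ (⟨σ, τ, h⟩ | ⟨σ, τ, ρ, h⟩ | ⟨σ, W, hW, h⟩)
    · change f n _ = 0
      rw [map_sub, hf, hf, sub_eq_zero]
      exact Bord.mk_eq_of_iso ((ht n σ).iso (ht n τ) h)
    · change f n _ = 0
      rw [map_sub, map_add, hf, hf, hf]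
      exact (Submodule.Quotient.mk_eq_zero _).2 (Submodule.subset_span
        (.disjointUnion _ _ _ ((ht n σ).isDisjointUnion (ht n τ) (ht n ρ) h)))
    · change f n _ = 0
      rw [hf]
      obtain ⟨T, hT, hWT⟩ := hb _ W hW
      refine (Submodule.Quotient.mk_eq_zero _).2 (Submodule.subset_span
        (.boundary _ T ?_ (hWT.boundaryIs h (ht n σ))))
      -- T has index (n + 1) + k, and the relation wants (n + k) + 1.
      rwa [add_right_comm]
  refine ⟨fun n => Submodule.liftQ _ (f n) (hle n), fun n σ τ h => ?_, fun Φ hΦ => ?_⟩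
  · refine (Submodule.liftQ_apply _ _ _).trans ((hf n σ).trans ?_)
    exact Bord.mk_eq_of_iso ((ht n σ).iso h (.refl _))
  · funext n
    refine Bord.hom_ext fun σ => ?_
    rw [hΦ n σ _ (ht n σ)]
    exact ((Submodule.liftQ_apply _ _ _).trans (hf n σ)).symm

end Bordism

/-! ## Solutions of equations with a boundary parameter -/

section Parametric

variable {X Y K : Type*} [NormedAddCommGroup X] [NormedSpace ℝ X] [CompleteSpace X]
  [NormedAddCommGroup Y] [NormedSpace ℝ Y] [NormedAddCommGroup K] [NormedSpace ℝ K]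

/-- A section of an injective local diffeomorphism is smooth. -/
theorem contDiffOn_of_section {T : Type*} [NormedAddCommGroup T] [NormedSpace ℝ T]
    {W : Set X} (hW : IsOpen W) {Φ : X → Y} (hΦ : ContDiffOn ℝ ∞ Φ W) (hinj : InjOn Φ W)
    (hinv : ∀ x ∈ W, ∃ e : X ≃L[ℝ] Y, HasFDerivAt Φ (e : X →L[ℝ] Y) x)
    {U : Set T} {S : T → X} {j : T → Y} (hS : MapsTo S U W) (hj : ContDiffOn ℝ ∞ j U)
    (hSj : ∀ y ∈ U, Φ (S y) = j y) : ContDiffOn ℝ ∞ S U := by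
  intro y hy
  obtain ⟨e, he⟩ := hinv _ (hS hy)
  obtain ⟨Θ, hΘ, h0, hsub, hs⟩ := exists_smooth_localInverse hW hΦ (hS hy) he
  have hy' : j y ∈ Θ.target := by
    rw [← hSj y hy, ← hΘ]; exact Θ.map_source h0
  have h1 : ContDiffWithinAt ℝ ∞ (fun y => Θ.symm (j y)) U y :=
    (hs.contDiffAt (Θ.open_target.mem_nhds hy')).comp_contDiffWithinAt y (hj y hy)
  refine h1.congr_of_eventuallyEq_of_mem ?_ hy
  have h2 := (hj.continuousOn y hy).preimage_mem_nhdsWithin (Θ.open_target.mem_nhds hy')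
  filter_upwards [h2, self_mem_nhdsWithin] with y' h3 h4
  refine hinj (hS h4) (hsub (Θ.map_target h3)) ?_
  rw [hSj _ h4, ← hΘ, Θ.right_inv h3]

/-- The implicit function theorem for an equation `G (x, t) = 0` with a parameter `t ≥ 0` on which
`G` depends smoothly only for `t > 0`. -/
theorem exists_parametric_solution [CompleteSpace Y] {Ω : Set X} (hΩ : IsOpen Ω) {ε : ℝ}
    (hε : 0 < ε)
    {G : X × ℝ → Y} (hG : ContinuousOn G (Ω ×ˢ Ico 0 ε)) (hGs : ContDiffOn ℝ ∞ G (Ω ×ˢ Ioo 0 ε))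
    (hG₀ : ContDiffOn ℝ ∞ (fun x => G (x, 0)) Ω)
    (hGd : ContinuousOn (fun v : X × ℝ => fderiv ℝ (fun x => G (x, v.2)) v.1) (Ω ×ˢ Ico 0 ε))
    {x₀ : X} (hx₀ : x₀ ∈ Ω) (h0 : G (x₀, 0) = 0) (A : X ≃L[ℝ] K × Y)
    (hA : ∀ v, (A v).2 = fderiv ℝ (fun x => G (x, 0)) x₀ v) :
    ∃ δ : ℝ, 0 < δ ∧ δ ≤ ε ∧ ∃ (U : Set K) (V : Set X) (s : K × ℝ → X), IsOpen U ∧ IsOpen V ∧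
      x₀ ∈ V ∧ V ⊆ Ω ∧ (∀ x ∈ V, (A x).1 ∈ U) ∧
      (∀ v ∈ U ×ˢ Ico 0 δ, s v ∈ V ∧ (A (s v)).1 = v.1 ∧ G (s v, v.2) = 0) ∧
      (∀ x ∈ V, ∀ t ∈ Ico 0 δ, G (x, t) = 0 → s ((A x).1, t) = x) ∧
      ContinuousOn s (U ×ˢ Ico 0 δ) ∧ ContDiffOn ℝ ∞ s (U ×ˢ Ioo 0 δ) ∧
      (∀ t ∈ Ico 0 δ, ContDiffOn ℝ ∞ (fun κ => s (κ, t)) U) ∧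
      ContinuousOn (fun v : K × ℝ => fderiv ℝ (fun κ => s (κ, v.2)) v.1) (U ×ˢ Ico 0 δ) := by
  have hGt : ∀ t ∈ Ico 0 ε, ContDiffOn ℝ ∞ (fun x => G (x, t)) Ω := by
    rintro t ⟨ht, ht'⟩
    rcases ht.eq_or_lt with rfl | ht
    · exact hG₀
    · exact hGs.comp (by fun_prop) fun x hx => ⟨hx, ht, ht'⟩
  let L : X →L[ℝ] K := ContinuousLinearMap.fst ℝ K Y ∘L (A : X →L[ℝ] K × Y)
  let Φ : ℝ → X → K × Y := fun t x => (L x, G (x, t))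
  -- The derivative of Φ t in x. No differentiability in t is available at t = 0, so the inverse
  -- function theorem is run for each t separately, with radii that do not depend on t.
  let D : X × ℝ → X →L[ℝ] K × Y := fun v => L.prod (fderiv ℝ (fun x => G (x, v.2)) v.1)
  have hΦ : ∀ t ∈ Ico 0 ε, ContDiffOn ℝ ∞ (Φ t) Ω := fun t ht =>
    L.contDiff.contDiffOn.prodMk (hGt t ht)
  have hΦd : ∀ x ∈ Ω, ∀ t ∈ Ico 0 ε, HasFDerivAt (Φ t) (D (x, t)) x := fun x hx t ht =>
    L.hasFDerivAt.prodMk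
      (((hGt t ht).contDiffAt (hΩ.mem_nhds hx)).differentiableAt (by simp)).hasFDerivAt
  have hD : ContinuousOn D (Ω ×ˢ Ico 0 ε) :=
    (ContinuousLinearMap.prodₗᵢ (𝕜 := ℝ) (E := X) (F := K) (G := Y) ℝ).continuous.comp_continuousOn
      (continuousOn_const.prodMk hGd)
  have hD₀ : D (x₀, 0) = A := ContinuousLinearMap.ext fun v => Prod.ext rfl (hA v).symm
  let N : NNReal := ‖(A.symm : K × Y →L[ℝ] X)‖₊ + 1
  have hN : 0 < N := by positivity
  -- With N ≥ ‖A⁻¹‖ and N c = 1/2, a map that is c-close to A is injective with Lipschitz inverse of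
  -- constant 2N, and N⁻¹ - c = c.
  let c : NNReal := N⁻¹ / 2
  have hc : 0 < c := by positivity
  have hNc : (N : ℝ) * c = 1 / 2 := by
    have : (N : ℝ) ≠ 0 := by exact_mod_cast hN.ne'
    simp only [c]; push_cast; field_simp
  have hS₀ : ((x₀, 0) : X × ℝ) ∈ Ω ×ˢ Ico 0 ε := ⟨hx₀, le_rfl, hε⟩
  obtain ⟨ρ, hρ, hρΩ, hρD⟩ : ∃ ρ > 0, Metric.ball x₀ ρ ⊆ Ω ∧ ∀ x ∈ Metric.ball x₀ ρ,
      ∀ t ∈ Ico 0 (min ρ ε), ‖D (x, t) - A‖ ≤ c ∧ ∃ e : X ≃L[ℝ] K × Y, D (x, t) = e := by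
    have h1 : Metric.ball (A : X →L[ℝ] K × Y) c ∩ range ((↑) : (X ≃L[ℝ] K × Y) → X →L[ℝ] K × Y) ∈
        𝓝 (D (x₀, 0)) := by
      rw [hD₀]
      exact inter_mem (Metric.ball_mem_nhds _ (by exact_mod_cast hc)) A.nhds
    obtain ⟨r, hr, h2⟩ := Metric.mem_nhdsWithin_iff.1 ((hD _ hS₀).preimage_mem_nhdsWithin h1)
    obtain ⟨r', hr', h3⟩ := Metric.isOpen_iff.1 hΩ x₀ hx₀
    refine ⟨min r r', lt_min hr hr', fun x hx => h3 (Metric.ball_subset_ball (min_le_right _ _) hx),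
      fun x hx t ht => ?_⟩
    have ht1 : t < r := ht.2.trans_le ((min_le_left _ _).trans (min_le_left _ _))
    have h4 : (x, t) ∈ D ⁻¹' (Metric.ball (A : X →L[ℝ] K × Y) c ∩
        range ((↑) : (X ≃L[ℝ] K × Y) → X →L[ℝ] K × Y)) := by
      refine h2 ⟨?_, h3 (Metric.ball_subset_ball (min_le_right _ _) hx), ht.1,
        ht.2.trans_le (min_le_right _ _)⟩
      rw [Metric.mem_ball, Prod.dist_eq, max_lt_iff]
      refine ⟨Metric.ball_subset_ball (min_le_left _ _) hx, ?_⟩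
      simpa [abs_of_nonneg ht.1] using ht1
    obtain ⟨h5, e, he⟩ := h4
    exact ⟨(mem_ball_iff_norm.1 h5).le, e, he.symm⟩
  set W := Metric.ball x₀ ρ with hW
  -- The image under Φ t of the closed ball of radius ρ/2 about x₀ contains the closed ball of
  -- radius (N⁻¹ - c) ρ/2 = η about Φ t x₀.
  set η : ℝ := c * (ρ / 2) with hη
  have hη0 : 0 < η := by positivity
  have happ : ∀ t ∈ Ico 0 (min ρ ε), ApproximatesLinearOn (Φ t) (A : X →L[ℝ] K × Y) W c :=
    fun t ht x hx y hy =>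
      (convex_ball x₀ ρ).norm_image_sub_le_of_norm_hasFDerivWithin_le' (f := Φ t)
        (f' := fun x => D (x, t)) (fun x hx => (hΦd x (hρΩ hx) t
          ⟨ht.1, ht.2.trans_le (min_le_right _ _)⟩).hasFDerivWithinAt)
        (fun x hx => (hρD x hx t ht).1) hy hx
  -- For t < δ the centre Φ t x₀ is within η of (L x₀, 0), so (κ, 0) is attained for every κ in the
  -- η-ball U.
  obtain ⟨δ, hδ, hδρ, hδε, hδG⟩ : ∃ δ > 0, δ ≤ ρ ∧ δ ≤ ε ∧ ∀ t ∈ Ico 0 δ, ‖G (x₀, t)‖ ≤ η := by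
    have h1 : ContinuousOn (fun t => G (x₀, t)) (Ico 0 ε) :=
      hG.comp (by fun_prop) fun t ht => ⟨hx₀, ht⟩
    have h2 := (h1 0 ⟨le_rfl, hε⟩).preimage_mem_nhdsWithin
      (show Metric.ball 0 η ∈ 𝓝 (G (x₀, 0)) by rw [h0]; exact Metric.ball_mem_nhds _ hη0)
    obtain ⟨r, hr, h3⟩ := Metric.mem_nhdsWithin_iff.1 h2
    refine ⟨min r (min ρ ε), lt_min hr (lt_min hρ hε), (min_le_right _ _).trans (min_le_left _ _),
      (min_le_right _ _).trans (min_le_right _ _), fun t ht => ?_⟩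
    have h4 : t ∈ (fun t => G (x₀, t)) ⁻¹' Metric.ball 0 η := by
      refine h3 ⟨?_, ht.1, ht.2.trans_le ((min_le_right _ _).trans (min_le_right _ _))⟩
      simpa [abs_of_nonneg ht.1] using ht.2.trans_le (min_le_left _ _)
    exact (mem_ball_zero_iff.1 h4).le
  have hδ' : ∀ t ∈ Ico 0 δ, t ∈ Ico 0 (min ρ ε) := fun t ht =>
    ⟨ht.1, ht.2.trans_le (le_min hδρ hδε)⟩
  have hδ'' : ∀ t ∈ Ico 0 δ, t ∈ Ico 0 ε := fun t ht => ⟨ht.1, ht.2.trans_le hδε⟩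
  have hlip : ∀ t ∈ Ico 0 δ, ∀ x ∈ W, ∀ y ∈ W, ‖x - y‖ ≤ 2 * N * ‖Φ t x - Φ t y‖ := by
    intro t ht x hx y hy
    have h1 := happ t (hδ' t ht) x hx y hy
    have h2 : ‖x - y‖ ≤ N * ‖A (x - y)‖ := by
      calc ‖x - y‖ = ‖A.symm (A (x - y))‖ := by simp
        _ ≤ ‖(A.symm : K × Y →L[ℝ] X)‖ * ‖A (x - y)‖ :=
          (A.symm : K × Y →L[ℝ] X).le_opNorm _
        _ ≤ N * ‖A (x - y)‖ := by gcongr; simp [N]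
    have h3 : ‖A (x - y)‖ ≤ ‖Φ t x - Φ t y‖ + c * ‖x - y‖ := by
      have : A (x - y) = (Φ t x - Φ t y) - (Φ t x - Φ t y - A (x - y)) := by abel
      rw [this]
      exact (norm_sub_le _ _).trans (by gcongr; exact h1)
    have h4 : (N : ℝ) * ‖A (x - y)‖ ≤ N * (‖Φ t x - Φ t y‖ + c * ‖x - y‖) := by gcongr
    have h5 : (N : ℝ) * (c * ‖x - y‖) = 1 / 2 * ‖x - y‖ := by rw [← mul_assoc, hNc]
    linarith
  have hinj : ∀ t ∈ Ico 0 δ, InjOn (Φ t) W := fun t ht x hx y hy hxy => by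
    have := hlip t ht x hx y hy
    rw [hxy, sub_self, norm_zero, mul_zero] at this
    exact sub_eq_zero.1 (norm_le_zero_iff.1 this)
  have hx₀W : x₀ ∈ W := Metric.mem_ball_self hρ
  let U : Set K := Metric.ball (L x₀) η
  have hex : ∀ v : K × ℝ, ∃ x, v ∈ U ×ˢ Ico 0 δ → x ∈ W ∧ Φ v.2 x = (v.1, 0) := by
    rintro ⟨κ, t⟩
    by_cases hv : (κ, t) ∈ U ×ˢ Ico 0 δ
    · obtain ⟨hκ, ht⟩ := hv
      let R : (A : X →L[ℝ] K × Y).NonlinearRightInverse :=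
        { toFun := A.symm
          nnnorm := N
          bound' := fun y => by
            refine ((A.symm : K × Y →L[ℝ] X).le_opNorm y).trans ?_
            gcongr; simp [N]
          right_inv' := A.apply_symm_apply }
      have h1 := (happ t (hδ' t ht)).surjOn_closedBall_of_nonlinearRightInverse R
        (ε := ρ / 2) (b := x₀) (by positivity) (Metric.closedBall_subset_ball (by linarith))
      have h2 : ((R.nnnorm : ℝ)⁻¹ - c) * (ρ / 2) = η := by
        have : ((N : ℝ)⁻¹ - c) = c := by simp only [c]; push_cast; ring
        change ((N : ℝ)⁻¹ - c) * (ρ / 2) = η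
        rw [this]
      rw [h2] at h1
      obtain ⟨x, hx, hx'⟩ := h1 (show ((κ, 0) : K × Y) ∈ Metric.closedBall (Φ t x₀) η by
        rw [mem_closedBall_iff_norm, Prod.norm_def]
        refine max_le (mem_ball_iff_norm.1 hκ).le ?_
        simpa [Φ] using hδG t ht)
      exact ⟨x, fun _ => ⟨Metric.closedBall_subset_ball (by linarith) hx, hx'⟩⟩
    · exact ⟨0, fun h => (hv h).elim⟩
  choose s hs using hex
  have hsW : MapsTo s (U ×ˢ Ico 0 δ) W := fun v hv => (hs v hv).1
  have hsΦ : ∀ v ∈ U ×ˢ Ico 0 δ, Φ v.2 (s v) = (v.1, 0) := fun v hv => (hs v hv).2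
  have hinv : ∀ t ∈ Ico 0 δ, ∀ x ∈ W, ∃ e : X ≃L[ℝ] K × Y,
      HasFDerivAt (Φ t) (e : X →L[ℝ] K × Y) x := fun t ht x hx => by
    obtain ⟨e, he⟩ := (hρD x hx t (hδ' t ht)).2
    exact ⟨e, he ▸ hΦd x (hρΩ hx) t (hδ'' t ht)⟩
  -- By the uniform Lipschitz bound, the distance from s(v) to s(κ, t) is controlled by Φ at the
  -- fixed point s(κ, t), which depends continuously on the parameter.
  have hsc : ContinuousOn s (U ×ˢ Ico 0 δ) := by
    rintro ⟨κ, t⟩ hv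
    have h1 : Tendsto (fun v : K × ℝ => 2 * N * ‖(v.1, (0 : Y)) - Φ v.2 (s (κ, t))‖)
        (𝓝[U ×ˢ Ico 0 δ] (κ, t)) (𝓝 0) := by
      have h2 : ContinuousOn (fun v : K × ℝ => 2 * N * ‖(v.1, (0 : Y)) - Φ v.2 (s (κ, t))‖)
          (U ×ˢ Ico 0 δ) := by
        have h3 : ContinuousOn (fun v : K × ℝ => G (s (κ, t), v.2)) (U ×ˢ Ico 0 δ) :=
          hG.comp (by fun_prop) fun v hv' => ⟨hρΩ (hsW hv), hδ'' _ hv'.2⟩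
        have h4 : ContinuousOn (fun v : K × ℝ => Φ v.2 (s (κ, t))) (U ×ˢ Ico 0 δ) :=
          continuousOn_const.prodMk h3
        have h5 : ContinuousOn (fun v : K × ℝ => (v.1, (0 : Y))) (U ×ˢ Ico 0 δ) := by fun_prop
        exact continuousOn_const.mul (h5.sub h4).norm
      have h3 := h2 (κ, t) hv
      unfold ContinuousWithinAt at h3
      have h4 := hsΦ _ hv
      simp only at h4
      simpa only [h4, sub_self, norm_zero, mul_zero] using h3
    refine tendsto_iff_norm_sub_tendsto_zero.2 (squeeze_zero' (.of_forall fun _ => norm_nonneg _)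
      ?_ h1)
    filter_upwards [self_mem_nhdsWithin] with v hv'
    rw [← hsΦ v hv']
    exact hlip v.2 hv'.2 _ (hsW hv') _ (hsW hv)
  have hst : ∀ t ∈ Ico 0 δ, ContDiffOn ℝ ∞ (fun κ => s (κ, t)) U := fun t ht =>
    contDiffOn_of_section Metric.isOpen_ball ((hΦ t (hδ'' t ht)).mono hρΩ) (hinj t ht) (hinv t ht)
      (j := fun κ => (κ, 0)) (fun κ hκ => hsW ⟨hκ, ht⟩) (by fun_prop) fun κ hκ => hsΦ _ ⟨hκ, ht⟩
  refine ⟨δ, hδ, hδε, U, W ∩ L ⁻¹' U, s, Metric.isOpen_ball,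
    Metric.isOpen_ball.inter (Metric.isOpen_ball.preimage L.continuous),
    ⟨hx₀W, Metric.mem_ball_self hη0⟩, fun x hx => hρΩ hx.1, fun x hx => hx.2, fun v hv => ?_,
    fun x hx t ht hxt => ?_, hsc, ?_, hst, ?_⟩
  · have h1 : L (s v) = v.1 := congrArg Prod.fst (hsΦ v hv)
    refine ⟨⟨hsW hv, ?_⟩, h1, congrArg Prod.snd (hsΦ v hv)⟩
    rw [mem_preimage, h1]; exact hv.1
  · have hv : ((A x).1, t) ∈ U ×ˢ Ico 0 δ := ⟨hx.2, ht⟩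
    refine hinj t ht (hsW hv) hx.1 ((hsΦ _ hv).trans ?_)
    exact Prod.ext rfl hxt.symm
  · have hsub : Ioo 0 δ ⊆ Ico 0 δ := Ioo_subset_Ico_self
    -- For t > 0 joint smoothness follows by adjoining t as a coordinate: (x, t) ↦ (Φ t x, t) has a
    -- block triangular derivative, inverted explicitly by `T'` below.
    have h1 : ContDiffOn ℝ ∞ (fun v : K × ℝ => (s v, v.2)) (U ×ˢ Ioo 0 δ) := by
      refine contDiffOn_of_section (W := W ×ˢ Ioo 0 δ) (Φ := fun v : X × ℝ => (Φ v.2 v.1, v.2))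
        (j := fun v => ((v.1, (0 : Y)), v.2)) (Metric.isOpen_ball.prod isOpen_Ioo) ?_ ?_ ?_
        (fun v hv => ⟨hsW ⟨hv.1, hsub hv.2⟩, hv.2⟩) (by fun_prop)
        fun v hv => Prod.ext (hsΦ v ⟨hv.1, hsub hv.2⟩) rfl
      · refine ContDiffOn.prodMk (ContDiffOn.prodMk (by fun_prop) ?_) (by fun_prop)
        exact hGs.mono fun v hv => ⟨hρΩ hv.1, hv.2.1, hv.2.2.trans_le hδε⟩
      · rintro ⟨x, t⟩ hx ⟨y, t'⟩ hy hxy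
        obtain ⟨h2, rfl⟩ := Prod.ext_iff.1 hxy
        exact Prod.ext (hinj t (hsub hx.2) hx.1 hy.1 h2) rfl
      · rintro ⟨x, t⟩ ⟨hx, ht⟩
        obtain ⟨e, he⟩ := hinv t (hsub ht) x hx
        have hGd : HasFDerivAt G (fderiv ℝ G (x, t)) (x, t) :=
          ((hGs.contDiffAt ((hΩ.prod isOpen_Ioo).mem_nhds
            ⟨hρΩ hx, ht.1, ht.2.trans_le hδε⟩)).differentiableAt (by simp)).hasFDerivAt
        let b : K × Y := (0, fderiv ℝ G (x, t) (0, 1))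
        have he' : ∀ v, e v = (L v, fderiv ℝ G (x, t) (v, 0)) := by
          have h3 : HasFDerivAt (Φ t)
              (L.prod (fderiv ℝ G (x, t) ∘L ContinuousLinearMap.inl ℝ X ℝ)) x :=
            L.hasFDerivAt.prodMk (hGd.comp x (hasFDerivAt_prodMk_left x t))
          intro v
          exact DFunLike.congr_fun (he.unique h3) v
        have hsplit : ∀ (v : X) (τ : ℝ), (L v, fderiv ℝ G (x, t) (v, τ)) = e v + τ • b := by
          intro v τ
          have h4 : ((v, τ) : X × ℝ) = (v, 0) + τ • ((0, 1) : X × ℝ) := by simp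
          rw [he', h4, map_add, map_smul]
          simp [b]
        let T : (X × ℝ) →L[ℝ] (K × Y) × ℝ :=
          ((L ∘L ContinuousLinearMap.fst ℝ X ℝ).prod (fderiv ℝ G (x, t))).prod
            (ContinuousLinearMap.snd ℝ X ℝ)
        let T' : ((K × Y) × ℝ) →L[ℝ] X × ℝ :=
          ((e.symm : K × Y →L[ℝ] X) ∘L (ContinuousLinearMap.fst ℝ (K × Y) ℝ -
            (ContinuousLinearMap.snd ℝ (K × Y) ℝ).smulRight b)).prod
            (ContinuousLinearMap.snd ℝ (K × Y) ℝ)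
        refine ⟨ContinuousLinearEquiv.equivOfInverse T T' ?_ ?_, ?_⟩
        · rintro ⟨v, τ⟩
          refine Prod.ext ?_ rfl
          change e.symm ((L v, fderiv ℝ G (x, t) (v, τ)) - τ • b) = v
          rw [hsplit, add_sub_cancel_right, e.symm_apply_apply]
        · rintro ⟨w, τ⟩
          refine Prod.ext ?_ rfl
          change (L (e.symm (w - τ • b)), fderiv ℝ G (x, t) (e.symm (w - τ • b), τ)) = w
          rw [hsplit, e.apply_symm_apply, sub_add_cancel]
        · exact ((L.hasFDerivAt.comp (x, t) hasFDerivAt_fst).prodMk hGd).prodMk hasFDerivAt_snd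
    exact contDiff_fst.comp_contDiffOn h1
  -- Differentiating Φ t (s (κ, t)) = (κ, 0) in κ expresses the derivative of s through the inverse
  -- of D, which is continuous up to t = 0.
  · have h1 : ∀ v ∈ U ×ˢ Ico 0 δ, fderiv ℝ (fun κ => s (κ, v.2)) v.1 =
        ContinuousLinearMap.inverse (D (s v, v.2)) ∘L ContinuousLinearMap.inl ℝ K Y := by
      rintro ⟨κ, t⟩ hv
      obtain ⟨e, he⟩ := (hρD _ (hsW hv) t (hδ' t hv.2)).2
      have h2 : HasFDerivAt (fun κ => s (κ, t)) (fderiv ℝ (fun κ => s (κ, t)) κ) κ :=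
        (((hst t hv.2).contDiffAt (Metric.isOpen_ball.mem_nhds hv.1)).differentiableAt
          (by simp)).hasFDerivAt
      have h3 := (hΦd _ (hρΩ (hsW hv)) t (hδ'' t hv.2)).comp κ h2
      have h4 : HasFDerivAt (Φ t ∘ fun κ => s (κ, t)) (ContinuousLinearMap.inl ℝ K Y) κ := by
        refine (ContinuousLinearMap.inl ℝ K Y).hasFDerivAt.congr_of_eventuallyEq ?_
        filter_upwards [Metric.isOpen_ball.mem_nhds hv.1] with κ' hκ'
        exact hsΦ (κ', t) ⟨hκ', hv.2⟩
      have h5 := h3.unique h4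
      simp only
      rw [← h5, he, ContinuousLinearMap.inverse_equiv]
      ext w
      simp
    refine ContinuousOn.congr ?_ h1
    refine ContinuousOn.clm_comp ?_ continuousOn_const
    intro v hv
    obtain ⟨e, he⟩ := (hρD _ (hsW hv) v.2 (hδ' _ hv.2)).2
    have h2 : ContinuousAt ContinuousLinearMap.inverse (D (s v, v.2)) := by
      rw [he]
      exact (contDiffAt_map_inverse (n := 0) e).continuousAt
    exact ContinuousAt.comp_continuousWithinAt (f := fun v => D (s v, v.2)) h2 (hD.comp (hsc.prodMk continuousOn_snd)
      (fun v hv => ⟨hρΩ (hsW hv), hδ'' _ hv.2⟩) v hv)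

end Parametric

/-! ## The fibre product near the boundary of an lc-manifold -/

section Embedding

variable {X Y : Type*} [TopologicalSpace X] [TopologicalSpace Y] {f : X → Y} {S : Set X}

theorem exists_inverse_of_isOpenEmbedding (h : IsOpenEmbedding (S.domRestrict f))
    (hS : S.Nonempty) : ∃ g : Y → X, (∀ x ∈ S, g (f x) = x) ∧ ContinuousOn g (f '' S) := by
  obtain ⟨x₀, hx₀⟩ := hS
  have : Nonempty S := ⟨⟨x₀, hx₀⟩⟩
  let f' : S → Y := S.domRestrict f
  have hl : ∀ x : S, invFun f' (f' x) = x := leftInverse_invFun h.injective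
  refine ⟨fun y => (invFun f' y : S), fun x hx => congrArg Subtype.val (hl ⟨x, hx⟩), ?_⟩
  rintro _ ⟨x, hx, rfl⟩
  refine ContinuousAt.continuousWithinAt ?_
  have h1 : ContinuousAt (fun y => ((invFun f' y : S) : X)) (f' ⟨x, hx⟩) := by
    rw [← h.continuousAt_iff]
    refine continuous_subtype_val.continuousAt.congr (.of_forall fun y => ?_)
    exact congrArg Subtype.val (hl y).symm
  exact h1

theorem isOpenEmbedding_domRestrict {g : Y → X} (hf : ContinuousOn f S)
    (hg : ContinuousOn g (f '' S)) (hgf : ∀ x ∈ S, g (f x) = x) (ho : IsOpen (f '' S)) :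
    IsOpenEmbedding (S.domRestrict f) := by
  let e : PartialHomeomorph X Y :=
    { toFun := f
      invFun := g
      source := S
      target := f '' S
      map_source' := fun x hx => mem_image_of_mem f hx
      map_target' := by
        rintro _ ⟨x, hx, rfl⟩
        rwa [hgf x hx]
      left_inv' := hgf
      right_inv' := by
        rintro _ ⟨x, hx, rfl⟩
        rw [hgf x hx]
      continuousOn_toFun := hf
      continuousOn_invFun := hg }
  exact ⟨e.isEmbedding_restrict, by rwa [Set.range_domRestrict]⟩

end Embedding

/-! ### Solving the fibre product equation in an lc-chart -/

section Collar

variable {P : LCManifold.{u}} {B Z : HilbertManifold.{u}} {σ : P → B} {g : Z → B}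

theorem LCChart.continuousOn {bd : Set P} {E₀ E₁ : Type u}
    [NormedAddCommGroup E₀] [InnerProductSpace ℝ E₀]
    [NormedAddCommGroup E₁] [InnerProductSpace ℝ E₁]
    [ChartedSpace E₀ ↥(bdᶜ)] [ChartedSpace E₁ ↥bd] (c : LCChart bd E₀ E₁) :
    ContinuousOn c.toFun (c.base ×ˢ Ico 0 c.ε) :=
  continuousOn_iff_continuous_domRestrict.2 c.isOpenEmbedding.continuous

/-- Local solution of `σ (c (u, t)) = g y` near a point with `t = 0`. -/
theorem LCSmooth.exists_solution (hσ : LCSmooth P B σ) (hg : Smooth Z B g) {p₀ : P.bd} {z₀ : Z}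
    (h0 : σ p₀ = g z₀) (hs : Surjective (differenceD (P.onBd σ) g (p₀, z₀)))
    {K : Type u} [NormedAddCommGroup K] [NormedSpace ℝ K] [CompleteSpace K]
    (e : (differenceD (P.onBd σ) g (p₀, z₀)).ker ≃L[ℝ] K)
    {O : Set Z} (hO : IsOpen O) (hz₀ : z₀ ∈ O) :
    ∃ c : LCChart P.boundary P.intModel P.bdModel, c.base ⊆ (chartAt P.bdModel p₀).source ∧
    ∃ δ : ℝ, 0 < δ ∧ δ ≤ c.ε ∧ ∃ (U : Set K) (V : Set (P.bdModel × Z.model))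
      (L : P.bdModel × Z.model →L[ℝ] K) (s : K × ℝ → P.bdModel × Z.model), IsOpen U ∧ IsOpen V ∧
      (chartAt P.bdModel p₀ p₀, chartAt Z.model z₀ z₀) ∈ V ∧
      V ⊆ (chartAt P.bdModel p₀ '' c.base) ×ˢ
        ((chartAt Z.model z₀).target ∩ (chartAt Z.model z₀).symm ⁻¹' O) ∧
      (∀ x ∈ V, L x ∈ U) ∧
      (∀ v ∈ U ×ˢ Ico 0 δ, s v ∈ V ∧ L (s v) = v.1 ∧
        σ (c.toFun ((chartAt P.bdModel p₀).symm (s v).1, v.2)) =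
          g ((chartAt Z.model z₀).symm (s v).2)) ∧
      (∀ x ∈ V, ∀ t ∈ Ico 0 δ, σ (c.toFun ((chartAt P.bdModel p₀).symm x.1, t)) =
          g ((chartAt Z.model z₀).symm x.2) → s (L x, t) = x) ∧
      ContinuousOn s (U ×ˢ Ico 0 δ) ∧ ContDiffOn ℝ ∞ s (U ×ˢ Ioo 0 δ) ∧
      (∀ t ∈ Ico 0 δ, ContDiffOn ℝ ∞ (fun κ => s (κ, t)) U) ∧
      ContinuousOn (fun v : K × ℝ => fderiv ℝ (fun κ => s (κ, v.2)) v.1) (U ×ˢ Ico 0 δ) := by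
  obtain ⟨c, hp₀, hcφ, hcχ, hcd⟩ := hσ.continuous_deriv p₀
  refine ⟨c, hcφ, ?_⟩
  set φ := chartAt P.bdModel p₀
  set ψ := chartAt Z.model z₀
  set χ := chartAt B.model (σ p₀) with hχ
  have hφb : IsOpen (φ '' c.base) := φ.isOpen_image_of_subset_source c.isOpen_base hcφ
  have hφs : ∀ x ∈ φ '' c.base, φ.symm x ∈ c.base := by
    rintro _ ⟨v, hv, rfl⟩
    rwa [φ.left_inv (hcφ hv)]
  have hφt : φ '' c.base ⊆ φ.target := by
    rintro _ ⟨v, hv, rfl⟩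
    exact φ.map_source (hcφ hv)
  let V₀ : Set Z.model := ψ.target ∩ ψ.symm ⁻¹' (g ⁻¹' χ.source)
  have hV₀ : IsOpen V₀ := isOpen_chart_domain (ContMDiff.continuous hg) z₀ (σ p₀)
  let V₁ : Set Z.model := ψ.target ∩ ψ.symm ⁻¹' O
  have hV₁ : IsOpen V₁ := ψ.isOpen_inter_preimage_symm hO
  let Ω : Set (P.bdModel × Z.model) := (φ '' c.base) ×ˢ (V₀ ∩ V₁)
  have hΩ : IsOpen Ω := hφb.prod (hV₀.inter hV₁)
  let S : P.bdModel × ℝ → B.model := fun v => χ (σ (c.toFun (φ.symm v.1, v.2)))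
  let R : Z.model → B.model := fun y => χ (g (ψ.symm y))
  have hR : ContDiffOn ℝ ∞ R V₀ := hg.contDiffOn_charts z₀ (σ p₀)
  have hSc : ContinuousOn S ((φ '' c.base) ×ˢ Ico 0 c.ε) := by
    refine χ.continuousOn.comp (hσ.continuous.comp_continuousOn (c.continuousOn.comp
      ((φ.continuousOn_symm.comp continuousOn_fst fun v hv => hφt hv.1).prodMk continuousOn_snd)
      ?_)) ?_
    · exact fun v hv => ⟨hφs _ hv.1, hv.2⟩
    · exact fun v hv => hcχ (φ.symm v.1, v.2) ⟨hφs _ hv.1, hv.2⟩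
  have hSs : ContDiffOn ℝ ∞ S ((φ '' c.base) ×ˢ Ioo 0 c.ε) := by
    have hsrc : ∀ v ∈ (φ '' c.base) ×ˢ Ioo 0 c.ε, (φ.symm v.1, v.2) ∈ c.diffeo.source := by
      intro v hv
      rw [c.source_eq]
      exact ⟨hφs _ hv.1, hv.2⟩
    have h1 : ContMDiffOn 𝓘(ℝ, P.bdModel × ℝ) (𝓘(ℝ, P.bdModel).prod 𝓘(ℝ, ℝ)) ∞
        (fun v : P.bdModel × ℝ => (φ.symm v.1, v.2)) ((φ '' c.base) ×ˢ Ioo 0 c.ε) :=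
      ((contMDiffOn_chart_symm (x := p₀)).comp contDiff_fst.contMDiff.contMDiffOn
        fun v hv => hφt hv.1).prodMk contDiff_snd.contMDiff.contMDiffOn
    have h2 := (ContMDiff.comp_contMDiffOn hσ.smooth_int c.smooth_diffeo).comp h1 hsrc
    have h3 := (contMDiffOn_chart (I := 𝓘(ℝ, B.model)) (n := ∞) (x := σ p₀)).comp h2 fun v hv => by
      change σ (c.diffeo (φ.symm v.1, v.2)) ∈ χ.source
      rw [c.diffeo_eq _ (hsrc v hv)]
      exact hcχ _ ⟨hφs _ hv.1, Ioo_subset_Ico_self hv.2⟩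
    rw [← contMDiffOn_iff_contDiffOn]
    refine h3.congr fun v hv => ?_
    change χ (σ (c.toFun (φ.symm v.1, v.2))) = χ (σ (c.diffeo (φ.symm v.1, v.2)))
    rw [c.diffeo_eq _ (hsrc v hv)]
  have hS₀ : ∀ x ∈ φ '' c.base, S (x, 0) = χ (P.onBd σ (φ.symm x)) := fun x hx => by
    simp only [S, c.map_zero _ (hφs x hx)]
  have hS₀s : ContDiffOn ℝ ∞ (fun x => S (x, 0)) (φ '' c.base) := by
    refine ((hσ.smooth_bd.contDiffOn_charts p₀ (σ p₀)).mono fun x hx => ⟨hφt hx, ?_⟩).congr hS₀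
    have := hcχ (φ.symm x, 0) ⟨hφs x hx, le_rfl, c.ε_pos⟩
    rwa [c.map_zero _ (hφs x hx)] at this
  have hSt : ∀ x ∈ φ '' c.base, ∀ t ∈ Ico 0 c.ε, DifferentiableAt ℝ (fun x => S (x, t)) x := by
    rintro x hx t ⟨ht, ht'⟩
    rcases ht.eq_or_lt with rfl | ht
    · exact (hS₀s.contDiffAt (hφb.mem_nhds hx)).differentiableAt (by simp)
    · have h1 : ContDiffOn ℝ ∞ (fun x => S (x, t)) (φ '' c.base) :=
        hSs.comp (by fun_prop) fun x hx => ⟨hx, ht, ht'⟩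
      exact (h1.contDiffAt (hφb.mem_nhds hx)).differentiableAt (by simp)
  -- The Z-part R is independent of t, so the only regularity needed at t = 0 is the continuity of
  -- the tangential derivative of σ supplied by lc-smoothness.
  let G : (P.bdModel × Z.model) × ℝ → B.model := fun v => S (v.1.1, v.2) - R v.1.2
  have hGf : ∀ v ∈ Ω ×ˢ Ico 0 c.ε, fderiv ℝ (fun x => G (x, v.2)) v.1 =
      fderiv ℝ (fun x => S (x, v.2)) v.1.1 ∘L ContinuousLinearMap.fst ℝ _ _ -
        fderiv ℝ R v.1.2 ∘L ContinuousLinearMap.snd ℝ _ _ := by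
    rintro ⟨⟨x, y⟩, t⟩ ⟨⟨hx, hy⟩, ht⟩
    have h1 := (hSt x hx t ht).hasFDerivAt.comp (x, y) (hasFDerivAt_fst (𝕜 := ℝ) (p := (x, y)))
    have h2 := ((hR.contDiffAt (hV₀.mem_nhds hy.1)).differentiableAt
      (by simp)).hasFDerivAt.comp (x, y) (hasFDerivAt_snd (𝕜 := ℝ) (p := (x, y)))
    exact (h1.sub h2).fderiv
  have hx₀ : (φ p₀, ψ z₀) ∈ Ω := by
    have h1 : ψ.symm (ψ z₀) = z₀ := ψ.left_inv (mem_chart_source _ _)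
    refine ⟨⟨p₀, hp₀, rfl⟩, ⟨mem_chart_target _ _, ?_⟩, mem_chart_target _ _, ?_⟩
    · rw [mem_preimage, mem_preimage, h1, ← h0]; exact mem_chart_source _ _
    · rwa [mem_preimage, h1]
  obtain ⟨A, hA⟩ := exists_splitting _ hs e
  have hχG : ∀ x ∈ Ω, ∀ t ∈ Ico 0 c.ε, G (x, t) = 0 ↔
      σ (c.toFun (φ.symm x.1, t)) = g (ψ.symm x.2) := by
    intro x hx t ht
    simp only [G, S, R, sub_eq_zero]
    exact ⟨fun h => χ.injOn (hcχ _ ⟨hφs _ hx.1, ht⟩) hx.2.1.2 h, fun h => by rw [h]⟩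
  obtain ⟨δ, hδ, hδε, U, V, s, hU, hV, hV₀, hVΩ, hAU, hsV, hsu, hs1, hs2, hs3, hs4⟩ :=
    exists_parametric_solution hΩ c.ε_pos (G := G)
      ((hSc.comp (by fun_prop) fun v hv => ⟨hv.1.1, hv.2⟩).sub
        (hR.continuousOn.comp (by fun_prop) fun v hv => hv.1.2.1))
      ((hSs.comp (by fun_prop) fun v hv => ⟨hv.1.1, hv.2⟩).sub
        (hR.comp (by fun_prop) fun v hv => hv.1.2.1))
      ((hS₀s.comp contDiff_fst.contDiffOn fun v hv => hv.1).sub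
        (hR.comp contDiff_snd.contDiffOn fun v hv => hv.2.1))
      (by
        refine ContinuousOn.congr (ContinuousOn.sub (ContinuousOn.clm_comp ?_ continuousOn_const)
          (ContinuousOn.clm_comp ?_ continuousOn_const)) hGf
        · exact hcd.comp (f := fun v : (P.bdModel × Z.model) × ℝ => (v.1.1, v.2))
            (by fun_prop) fun v hv => ⟨hv.1.1, hv.2⟩
        · exact (hR.continuousOn_fderiv_of_isOpen ‹_› (by simp)).comp
            (f := fun v : (P.bdModel × Z.model) × ℝ => v.1.2) (by fun_prop) fun v hv => hv.1.2.1)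
      hx₀ ((hχG _ hx₀ 0 ⟨le_rfl, c.ε_pos⟩).2 (by
        simp only
        rw [c.map_zero _ (hφs _ hx₀.1), φ.left_inv (mem_chart_source _ _),
          ψ.left_inv (mem_chart_source _ _), h0])) A (by
        intro v
        rw [hA, hGf (_, 0) ⟨hx₀, le_rfl, c.ε_pos⟩]
        have h1 : fderiv ℝ (fun x => S (x, 0)) (φ p₀) =
            differential P.bd B (P.onBd σ) p₀ := by
          rw [hσ.smooth_bd.differential_eq]
          refine Filter.EventuallyEq.fderiv_eq ?_
          filter_upwards [hφb.mem_nhds hx₀.1] with x hx using hS₀ x hx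
        have h2 : fderiv ℝ R (ψ z₀) = differential Z B g z₀ := by
          rw [hg.differential_eq, ← h0]
        simp only [h1, h2]
        simp [differenceD, sub_eq_add_neg])
  refine ⟨δ, hδ, hδε, U, V, ContinuousLinearMap.fst ℝ K B.model ∘L
    (A : P.bdModel × Z.model →L[ℝ] K × B.model), s, hU, hV, hV₀,
    fun x hx => ⟨(hVΩ hx).1, (hVΩ hx).2.2⟩, hAU, fun v hv => ?_, fun x hx t ht hxt => ?_,
    hs1, hs2, hs3, hs4⟩
  · obtain ⟨h1, h2, h3⟩ := hsV v hv
    exact ⟨h1, h2, (hχG _ (hVΩ h1) _ ⟨hv.2.1, hv.2.2.trans_le hδε⟩).1 h3⟩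
  · exact hsu x hx t ht ((hχG _ (hVΩ hx) _ ⟨ht.1, ht.2.trans_le hδε⟩).2 hxt)

end Collar

/-! ## Collars of fibre products -/

section SliceParam

/-- A local parametrization of a fibre product which is smooth in terms of the projections. -/
structure SliceParam {P Z : HilbertManifold.{u}} {Q : Type u} [TopologicalSpace Q] (p : Q → P)
    (z : Q → Z) {K : Type u} [NormedAddCommGroup K] [NormedSpace ℝ K]
    (e : OpenPartialHomeomorph K Q) : Prop where
  smooth_fst : ContMDiffOn 𝓘(ℝ, K) 𝓘(ℝ, P.model) ∞ (fun v => p (e v)) e.source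
  smooth_snd : ContMDiffOn 𝓘(ℝ, K) 𝓘(ℝ, Z.model) ∞ (fun v => z (e v)) e.source
  smooth_symm : ∃ (O : Set (P × Z)) (j : P × Z → K),
    ContMDiffOn (𝓘(ℝ, P.model).prod 𝓘(ℝ, Z.model)) 𝓘(ℝ, K) ∞ j O ∧
    ∀ q ∈ e.target, (p q, z q) ∈ O ∧ e.symm q = j (p q, z q)

variable {P Z Q : HilbertManifold.{u}} {B : Type u} {σ : P → B} {g : Z → B}
  {p : Q → P} {z : Q → Z} {K : Type u} [NormedAddCommGroup K] [NormedSpace ℝ K]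
  {e : OpenPartialHomeomorph K Q}

/-- Collars are built while the fibre product is only a topological space, with smoothness expressed
through the projections. Once a smooth embedded structure is given, the embedding turns this into
genuine smoothness. -/
theorem SliceParam.contMDiffOn (h : SliceParam p z e)
    (hq : FloerBordism.IsFibreProduct σ g p z) :
    ContMDiffOn 𝓘(ℝ, K) 𝓘(ℝ, Q.model) ∞ e e.source := by
  intro v hv
  have hnhds := e.open_source.mem_nhds hv
  refine ContMDiffAt.contMDiffWithinAt ?_
  rw [ContMDiffAt.iff_comp_isImmersionAt (hq.isSmoothEmbedding.isImmersion.isImmersionAt _)]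
  exact ⟨e.continuousAt hv, (h.smooth_fst.contMDiffAt hnhds).prodMk
    (h.smooth_snd.contMDiffAt hnhds)⟩

theorem SliceParam.contMDiffOn_symm (h : SliceParam p z e)
    (hq : FloerBordism.IsFibreProduct σ g p z) :
    ContMDiffOn 𝓘(ℝ, Q.model) 𝓘(ℝ, K) ∞ e.symm e.target := by
  obtain ⟨O, j, hj, hjO⟩ := h.smooth_symm
  exact (hj.comp hq.isSmoothEmbedding.contMDiff.contMDiffOn fun q hq => (hjO q hq).1).congr
    fun q hq => (hjO q hq).2

theorem SliceParam.nonempty_equiv (h : SliceParam p z e)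
    (hq : FloerBordism.IsFibreProduct σ g p z) (hne : e.source.Nonempty) :
    Nonempty (K ≃L[ℝ] Q.model) := by
  obtain ⟨x, hx⟩ := hne
  have h1 : IsLocalDiffeomorphAt 𝓘(ℝ, K) 𝓘(ℝ, Q.model) ∞ e x :=
    ⟨⟨e.toPartialEquiv, e.open_source, e.open_target, h.contMDiffOn hq, h.contMDiffOn_symm hq⟩,
      hx, fun _ _ => rfl⟩
  exact ⟨h1.mfderivToContinuousLinearEquiv (by simp)⟩

end SliceParam

/-! ### Construction of the collar -/

section Collar

theorem exists_openPartialHomeomorph_subtype {X Y : Type*} [TopologicalSpace X]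
    [TopologicalSpace Y] {T : Set Y} {a : X → Y} {b : Y → X} {S : Set X} {O : Set Y}
    (hS : IsOpen S) (hO : IsOpen O) (ha : ContinuousOn a S) (hb : ContinuousOn b O)
    (haO : ∀ x ∈ S, a x ∈ O ∧ a x ∈ T ∧ b (a x) = x)
    (hbS : ∀ y ∈ O, y ∈ T → b y ∈ S ∧ a (b y) = y) (hne : S.Nonempty) :
    ∃ e : OpenPartialHomeomorph X T, e.source = S ∧ e.target = Subtype.val ⁻¹' O ∧
      (∀ x ∈ S, (e x : Y) = a x) ∧ ∀ y, e.symm y = b y := by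
  obtain ⟨x₀, hx₀⟩ := hne
  have hex : ∀ x, ∃ y : T, x ∈ S → (y : Y) = a x := fun x => by
    by_cases hx : x ∈ S
    · exact ⟨⟨a x, (haO x hx).2.1⟩, fun _ => rfl⟩
    · exact ⟨⟨a x₀, (haO x₀ hx₀).2.1⟩, fun h => (hx h).elim⟩
  choose a' ha' using hex
  exact ⟨
    { toFun := a'
      invFun := fun y => b y
      source := S
      target := Subtype.val ⁻¹' O
      map_source' := fun x hx => by
        rw [mem_preimage, ha' x hx]
        exact (haO x hx).1
      map_target' := fun y hy => (hbS y hy y.2).1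
      left_inv' := fun x hx => by
        rw [ha' x hx]
        exact (haO x hx).2.2
      right_inv' := fun y hy => Subtype.ext ((ha' _ (hbS y hy y.2).1).trans (hbS y hy y.2).2)
      open_source := hS
      open_target := hO.preimage continuous_subtype_val
      continuousOn_toFun := IsInducing.subtypeVal.continuousOn_iff.2 (ha.congr ha')
      continuousOn_invFun := hb.comp continuous_subtype_val.continuousOn fun _ h => h },
    rfl, rfl, ha', fun _ => rfl⟩

variable {P : LCManifold.{u}} {B Z N : HilbertManifold.{u}} {σ : P → B} {g : Z → B} {f : Z → N}
  {Q : Type u} [TopologicalSpace Q] {p : Q → P} {z : Q → Z}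

/-- A collar of the boundary `{q | p q ∈ ∂P}` of the fibre product, near one of its points. -/
theorem LCSmooth.exists_collar (hσ : LCSmooth P B σ) (hg : Smooth Z B g) (hf : Smooth Z N f)
    (he : IsEmbedding fun q => (p q, z q))
    (hr : range (fun q => (p q, z q)) = {x : P × Z | σ x.1 = g x.2})
    (q₀ : {q | p q ∈ P.boundary})
    (hs : Surjective (differenceD (P.onBd σ) g (⟨p q₀, q₀.2⟩, z q₀)))
    {K : Type u} [NormedAddCommGroup K] [NormedSpace ℝ K] [CompleteSpace K]
    (e : (differenceD (P.onBd σ) g (⟨p q₀, q₀.2⟩, z q₀)).ker ≃L[ℝ] K) :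
    ∃ (δ : ℝ) (U : Set K) (α : PartialHomeomorph (K × ℝ) Q)
      (αi : OpenPartialHomeomorph (K × ℝ) ↥({q | p q ∈ P.boundary}ᶜ))
      (αb : OpenPartialHomeomorph K {q | p q ∈ P.boundary}), 0 < δ ∧ IsOpen U ∧
      α.source = U ×ˢ Ico 0 δ ∧ IsOpen α.target ∧
      αi.source = U ×ˢ Ioo 0 δ ∧ (∀ v ∈ αi.source, (αi v : Q) = α v) ∧
      SliceParam (P := P.int) (fun q : ↥({q | p q ∈ P.boundary}ᶜ) => ⟨p q, q.2⟩) (fun q => z q) αi ∧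
      αb.source = U ∧ (∀ κ ∈ U, (αb κ : Q) = α (κ, 0)) ∧ q₀ ∈ αb.target ∧
      SliceParam (P := P.bd) (fun q : {q | p q ∈ P.boundary} => ⟨p q, q.2⟩) (fun q => z q) αb ∧
      (∀ v ∈ U ×ˢ Ico 0 δ, f (z (α v)) ∈ (chartAt N.model (f (z q₀))).source) ∧
      (∀ t ∈ Ico 0 δ, DifferentiableOn ℝ
        (fun κ => chartAt N.model (f (z q₀)) (f (z (α (κ, t))))) U) ∧
      ContinuousOn (fun v : K × ℝ => fderiv ℝ
        (fun κ => chartAt N.model (f (z q₀)) (f (z (α (κ, v.2))))) v.1) (U ×ˢ Ico 0 δ) := by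
  have hpz : ∀ q, σ (p q) = g (z q) := fun q => by
    have : (p q, z q) ∈ {x : P × Z | σ x.1 = g x.2} := hr ▸ ⟨q, rfl⟩
    exact this
  have hpc : Continuous p := continuous_fst.comp he.continuous
  have hzc : Continuous z := continuous_snd.comp he.continuous
  set p₀ : P.bd := ⟨p q₀, q₀.2⟩ with hp₀
  set z₀ : Z := z q₀ with hz₀
  -- The set O confines the Z-coordinate so that f takes values in the chart of N at f(z₀)
  -- throughout the collar.
  obtain ⟨c, hcφ, δ, hδ, hδε, U, V, L, s, hU, hV, hV₀, hVΩ, hLU, hsV, hsu, hsc, hsi, hst, hsd⟩ :=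
    hσ.exists_solution hg (p₀ := p₀) (z₀ := z₀) (hpz q₀) hs e
      (O := f ⁻¹' (chartAt N.model (f z₀)).source)
      ((chartAt N.model (f z₀)).open_source.preimage (ContMDiff.continuous hf))
      (mem_chart_source _ _)
  set φ := chartAt P.bdModel p₀
  set ψ := chartAt Z.model z₀
  set χ := chartAt N.model (f z₀)
  have hφs : ∀ x ∈ φ '' c.base, φ.symm x ∈ c.base := by
    rintro _ ⟨v, hv, rfl⟩
    rwa [φ.left_inv (hcφ hv)]
  have hφt : φ '' c.base ⊆ φ.target := by
    rintro _ ⟨v, hv, rfl⟩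
    exact φ.map_source (hcφ hv)
  have hne : (c.base ×ˢ Ico 0 c.ε).Nonempty :=
    ⟨(φ.symm (φ p₀), 0), hφs _ (hVΩ hV₀).1, le_rfl, c.ε_pos⟩
  obtain ⟨c', hc', hc'c⟩ := exists_inverse_of_isOpenEmbedding c.isOpenEmbedding hne
  have hδs : Ico 0 δ ⊆ Ico 0 c.ε := fun t ht => ⟨ht.1, ht.2.trans_le hδε⟩
  -- The collar meets the boundary exactly at t = 0, since for t > 0 the lc-chart agrees with a map
  -- into the open stratum.
  have hcb : ∀ u ∈ c.base, ∀ t ∈ Ico 0 c.ε, c.toFun (u, t) ∈ P.boundary ↔ t = 0 := by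
    rintro u hu t ht
    constructor
    · intro h
      by_contra h0
      have h1 : (u, t) ∈ c.diffeo.source := by
        rw [c.source_eq]
        exact ⟨hu, lt_of_le_of_ne ht.1 (Ne.symm h0), ht.2⟩
      rw [← c.diffeo_eq _ h1] at h
      exact (c.diffeo (u, t)).2 h
    · rintro rfl
      rw [c.map_zero u hu]
      exact u.2
  -- the parametrization
  have hex : ∀ v : K × ℝ, ∃ q, v ∈ U ×ˢ Ico 0 δ →
      (p q, z q) = (c.toFun (φ.symm (s v).1, v.2), ψ.symm (s v).2) := by
    intro v
    by_cases hv : v ∈ U ×ˢ Ico 0 δ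
    · have : (c.toFun (φ.symm (s v).1, v.2), ψ.symm (s v).2) ∈ range fun q => (p q, z q) := by
        rw [hr]; exact (hsV v hv).2.2
      obtain ⟨q, hq⟩ := this
      exact ⟨q, fun _ => hq⟩
    · exact ⟨q₀, fun h => (hv h).elim⟩
  choose a ha using hex
  have hap : ∀ v ∈ U ×ˢ Ico 0 δ, p (a v) = c.toFun (φ.symm (s v).1, v.2) := fun v hv =>
    congrArg Prod.fst (ha v hv)
  have haz : ∀ v ∈ U ×ˢ Ico 0 δ, z (a v) = ψ.symm (s v).2 := fun v hv =>
    congrArg Prod.snd (ha v hv)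
  have hsb : ∀ v ∈ U ×ˢ Ico 0 δ, φ.symm (s v).1 ∈ c.base := fun v hv =>
    hφs _ (hVΩ (hsV v hv).1).1
  -- its inverse
  let crd : Q → P.bdModel × Z.model := fun q => (φ (c' (p q)).1, ψ (z q))
  -- The inverse reads off the time from the lc-chart and the K-coordinate by applying L to the
  -- chart coordinates; uniqueness of solutions in V makes it two-sided.
  let b : Q → K × ℝ := fun q => (L (crd q), (c' (p q)).2)
  let O₀ : Set Q := p ⁻¹' (c.toFun '' (c.base ×ˢ Ico 0 δ)) ∩ z ⁻¹' ψ.source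
  have hO₀ : IsOpen O₀ := by
    refine IsOpen.inter (IsOpen.preimage hpc ?_) (ψ.open_source.preimage hzc)
    have h1 : c.toFun '' (c.base ×ˢ Ico 0 δ) =
        ((c.base ×ˢ Ico 0 c.ε).domRestrict c.toFun) '' (Subtype.val ⁻¹' (univ ×ˢ Iio δ)) := by
      ext x
      constructor
      · rintro ⟨v, hv, rfl⟩
        exact ⟨⟨v, hv.1, hδs hv.2⟩, ⟨trivial, hv.2.2⟩, rfl⟩
      · rintro ⟨⟨v, hv⟩, hv', rfl⟩
        exact ⟨v, ⟨hv.1, hv.2.1, hv'.2⟩, rfl⟩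
    rw [h1]
    exact c.isOpenEmbedding.isOpenMap _
      ((isOpen_univ.prod isOpen_Iio).preimage continuous_subtype_val)
  have hc'₀ : ∀ q ∈ O₀, ∃ u ∈ c.base, ∃ t ∈ Ico 0 δ, p q = c.toFun (u, t) ∧ c' (p q) = (u, t) := by
    rintro q ⟨⟨⟨u, t⟩, ⟨hu, ht⟩, hq⟩, -⟩
    exact ⟨u, hu, t, ht, hq.symm, by rw [← hq, hc' _ ⟨hu, hδs ht⟩]⟩
  have hc'p : ContinuousOn (fun q => c' (p q)) O₀ :=
    hc'c.comp hpc.continuousOn fun q hq => by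
      obtain ⟨u, hu, t, ht, hq, -⟩ := hc'₀ q hq
      exact ⟨(u, t), ⟨hu, hδs ht⟩, hq.symm⟩
  have hcrd : ContinuousOn crd O₀ := by
    refine ContinuousOn.prodMk (φ.continuousOn.comp (continuous_fst.comp_continuousOn hc'p) ?_)
      (ψ.continuousOn.comp hzc.continuousOn fun q hq => hq.2)
    intro q hq
    obtain ⟨u, hu, t, ht, -, hq⟩ := hc'₀ q hq
    change (c' (p q)).1 ∈ φ.source
    rw [hq]
    exact hcφ hu
  have hcb' : ContinuousOn b O₀ :=
    (L.continuous.comp_continuousOn hcrd).prodMk (continuous_snd.comp_continuousOn hc'p)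
  let O : Set Q := O₀ ∩ crd ⁻¹' V
  have hO : IsOpen O := hcrd.isOpen_inter_preimage hO₀ hV
  have hca : ∀ v ∈ U ×ˢ Ico 0 δ, a v ∈ O ∧ crd (a v) = s v ∧ b (a v) = v := by
    intro v hv
    have h1 := (hVΩ (hsV v hv).1)
    have h2 : c' (p (a v)) = (φ.symm (s v).1, v.2) := by
      rw [hap v hv, hc' _ ⟨hsb v hv, hδs hv.2⟩]
    have h3 : crd (a v) = s v := by
      simp only [crd, h2, haz v hv]
      exact Prod.ext (φ.right_inv (hφt h1.1)) (ψ.right_inv h1.2.1)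
    refine ⟨⟨⟨?_, ?_⟩, ?_⟩, h3, Prod.ext ?_ ?_⟩
    · exact ⟨(φ.symm (s v).1, v.2), ⟨hsb v hv, hv.2⟩, (hap v hv).symm⟩
    · rw [mem_preimage, haz v hv]
      exact ψ.map_target h1.2.1
    · rw [mem_preimage, h3]
      exact (hsV v hv).1
    · change L (crd (a v)) = v.1
      rw [h3]
      exact (hsV v hv).2.1
    · change (c' (p (a v))).2 = v.2
      rw [h2]
  have hcO : ∀ q ∈ O, b q ∈ U ×ˢ Ico 0 δ ∧ a (b q) = q := by
    rintro q ⟨hq, hqV⟩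
    obtain ⟨u, hu, t, ht, hpq, hcq⟩ := hc'₀ q hq
    have hb : b q = (L (crd q), t) := by simp only [b, hcq]
    have hbm : b q ∈ U ×ˢ Ico 0 δ := by
      rw [hb]
      exact ⟨hLU _ hqV, ht⟩
    have h1 : φ.symm (crd q).1 = u := by
      simp only [crd, hcq]
      exact φ.left_inv (hcφ hu)
    have h2 : ψ.symm (crd q).2 = z q := ψ.left_inv hq.2
    have h3 : s (b q) = crd q := by
      rw [hb]
      refine hsu _ hqV t ht ?_
      rw [h1, h2, ← hpq]
      exact hpz q
    refine ⟨hbm, he.injective ?_⟩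
    rw [ha _ hbm, h3, h1, h2, hb, hpq]
  have hac : ContinuousOn a (U ×ˢ Ico 0 δ) := by
    refine he.isInducing.continuousOn_iff.2 ?_
    refine ContinuousOn.congr (ContinuousOn.prodMk (c.continuousOn.comp (ContinuousOn.prodMk
      (φ.continuousOn_symm.comp (continuous_fst.comp_continuousOn hsc) ?_) continuousOn_snd) ?_)
      (ψ.continuousOn_symm.comp (continuous_snd.comp_continuousOn hsc) ?_)) ha
    · exact fun v hv => hφt (hVΩ (hsV v hv).1).1
    · exact fun v hv => ⟨hsb v hv, hδs hv.2⟩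
    · exact fun v hv => (hVΩ (hsV v hv).1).2.1
  have hab : ∀ v ∈ U ×ˢ Ico 0 δ, p (a v) ∈ P.boundary ↔ v.2 = 0 := fun v hv => by
    rw [hap v hv]
    exact hcb _ (hsb v hv) _ (hδs hv.2)
  have hbO : ContinuousOn b O := hcb'.mono inter_subset_left
  have hoo : ∀ v ∈ U ×ˢ Ioo 0 δ, v ∈ U ×ˢ Ico 0 δ := fun v hv => ⟨hv.1, Ioo_subset_Ico_self hv.2⟩
  have h00 : ∀ κ ∈ U, (κ, (0 : ℝ)) ∈ U ×ˢ Ico 0 δ := fun κ hκ => ⟨hκ, le_rfl, hδ⟩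
  let α : PartialHomeomorph (K × ℝ) Q :=
    { toFun := a
      invFun := b
      source := U ×ˢ Ico 0 δ
      target := O
      map_source' := fun v hv => (hca v hv).1
      map_target' := fun q hq => (hcO q hq).1
      left_inv' := fun v hv => (hca v hv).2.2
      right_inv' := fun q hq => (hcO q hq).2
      continuousOn_toFun := hac
      continuousOn_invFun := hbO }
  have hU₀ : L (φ p₀, ψ z₀) ∈ U := hLU _ hV₀
  have hmem : ∀ q ∈ O, q ∈ ({q | p q ∈ P.boundary} : Set Q) ↔ (b q).2 = 0 := fun q hq => by
    rw [← hab _ (hcO q hq).1, (hcO q hq).2]; rfl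
  -- The collar is split into its part with t > 0, open in the open stratum, and its slice t = 0,
  -- open in the boundary.
  obtain ⟨αi, hαi, hαit, hαia, hαib⟩ := exists_openPartialHomeomorph_subtype
    (T := {q | p q ∈ P.boundary}ᶜ) (hU.prod isOpen_Ioo) hO (hac.mono hoo) hbO
    (fun v hv => ⟨(hca v (hoo v hv)).1, fun h => hv.2.1.ne' ((hab v (hoo v hv)).1 h),
      (hca v (hoo v hv)).2.2⟩)
    (fun q hq hqT => ⟨⟨(hcO q hq).1.1, lt_of_le_of_ne (hcO q hq).1.2.1
      fun h => hqT ((hmem q hq).2 h.symm), (hcO q hq).1.2.2⟩, (hcO q hq).2⟩)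
    ⟨(L (φ p₀, ψ z₀), δ / 2), hU₀, by constructor <;> linarith⟩
  obtain ⟨αb, hαb, hαbt, hαba, hαbb⟩ := exists_openPartialHomeomorph_subtype
    (T := {q | p q ∈ P.boundary}) (a := fun κ => a (κ, 0)) (b := fun q => (b q).1) hU hO
    (hac.comp (by fun_prop) h00) (continuous_fst.comp_continuousOn hbO)
    (fun κ hκ => ⟨(hca _ (h00 κ hκ)).1, (hab _ (h00 κ hκ)).2 rfl,
      congrArg Prod.fst (hca _ (h00 κ hκ)).2.2⟩)
    (fun q hq hqT => ⟨(hcO q hq).1.1, by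
      have h1 : ((b q).1, (0 : ℝ)) = b q := Prod.ext rfl ((hmem q hq).1 hqT).symm
      rw [h1, (hcO q hq).2]⟩) ⟨_, hU₀⟩
  have hψs : ContMDiffOn 𝓘(ℝ, Z.model) 𝓘(ℝ, Z.model) ∞ ψ.symm ψ.target := contMDiffOn_chart_symm
  have hφsm : ContMDiffOn 𝓘(ℝ, P.bdModel) 𝓘(ℝ, P.bdModel) ∞ φ.symm φ.target :=
    contMDiffOn_chart_symm
  have hsim := hsi.contMDiffOn
  have hstm := (hst 0 ⟨le_rfl, hδ⟩).contMDiffOn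
  have hcsrc : ∀ u ∈ c.base, ∀ t ∈ Ioo 0 c.ε, (u, t) ∈ c.diffeo.source := fun u hu t ht => by
    rw [c.source_eq]; exact ⟨hu, ht⟩
  refine ⟨δ, U, α, αi, αb, hδ, hU, rfl, hO, hαi, fun v hv => hαia v (hαi ▸ hv), ⟨?_, ?_, ?_⟩, hαb,
    fun κ hκ => hαba κ hκ, ?_, ⟨?_, ?_, ?_⟩, ?_, ?_, ?_⟩
  · rw [hαi]
    have h1 : ContMDiffOn 𝓘(ℝ, K × ℝ) (𝓘(ℝ, P.bdModel).prod 𝓘(ℝ, ℝ)) ∞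
        (fun v : K × ℝ => (φ.symm (s v).1, v.2)) (U ×ˢ Ioo 0 δ) :=
      (hφsm.comp (contDiff_fst.contMDiff.comp_contMDiffOn hsim)
        fun v hv => hφt (hVΩ (hsV v (hoo v hv)).1).1).prodMk contDiff_snd.contMDiff.contMDiffOn
    have h2 : ∀ v ∈ U ×ˢ Ioo 0 δ, (φ.symm (s v).1, v.2) ∈ c.diffeo.source := fun v hv =>
      hcsrc _ (hsb v (hoo v hv)) _ ⟨hv.2.1, hv.2.2.trans_le hδε⟩
    refine (c.smooth_diffeo.comp h1 h2).congr fun v hv => Subtype.ext ?_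
    change p (αi v) = c.diffeo (φ.symm (s v).1, v.2)
    rw [hαia v hv, hap v (hoo v hv), c.diffeo_eq _ (h2 v hv)]
  · rw [hαi]
    refine (hψs.comp (contDiff_snd.contMDiff.comp_contMDiffOn hsim)
      fun v hv => (hVΩ (hsV v (hoo v hv)).1).2.1).congr fun v hv => ?_
    rw [hαia v hv, haz v (hoo v hv)]
    rfl
  · refine ⟨c.diffeo.target ×ˢ ψ.source,
      fun x => (L (φ (c.diffeo.symm x.1).1, ψ x.2), (c.diffeo.symm x.1).2), ?_, ?_⟩
    · have h1 : ContMDiffOn (𝓘(ℝ, P.intModel).prod 𝓘(ℝ, Z.model)) (𝓘(ℝ, P.bdModel).prod 𝓘(ℝ, ℝ)) ∞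
          (fun x : P.int × Z => c.diffeo.symm x.1) (c.diffeo.target ×ˢ ψ.source) :=
        c.smooth_symm.comp contMDiffOn_fst fun x hx => hx.1
      have h2 : ContMDiffOn (𝓘(ℝ, P.intModel).prod 𝓘(ℝ, Z.model)) 𝓘(ℝ, P.bdModel) ∞
          (fun x : P.int × Z => φ (c.diffeo.symm x.1).1) (c.diffeo.target ×ˢ ψ.source) := by
        refine (contMDiffOn_chart (x := p₀)).comp (contMDiff_fst.comp_contMDiffOn h1) ?_
        intro x hx
        have h3 := c.diffeo.map_target hx.1
        rw [c.source_eq] at h3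
        exact hcφ h3.1
      have h3 : ContMDiffOn (𝓘(ℝ, P.intModel).prod 𝓘(ℝ, Z.model)) 𝓘(ℝ, Z.model) ∞
          (fun x : P.int × Z => ψ x.2) (c.diffeo.target ×ˢ ψ.source) :=
        (contMDiffOn_chart (x := z₀)).comp contMDiffOn_snd fun x hx => hx.2
      exact (L.contDiff.contMDiff.comp_contMDiffOn (h2.prodMk_space h3)).prodMk_space
        (contMDiff_snd.comp_contMDiffOn h1)
    · rintro ⟨q, hqT⟩ hq
      have hqO : q ∈ O := by rwa [hαit] at hq
      obtain ⟨u, hu, t, ht, hpq, hcq⟩ := hc'₀ q hqO.1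
      have ht0 : t ≠ 0 := fun h0 => hqT (by
        change p q ∈ P.boundary
        rw [hpq]
        exact (hcb u hu t (hδs ht)).2 h0)
      have h1 := hcsrc u hu t ⟨lt_of_le_of_ne ht.1 ht0.symm, ht.2.trans_le hδε⟩
      have h2 : (⟨p q, hqT⟩ : P.int) = c.diffeo (u, t) := Subtype.ext (by
        rw [c.diffeo_eq _ h1]; exact hpq)
      refine ⟨⟨?_, hqO.1.2⟩, ?_⟩
      · change (⟨p q, hqT⟩ : P.int) ∈ c.diffeo.target
        rw [h2]
        exact c.diffeo.map_source h1
      · change αi.symm ⟨q, hqT⟩ = (L (φ (c.diffeo.symm (⟨p q, hqT⟩ : P.int)).1, ψ (z q)),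
          (c.diffeo.symm (⟨p q, hqT⟩ : P.int)).2)
        rw [hαib, h2, c.diffeo.left_inv h1]
        simp only [b, crd, hcq]
  · rw [hαbt]
    have h1 : c' (p q₀) = (p₀, 0) := by
      have h2 : p₀ ∈ c.base := by
        have := hφs _ (hVΩ hV₀).1
        rwa [φ.left_inv (mem_chart_source _ _)] at this
      have h3 := hc' (p₀, 0) ⟨h2, le_rfl, c.ε_pos⟩
      rwa [c.map_zero _ h2] at h3
    have h2 : crd q₀ = (φ p₀, ψ z₀) := by simp only [crd, h1]; rfl
    have h4 : p₀ ∈ c.base := by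
      have := hφs _ (hVΩ hV₀).1
      rwa [φ.left_inv (mem_chart_source _ _)] at this
    refine ⟨⟨⟨(p₀, 0), ⟨h4, le_rfl, hδ⟩, c.map_zero _ h4⟩, mem_chart_source _ _⟩, ?_⟩
    rw [mem_preimage, h2]
    exact hV₀
  · rw [hαb]
    refine (hφsm.comp (contDiff_fst.contMDiff.comp_contMDiffOn hstm)
        fun κ hκ => hφt (hVΩ (hsV _ (h00 κ hκ)).1).1).congr fun κ hκ => Subtype.ext ?_
    change p (αb κ) = φ.symm (s (κ, 0)).1
    rw [hαba κ hκ, hap _ (h00 κ hκ), c.map_zero _ (hsb _ (h00 κ hκ))]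
  · rw [hαb]
    refine (hψs.comp (contDiff_snd.contMDiff.comp_contMDiffOn hstm)
      fun κ hκ => (hVΩ (hsV _ (h00 κ hκ)).1).2.1).congr fun κ hκ => ?_
    rw [hαba κ hκ, haz _ (h00 κ hκ)]
    rfl
  · refine ⟨φ.source ×ˢ ψ.source, fun x => L (φ x.1, ψ x.2), ?_, ?_⟩
    · exact L.contDiff.contMDiff.comp_contMDiffOn
        (((contMDiffOn_chart (x := p₀)).comp contMDiffOn_fst fun x hx => hx.1).prodMk_space
          ((contMDiffOn_chart (x := z₀)).comp contMDiffOn_snd fun x hx => hx.2))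
    · rintro ⟨q, hqT⟩ hq
      have hqO : q ∈ O := by rwa [hαbt] at hq
      obtain ⟨u, hu, t, ht, hpq, hcq⟩ := hc'₀ q hqO.1
      have ht0 : t = 0 := (hcb u hu t (hδs ht)).1 (by rw [← hpq]; exact hqT)
      have h2 : (⟨p q, hqT⟩ : P.bd) = u := Subtype.ext (by
        rw [← c.map_zero u hu, ← ht0]; exact hpq)
      refine ⟨⟨?_, hqO.1.2⟩, ?_⟩
      · change (⟨p q, hqT⟩ : P.bd) ∈ φ.source
        rw [h2]
        exact hcφ hu
      · change αb.symm ⟨q, hqT⟩ = L (φ (⟨p q, hqT⟩ : P.bd), ψ (z q))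
        rw [hαbb, h2]
        simp only [b, crd, hcq]
  · intro v hv
    change f (z (a v)) ∈ χ.source
    rw [haz v hv]
    exact (hVΩ (hsV v hv).1).2.2
  -- In charts, f ∘ z on the collar is a smooth function of the second component of s, so its
  -- κ-derivative inherits continuity from that of s.
  all_goals
    have hh : ContDiffOn ℝ ∞ (fun y => χ (f (ψ.symm y))) (ψ.target ∩ ψ.symm ⁻¹' (f ⁻¹' χ.source)) :=
      hf.contDiffOn_charts z₀ (f z₀)
    have hhO : IsOpen (ψ.target ∩ ψ.symm ⁻¹' (f ⁻¹' χ.source)) :=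
      isOpen_chart_domain (ContMDiff.continuous hf) z₀ (f z₀)
    have hd : ∀ v ∈ U ×ˢ Ico 0 δ, HasFDerivAt (fun κ => χ (f (z (a (κ, v.2)))))
        (fderiv ℝ (fun y => χ (f (ψ.symm y))) (s v).2 ∘L ContinuousLinearMap.snd ℝ _ _ ∘L
          fderiv ℝ (fun κ => s (κ, v.2)) v.1) v.1 := by
      rintro ⟨κ, t⟩ hv
      have h1 := (((hst t hv.2).contDiffAt (hU.mem_nhds hv.1)).differentiableAt
        (by simp)).hasFDerivAt
      have h2 := ((hh.contDiffAt (hhO.mem_nhds (hVΩ (hsV _ hv).1).2)).differentiableAt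
        (by simp)).hasFDerivAt
      refine (h2.comp κ (hasFDerivAt_snd.comp κ h1)).congr_of_eventuallyEq ?_
      filter_upwards [hU.mem_nhds hv.1] with κ' hκ'
      simp only [comp_apply, haz (κ', t) ⟨hκ', hv.2⟩]
  · exact fun t ht κ hκ => (hd (κ, t) ⟨hκ, ht⟩).differentiableAt.differentiableWithinAt
  · refine ContinuousOn.congr (ContinuousOn.clm_comp ?_
      (ContinuousOn.clm_comp continuousOn_const hsd)) fun v hv => (hd v hv).fderiv
    exact (hh.continuousOn_fderiv_of_isOpen hhO (by simp)).comp
      (continuous_snd.comp_continuousOn hsc) fun v hv => (hVΩ (hsV v hv).1).2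

end Collar

/-! ## Charts of lc-manifolds from collars -/

section LCCharts

variable {Q : Type u} [TopologicalSpace Q] {bd : Set Q} {E₀ E₁ : Type u}
  [NormedAddCommGroup E₀] [InnerProductSpace ℝ E₀] [NormedAddCommGroup E₁] [InnerProductSpace ℝ E₁]
  [ChartedSpace E₀ ↥(bdᶜ)] [ChartedSpace E₁ ↥bd] [IsManifold 𝓘(ℝ, E₁) ∞ ↥bd]
  {K : Type u} [NormedAddCommGroup K] [NormedSpace ℝ K]
  {Y : Type*} [NormedAddCommGroup Y] [NormedSpace ℝ Y]

/-- A parametrized collar gives a chart in the sense of lc-manifolds. -/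
theorem exists_lcChart_of_collar {δ : ℝ} (hδ : 0 < δ) {U : Set K} {α : PartialHomeomorph (K × ℝ) Q}
    {αi : OpenPartialHomeomorph (K × ℝ) ↥(bdᶜ)} {αb : OpenPartialHomeomorph K bd}
    (hα : α.source = U ×ˢ Ico 0 δ) (hαo : IsOpen α.target) (hαi : αi.source = U ×ˢ Ioo 0 δ)
    (hαiα : ∀ v ∈ αi.source, (αi v : Q) = α v)
    (hαis : ContMDiffOn 𝓘(ℝ, K × ℝ) 𝓘(ℝ, E₀) ∞ αi αi.source)
    (hαis' : ContMDiffOn 𝓘(ℝ, E₀) 𝓘(ℝ, K × ℝ) ∞ αi.symm αi.target)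
    (hαb : αb.source = U) (hαbα : ∀ κ ∈ U, (αb κ : Q) = α (κ, 0))
    (hαbs : ContMDiffOn 𝓘(ℝ, K) 𝓘(ℝ, E₁) ∞ αb αb.source)
    (hαbs' : ContMDiffOn 𝓘(ℝ, E₁) 𝓘(ℝ, K) ∞ αb.symm αb.target)
    {q₀ : bd} (hq₀ : q₀ ∈ αb.target) {h : Q → Y}
    (hd : ∀ t ∈ Ico 0 δ, DifferentiableOn ℝ (fun κ => h (α (κ, t))) U)
    (hc : ContinuousOn (fun v : K × ℝ => fderiv ℝ (fun κ => h (α (κ, v.2))) v.1)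
      (U ×ˢ Ico 0 δ)) :
    ∃ c : LCChart bd E₀ E₁, q₀ ∈ c.base ∧ c.base ⊆ (chartAt E₁ q₀).source ∧
      (∀ v ∈ c.base ×ˢ Ico 0 c.ε, ∃ w ∈ U ×ˢ Ico 0 δ, c.toFun v = α w) ∧
      ContinuousOn (fun x : E₁ × ℝ =>
        fderiv ℝ (fun x' => h (c.toFun ((chartAt E₁ q₀).symm x', x.2))) x.1)
        ((chartAt E₁ q₀ '' c.base) ×ˢ Ico 0 c.ε) := by
  have hU : IsOpen U := hαb ▸ αb.open_source
  set θ := chartAt E₁ q₀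
  let base : Set bd := αb.target ∩ θ.source
  have hbase : IsOpen base := αb.open_target.inter θ.open_source
  -- The linear parameter space K is traded for the boundary by inverting the slice at t = 0, which
  -- makes the chart the inclusion there.
  let F : bd × ℝ → Q := fun v => α (αb.symm v.1, v.2)
  have hbU : ∀ v ∈ base, αb.symm v ∈ U := fun v hv => hαb ▸ αb.map_target hv.1
  have hFw : ∀ v ∈ base ×ˢ Ico 0 δ, (αb.symm v.1, v.2) ∈ U ×ˢ Ico 0 δ := fun v hv =>
    ⟨hbU _ hv.1, hv.2⟩
  have hαl : ∀ w ∈ U ×ˢ Ico 0 δ, α w ∈ α.target ∧ α.symm (α w) = w := fun w hw =>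
    ⟨α.map_source (hα ▸ hw), α.left_inv (hα ▸ hw)⟩
  let G : Q → bd × ℝ := fun q => (αb (α.symm q).1, (α.symm q).2)
  have hGF : ∀ v ∈ base ×ˢ Ico 0 δ, G (F v) = v := fun v hv => by
    simp only [G, F, (hαl _ (hFw v hv)).2]
    exact Prod.ext (αb.right_inv hv.1.1) rfl
  have hαs : ContinuousOn α.symm α.target := α.continuousOn_symm
  have himg : F '' (base ×ˢ Ico 0 δ) =
      α.target ∩ α.symm ⁻¹' ((αb.source ∩ αb ⁻¹' base) ×ˢ univ) := by
    ext q
    constructor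
    · rintro ⟨v, hv, rfl⟩
      have h1 := hαl _ (hFw v hv)
      refine ⟨h1.1, ?_⟩
      change α.symm (α _) ∈ ((αb.source ∩ αb ⁻¹' base) ×ˢ univ : Set (K × ℝ))
      rw [h1.2]
      refine ⟨⟨αb.map_target hv.1.1, ?_⟩, trivial⟩
      rw [mem_preimage, αb.right_inv hv.1.1]
      exact hv.1
    · rintro ⟨hq, ⟨hq1, hq2⟩, -⟩
      have h1 : α.symm q ∈ U ×ˢ Ico 0 δ := hα ▸ α.map_target hq
      refine ⟨(αb (α.symm q).1, (α.symm q).2), ⟨hq2, h1.2⟩, ?_⟩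
      simp only [F, αb.left_inv hq1]
      exact α.right_inv hq
  have hFc : ContinuousOn F (base ×ˢ Ico 0 δ) := by
    have h1 : ContinuousOn α (U ×ˢ Ico 0 δ) := hα ▸ α.continuousOn
    exact h1.comp ((αb.continuousOn_symm.comp continuousOn_fst fun v hv => hv.1.1).prodMk
      continuousOn_snd) hFw
  have hGc : ContinuousOn G (F '' (base ×ˢ Ico 0 δ)) := by
    have h1 : ContinuousOn α.symm (F '' (base ×ˢ Ico 0 δ)) :=
      hαs.mono (himg ▸ inter_subset_left)
    refine (αb.continuousOn.comp (continuous_fst.comp_continuousOn h1) ?_).prodMk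
      (continuous_snd.comp_continuousOn h1)
    rw [himg]
    exact fun q hq => hq.2.1.1
  let e : OpenPartialHomeomorph (bd × ℝ) ↥(bdᶜ) :=
    ((αb.symm.restrOpen θ.source θ.open_source).prod (OpenPartialHomeomorph.refl ℝ)).trans αi
  have hes : e.source = base ×ˢ Ioo 0 δ := by
    ext ⟨v, t⟩
    constructor
    · rintro ⟨⟨hv, -⟩, hv'⟩
      have h1 : (αb.symm v, t) ∈ αi.source := hv'
      rw [hαi] at h1
      exact ⟨hv, h1.2⟩
    · rintro ⟨hv, ht⟩
      refine ⟨⟨hv, trivial⟩, ?_⟩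
      change (αb.symm v, t) ∈ αi.source
      rw [hαi]
      exact ⟨hbU v hv, ht⟩
  have hei : ∀ v ∈ e.source, (αb.symm v.1, v.2) ∈ αi.source := fun v hv => hv.2
  have hb1 : ∀ v ∈ e.source, v.1 ∈ αb.target := fun v hv => (hes ▸ hv).1.1
  let c : LCChart bd E₀ E₁ :=
    { base := base
      isOpen_base := hbase
      ε := δ
      ε_pos := hδ
      toFun := F
      isOpenEmbedding := by
        refine isOpenEmbedding_domRestrict hFc hGc hGF ?_
        rw [himg]
        exact hαs.isOpen_inter_preimage hαo
          ((αb.isOpen_inter_preimage hbase).prod isOpen_univ)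
      map_zero := fun v hv => by
        simp only [F]
        rw [← hαbα _ (hbU v hv), αb.right_inv hv.1]
      diffeo := e
      source_eq := hes
      diffeo_eq := fun v hv => hαiα _ (hei v hv)
      smooth_diffeo := by
        refine ContMDiffOn.comp (I' := 𝓘(ℝ, K × ℝ)) (t := αi.source) (g := αi)
          (f := fun v : bd × ℝ => (αb.symm v.1, v.2)) hαis ?_ hei
        exact (hαbs'.comp contMDiffOn_fst hb1).prodMk_space contMDiffOn_snd
      smooth_symm := by
        have h1 : ContMDiffOn 𝓘(ℝ, E₀) 𝓘(ℝ, K × ℝ) ∞ αi.symm e.target :=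
          hαis'.mono fun q hq => hq.1
        refine ContMDiffOn.prodMk (f := fun q => αb (αi.symm q).1) (g := fun q => (αi.symm q).2)
          (hαbs.comp (contDiff_fst.contMDiff.comp_contMDiffOn h1) fun q hq => ?_)
          (contDiff_snd.contMDiff.comp_contMDiffOn h1)
        have h2 : αi.symm q ∈ αi.source := αi.map_target hq.1
        rw [hαi] at h2
        exact hαb ▸ h2.1 }
  refine ⟨c, ⟨hq₀, mem_chart_source _ _⟩, inter_subset_right, fun v hv => ⟨_, hFw v hv, rfl⟩, ?_⟩
  have hθo : IsOpen (θ '' base) := θ.isOpen_image_of_subset_source hbase inter_subset_right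
  have hθs : ∀ x ∈ θ '' base, θ.symm x ∈ base ∧ x ∈ θ.target := by
    rintro _ ⟨v, hv, rfl⟩
    rw [θ.left_inv hv.2]
    exact ⟨hv, θ.map_source hv.2⟩
  have hκ : ContDiffOn ℝ ∞ (fun x => αb.symm (θ.symm x)) (θ '' base) := by
    rw [← contMDiffOn_iff_contDiffOn]
    exact hαbs'.comp ((contMDiffOn_chart_symm (x := q₀)).mono fun x hx => (hθs x hx).2)
      fun x hx => (hθs x hx).1.1
  have hfd : ∀ v ∈ (θ '' base) ×ˢ Ico 0 δ,
      fderiv ℝ (fun x' => h (c.toFun (θ.symm x', v.2))) v.1 =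
      fderiv ℝ (fun κ => h (α (κ, v.2))) (αb.symm (θ.symm v.1)) ∘L
        fderiv ℝ (fun x => αb.symm (θ.symm x)) v.1 := by
    rintro ⟨x, t⟩ hv
    have h1 := ((hκ.contDiffAt (hθo.mem_nhds hv.1)).differentiableAt (by simp)).hasFDerivAt
    have h2 := ((hd t hv.2).differentiableAt
      (hU.mem_nhds (hbU _ (hθs x hv.1).1))).hasFDerivAt
    exact (h2.comp x h1).fderiv
  refine ContinuousOn.congr (ContinuousOn.clm_comp ?_ ?_) hfd
  · exact hc.comp (f := fun v : E₁ × ℝ => (αb.symm (θ.symm v.1), v.2))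
      ((hκ.continuousOn.comp continuousOn_fst fun v hv => hv.1).prodMk continuousOn_snd)
      fun v hv => ⟨hbU _ (hθs _ hv.1).1, hv.2⟩
  · exact (hκ.continuousOn_fderiv_of_isOpen hθo (by simp)).comp continuousOn_fst fun v hv => hv.1

end LCCharts

/-! ## Fibre products of chains -/

section Chains

variable {B₀ B₁ : FloerSpace.{u}} {F : Correspondence B₀ B₁}

theorem isEmbedding_stratum {Q P Z : Type*} [TopologicalSpace Q] [TopologicalSpace P]
    [TopologicalSpace Z] {p : Q → P} {z : Q → Z} (he : IsEmbedding fun q => (p q, z q))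
    (S : Set P) :
    IsEmbedding fun q : p ⁻¹' S => ((⟨p q, q.2⟩ : S), z q) := by
  have h1 : IsEmbedding (Prod.map (Subtype.val : S → P) (id : Z → Z)) :=
    IsEmbedding.subtypeVal.prodMap .id
  have hp : Continuous p := continuous_fst.comp he.continuous
  have hz : Continuous z := continuous_snd.comp he.continuous
  refine IsEmbedding.of_comp (by fun_prop) h1.continuous ?_
  exact he.comp IsEmbedding.subtypeVal

theorem range_stratum {Q P Z B : Type*} {p : Q → P} {z : Q → Z} {σ : P → B} {g : Z → B}
    (hr : range (fun q => (p q, z q)) = {x : P × Z | σ x.1 = g x.2}) (S : Set P) :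
    range (fun q : p ⁻¹' S => ((⟨p q, q.2⟩ : S), z q)) =
      {x : S × Z | σ x.1.1 = g x.2} := by
  ext ⟨⟨x, hx⟩, y⟩
  constructor
  · rintro ⟨⟨q, hq⟩, h⟩
    have h1 : p q = x := congrArg (fun w => w.1.1) h
    have h2 : z q = y := congrArg Prod.snd h
    have h3 : (p q, z q) ∈ {x : P × Z | σ x.1 = g x.2} := hr ▸ ⟨q, rfl⟩
    rw [h1, h2] at h3
    exact h3
  · intro h
    have h1 : (x, y) ∈ range (fun q => (p q, z q)) := by
      rw [hr]; exact h
    obtain ⟨q, hq⟩ := h1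
    obtain ⟨rfl, rfl⟩ := Prod.ext_iff.1 hq
    exact ⟨⟨q, hx⟩, rfl⟩

/-- Both strata are smooth fibre products by the same argument as for cycles, applied separately.
The collars then fit them together and at the same time give lc-smoothness of the map to B₁. -/
theorem FloerChain.exists_isFibreProduct {k m : ℤ} (hF : F.HasIndex k) (W : FloerChain B₀)
    (hW : W.HasIndex m) : ∃ T : FloerChain B₁, T.HasIndex (m + k) ∧ W.IsFibreProduct F T := by
  let Q := {x : W.dom × F.dom // W.map x.1 = F.map₀ x.2}
  have : SecondCountableTopology Q := TopologicalSpace.Subtype.secondCountableTopology _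
  let p : Q → W.dom := fun q => q.1.1
  let z : Q → F.dom := fun q => q.1.2
  have he : IsEmbedding fun q => (p q, z q) := IsEmbedding.subtypeVal
  have hr : range (fun q => (p q, z q)) = {x : W.dom × F.dom | W.map x.1 = F.map₀ x.2} :=
    Subtype.range_coe
  have hpc : Continuous p := continuous_fst.comp he.continuous
  let bd : Set Q := {q | p q ∈ W.dom.boundary}
  -- the open stratum
  obtain ⟨H₀, _, _, _, hH₀⟩ := exists_common_hilbert_model (B := B₀.toHilbertManifold)
    (σ := W.dom.onInt W.map) (g := F.map₀) fun x x' hx hx' =>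
      W.semiInfinite_int.nonempty_ker_equiv F hW hF hx hx'
  let pi : ↥(bdᶜ) → W.dom.int := fun q => ⟨p q, q.2⟩
  let pb : bd → W.dom.bd := fun q => ⟨p q, q.2⟩
  obtain ⟨_, _, hi, hiτ⟩ := W.semiInfinite_int.exists_fibreProduct F W.lcSmooth.smooth_int
    (Q := ↥(bdᶜ)) pi (fun q => z q) (isEmbedding_stratum he (W.dom.boundaryᶜ))
    (range_stratum hr (W.dom.boundaryᶜ)) H₀ hH₀
  obtain ⟨hi1, hi2, hi3⟩ := hiτ (fun q => F.map₁ (z q)) fun q => rfl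
  -- the boundary
  have hsj := fun q₀ : bd =>
    W.semiInfinite_bd.surjective_differenceD F (p := pb q₀) (z := z q₀) (hr.le ⟨q₀.1, rfl⟩)
  have hker : ∀ x x' : W.dom.bd × F.dom, W.dom.onBd W.map x.1 = F.map₀ x.2 →
      W.dom.onBd W.map x'.1 = F.map₀ x'.2 →
      Nonempty ((differenceD (B := B₀.toHilbertManifold) (W.dom.onBd W.map) F.map₀ x).ker ≃L[ℝ]
        (differenceD (B := B₀.toHilbertManifold) (W.dom.onBd W.map) F.map₀ x').ker) := by
    -- The index hypothesis concerns the open stratum only, so kernels along the boundary are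
    -- compared through it: a collar modelled on the kernel itself gives ker × ℝ ≃ H₀, and a line
    -- can be cancelled.
    have key : ∀ x : W.dom.bd × F.dom, W.dom.onBd W.map x.1 = F.map₀ x.2 → Nonempty
        (((differenceD (B := B₀.toHilbertManifold) (W.dom.onBd W.map) F.map₀ x).ker × ℝ) ≃L[ℝ]
          H₀) := by
      rintro ⟨⟨x, hx⟩, y⟩ hxy
      have : CompleteSpace (differenceD (B := B₀.toHilbertManifold) (W.dom.onBd W.map) F.map₀
        (⟨x, hx⟩, y)).ker := (ContinuousLinearMap.isClosed_ker _).completeSpace_coe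
      obtain ⟨δ, U, α, αi, αb, hδ, -, -, -, hαi, -, hsi, hαb, -, hq, -⟩ :=
        W.lcSmooth.exists_collar F.smooth₀ F.smooth₁ he hr ⟨⟨(x, y), hxy⟩, hx⟩
          (hsj ⟨⟨(x, y), hxy⟩, hx⟩) (.refl ℝ _)
      refine hsi.nonempty_equiv hi ⟨(αb.symm ⟨⟨(x, y), hxy⟩, hx⟩, δ / 2), ?_⟩
      rw [hαi, ← hαb]
      exact ⟨αb.map_target hq, by constructor <;> linarith⟩
    intro x x' hx hx'
    have h1 : CompleteSpace (differenceD (B := B₀.toHilbertManifold) (W.dom.onBd W.map) F.map₀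
      x).ker := (ContinuousLinearMap.isClosed_ker _).completeSpace_coe
    have h2 : CompleteSpace (differenceD (B := B₀.toHilbertManifold) (W.dom.onBd W.map) F.map₀
      x').ker := (ContinuousLinearMap.isClosed_ker _).completeSpace_coe
    exact nonempty_equiv_of_prod_real ⟨(key x hx).some.trans (key x' hx').some.symm⟩
  obtain ⟨H₁, _, _, _, hH₁⟩ := exists_common_hilbert_model hker
  obtain ⟨_, _, hb, hbτ⟩ := W.semiInfinite_bd.exists_fibreProduct F W.lcSmooth.smooth_bd
    (Q := bd) pb (fun q => z q) (isEmbedding_stratum he W.dom.boundary)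
    (range_stratum hr W.dom.boundary) H₁ hH₁
  obtain ⟨hb1, hb2, -⟩ := hbτ (fun q => F.map₁ (z q)) fun q => rfl
  have hchart : ∀ q₀ : bd, ∃ c : LCChart bd H₀ H₁, q₀ ∈ c.base ∧
      c.base ⊆ (chartAt H₁ q₀).source ∧
      (∀ v ∈ c.base ×ˢ Ico 0 c.ε, F.map₁ (z (c.toFun v)) ∈
        (chartAt B₁.model (F.map₁ (z q₀))).source) ∧
      ContinuousOn (fun x : H₁ × ℝ => fderiv ℝ (fun x' => chartAt B₁.model (F.map₁ (z q₀))
        (F.map₁ (z (c.toFun ((chartAt H₁ q₀).symm x', x.2))))) x.1)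
        ((chartAt H₁ q₀ '' c.base) ×ˢ Ico 0 c.ε) := by
    intro q₀
    obtain ⟨δ, U, α, αi, αb, hδ, hU, hα, hαo, hαi, hαiα, hsi, hαb, hαbα, hq₀, hsb, hχ, hd, hc⟩ :=
      W.lcSmooth.exists_collar F.smooth₀ F.smooth₁ he hr q₀ (hsj q₀) (hH₁ (pb q₀, z q₀) (hr.le ⟨q₀.1, rfl⟩)).some
    obtain ⟨c, h1, h2, h3, h4⟩ := exists_lcChart_of_collar hδ hα hαo hαi hαiα
      (hsi.contMDiffOn hi) (hsi.contMDiffOn_symm hi) hαb hαbα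
      (hsb.contMDiffOn hb) (hsb.contMDiffOn_symm hb) hq₀
      (h := fun q => chartAt B₁.model (F.map₁ (z q₀)) (F.map₁ (z q))) hd hc
    refine ⟨c, h1, h2, fun v hv => ?_, h4⟩
    obtain ⟨w, hw, hvw⟩ := h3 v hv
    rw [hvw]
    exact hχ w hw
  let D : LCManifold.{u} :=
    { carrier := Q
      boundary := bd
      isClosed_boundary := W.dom.isClosed_boundary.preimage hpc
      intModel := H₀
      bdModel := H₁
      exists_lcChart := fun q => (hchart q).imp fun c hc => hc.1 }
  let T : FloerChain B₁ :=
    { dom := D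
      map := fun q => F.map₁ (z q)
      lcSmooth := ⟨(ContMDiff.continuous F.smooth₁).comp (continuous_snd.comp he.continuous),
        hi1, hb1, hchart⟩
      compactness := W.compactness.fibreProduct F W.lcSmooth.continuous p z he hr fun q => rfl
      semiInfinite_int := hi2
      semiInfinite_bd := hb2 }
  refine ⟨T, fun q => (hi3 q).trans ?_, p, z, pi, pb, fun _ => rfl, fun _ => rfl, he, hr, hi, hb,
    fun _ => rfl⟩
  rw [hW, hF]

end Chains

end FloerBordism

end

theorem mainTheorem7 (B₀ B₁ : FloerSpace.{u}) (k : ℤ) (F : Correspondence B₀ B₁)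
    (hF : F.HasIndex k) :
    -- fibre products of cycles with `F` exist as cycles, and the index is shifted by `k`
    (∀ (n : ℤ) (σ : CycleOfIndex B₀ n), ∃ τ : CycleOfIndex B₁ (n + k), σ.1.IsFibreProduct F τ.1) ∧
    -- likewise for chains of depth one, and `∂(W ×_{B₀} F) = ∂W ×_{B₀} F`
    (∀ (m : ℤ) (W : FloerChain B₀), W.HasIndex m →
      ∃ T : FloerChain B₁, T.HasIndex (m + k) ∧ W.IsFibreProduct F T ∧
        ∀ (σ : FloerCycle B₀) (τ : FloerCycle B₁), W.BoundaryIs σ → σ.IsFibreProduct F τ →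
          T.BoundaryIs τ) ∧
    -- fibre product with `F` is a well-defined homomorphism on bordism groups
    ∃! Φ : ∀ n : ℤ, Bord B₀ n →ₗ[ZMod 2] Bord B₁ (n + k),
      ∀ (n : ℤ) (σ : CycleOfIndex B₀ n) (τ : CycleOfIndex B₁ (n + k)),
        σ.1.IsFibreProduct F τ.1 → Φ n (Bord.mk σ) = Bord.mk τ := by
  have hb : ∀ (m : ℤ) (W : FloerChain B₀), W.HasIndex m →
      ∃ T : FloerChain B₁, T.HasIndex (m + k) ∧ W.IsFibreProduct F T := fun m W hW =>
    W.exists_isFibreProduct hF hW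
  refine ⟨fun n σ => FloerCycle.exists_isFibreProduct F hF σ, fun m W hW => ?_,
    existsUnique_bordism_hom hF hb⟩
  obtain ⟨T, hT, hWT⟩ := hb m W hW
  exact ⟨T, hT, hWT, fun σ τ hσ hτ => hWT.boundaryIs hσ hτ⟩
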